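/- On the unit sphere $S^2\subset\mathbb R^3$ with its angular distance $|ab|$, write $ab$ for the shorter great-circle arc joining two non-antipodal points (with $aa=\{a\}$). A set $C\subseteq S^2$ is convex if $|ab|<\pi$ and $ab\subseteq C$ for all $a,b\in C$; a convex body is a closed convex set with non-empty interior. A hemisphere is a closed spherical disk of radius $\pi/2$. A lune is the intersection of two hemispheres whose centres are neither equal nor antipodal; its thickness is the distance between the midpoints of the two great semicircles bounding it. The thickness $\Delta(C)$ of a convex body $C$ is the minimal thickness of a lune containing $C$, and $C$ is reduced if $\Delta(R)<\Delta(C)$ for every convex body $R\subsetneq C$. A spherical $n$-gon ($n\ge 3$) is the convex hull (intersection of all convex supersets) of $n$ points that lie in a common convex set and none of which lies in the convex hull of the others; these points are its vertices. It is regular if its sides have equal length and its interior angles are equal. Its perimeter is the sum of the lengths of its sides. Theorem. Let $n\ge 3$ and $\omega\in(0,\pi/2)$. If $V$ is a regular spherical $n$-gon with $\Delta(V)=\omega$ and $W$ is a reduced spherical $n$-gon with $\Delta(W)=\omega$, then $$\operatorname{perim}(V)\le \operatorname{perim}(W).$$ Moreover, if $n$ is odd, then a regular spherical $n$-gon of thickness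 $\omega$ exists and every such polygon is reduced; thus it has the minimum perimeter among all reduced spherical $n$-gons of thickness $\omega$. -/

import Mathlib

noncomputable section

/-- Euclidean three-space. -/
abbrev E3 : Type := EuclideanSpace ℝ (Fin 3)

/-- The unit sphere of `E3`, with the subspace topology. -/
abbrev S2 : Type := Metric.sphere (0 : E3) 1

/-- Spherical distance: the length of the shorter great-circle arc between two points. -/
def sphDist (a b : S2) : ℝ := InnerProductGeometry.angle (a : E3) (b : E3)

/-- The arc `ab`. For `a ≠ b` that are not antipodes this is the shorter part of the great circle
through `a` and `b`; for `a = b` it is the single point `a`. (It is never used for antipodes.) -/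
def sphArc (a b : S2) : Set S2 :=
  {x | ∃ s t : ℝ, 0 ≤ s ∧ 0 ≤ t ∧ (x : E3) = s • (a : E3) + t • (b : E3)}

/-- Convex sets on the sphere: any two points are at distance less than `π` and the arc joining
them lies in the set. -/
def IsSphConvex (C : Set S2) : Prop :=
  ∀ a ∈ C, ∀ b ∈ C, sphDist a b < Real.pi ∧ sphArc a b ⊆ C

/-- Convex bodies: closed convex sets with non-empty interior. -/
def IsSphConvexBody (C : Set S2) : Prop :=
  IsClosed C ∧ IsSphConvex C ∧ (interior C).Nonempty

/-- The convex hull: the intersection of all convex sets containing `A`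
(meaningful when `A` is contained in some convex set). -/
def sphHull (A : Set S2) : Set S2 := ⋂₀ {C | IsSphConvex C ∧ A ⊆ C}

/-- The hemisphere with centre `k`: the spherical disk of radius `π / 2`. -/
def hemisphere (k : S2) : Set S2 := {x | sphDist k x ≤ Real.pi / 2}

/-- The great circle bounding the hemisphere with centre `k`. -/
def boundingCircle (k : S2) : Set S2 := {x | sphDist k x = Real.pi / 2}

/-- `a`, `b` are the centres of two hemispheres that form a lune: they are neither equal nor
antipodal. -/
def FormLune (a b : S2) : Prop := a ≠ b ∧ (a : E3) ≠ -(b : E3)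

/-- The lune that is the intersection of the hemispheres with centres `a` and `b`. -/
def lune (a b : S2) : Set S2 := hemisphere a ∩ hemisphere b

/-- For hemispheres `G`, `H` with centres `a`, `b`: the semicircle `G/H`, the part of the
boundary of `G` contained in `G ∩ H`. -/
def luneSide (a b : S2) : Set S2 := boundingCircle a ∩ lune a b

/-- `c` is the centre (midpoint) of the great semicircle `A`: the point of `A` whose distance
to every point of `A` is at most `π / 2`. -/
def IsSemicircleCenter (c : S2) (A : Set S2) : Prop :=
  c ∈ A ∧ ∀ x ∈ A, sphDist c x ≤ Real.pi / 2

/-- The lune with hemisphere centres `a`, `b` has thickness `t`: the distance between the centres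
of its two bounding semicircles is `t`. -/
def LuneHasThickness (a b : S2) (t : ℝ) : Prop :=
  ∃ c d : S2, IsSemicircleCenter c (luneSide a b) ∧ IsSemicircleCenter d (luneSide b a) ∧
    t = sphDist c d

/-- The thickness of `C`: the minimal thickness of a lune containing `C`. -/
def thickness (C : Set S2) : ℝ :=
  sInf {t | ∃ a b : S2, FormLune a b ∧ C ⊆ lune a b ∧ LuneHasThickness a b t}

/-- Reduced convex bodies: every convex body properly contained in `C` has smaller thickness. -/
def IsReducedBody (C : Set S2) : Prop :=
  IsSphConvexBody C ∧ ∀ R : Set S2, IsSphConvexBody R → R ⊂ C → thickness R < thickness C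

/-- The determinant of three points of the sphere; it is positive iff, seen from outside the
sphere, `c` lies strictly to the left of the great circle directed from `a` to `b`. -/
def orient (a b c : S2) : ℝ :=
  Matrix.det (Matrix.of ![⇑(a : E3), ⇑(b : E3), ⇑(c : E3)])

/-- `v 0, …, v (n - 1)` are the vertices, in counterclockwise order, of a spherically convex
`n`-gon: `n ≥ 3`, the points lie in a convex set, none of them is in the convex hull of the
remaining ones, and for each `i` all the other points lie to the left of the side from `v i`
to `v (i + 1)`. Indices are taken modulo `n`. -/
structure IsConvexPolygon {n : ℕ} [NeZero n] (v : Fin n → S2) : Prop where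
  three_le : 3 ≤ n
  subset_convex : ∃ C : Set S2, IsSphConvex C ∧ Set.range v ⊆ C
  notMem_hull : ∀ i, v i ∉ sphHull (v '' {i}ᶜ)
  counterclockwise : ∀ i j, j ≠ i → j ≠ i + 1 → 0 < orient (v i) (v (i + 1)) (v j)

/-- The polygon with vertices `v`, as a subset of the sphere. -/
def polygon {n : ℕ} (v : Fin n → S2) : Set S2 := sphHull (Set.range v)

/-- The length of the `i`-th side, which joins `v i` to `v (i + 1)` (indices modulo `n`). -/
def sideLength {n : ℕ} [NeZero n] (v : Fin n → S2) (i : Fin n) : ℝ := sphDist (v i) (v (i + 1))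

/-- The perimeter: the sum of the side lengths. -/
def perim {n : ℕ} [NeZero n] (v : Fin n → S2) : ℝ := ∑ i, sideLength v i

/-- The component of `a` orthogonal to `p`: for `a ≠ ± p`, a tangent vector at `p` in the
direction of the arc from `p` to `a`. -/
def tangentTo (p a : S2) : E3 := (a : E3) - inner ℝ (p : E3) (a : E3) • (p : E3)

/-- The spherical angle at `p` between the arcs `pa` and `pb`. -/
def sphAngle (a p b : S2) : ℝ := InnerProductGeometry.angle (tangentTo p a) (tangentTo p b)

/-- The interior angle at the vertex `v i` (indices modulo `n`). -/
def interiorAngle {n : ℕ} [NeZero n] (v : Fin n → S2) (i : Fin n) : ℝ :=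
  sphAngle (v (i - 1)) (v i) (v (i + 1))

/-- Regular spherical polygons: all sides have equal length and all interior angles are equal. -/
def IsRegularPolygon {n : ℕ} [NeZero n] (v : Fin n → S2) : Prop :=
  IsConvexPolygon v ∧ (∀ i j, sideLength v i = sideLength v j) ∧
    ∀ i j, interiorAngle v i = interiorAngle v j

end

noncomputable section

open InnerProductGeometry

/-! ### Vector algebra in three-space -/

/-! A hemisphere contains `C` iff its centre lies in the dual cone of `C`, and the lune of the
hemispheres centred at `a`, `b` has thickness `π` minus the angle between `a` and `b`
(`luneHasThickness_iff`). So thickness is governed by a pair of unit vectors of the dual cone that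
are as far apart as possible (`IsWidthPair`). A first-order variation and the bipolar theorem put
the centres of both bounding semicircles into `C` (`IsWidthPair.exists_center`).

Let `W` be reduced of thickness `ω < π / 2`. Cutting off a corner makes `W` thinner, so in the limit
every vertex is the centre of a semicircle of some minimal lune (`exists_widthPair_center`), and the
other semicircle contains a side (`IsWidthPair.exists_eq_pole`). Seen in the dual cone, two such
chords cannot be opposite sides of a convex quadrilateral, since its diagonals would have too large
a sum (`IsWidthPair.eq_of_cross`). This forces `n = 2 * m + 1`, with vertex `i` at distance `ω` from
the side `i + m` (`exists_opposite_chords`).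

The feet of these perpendiculars divide the sides. Two right triangles with common hypotenuse from
vertex `i` to vertex `i + m + 1` have a leg `ω` each, so their other legs have a common length `x
i`, and the perimeter is twice the sum of the `x i`. The directions of the two sides at the feet
enclose the angle `pairAngle (cos ω) (x i)`, up to a sign. Passing through all chords reverses a
direction, so these angles add up to at least `π` (`HasOppositeChords.pi_le_sum_pairAngle`). As
`pairAngle` is concave, Jensen's inequality bounds the sum of the `x i` below by `n * y`, where
`pairAngle (cos ω) y = π / n` (`card_mul_le_sum`).

A regular polygon is inscribed in a circle (`IsRegularPolygon.exists_isInscribed`). For odd `n` its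
thickness is the sum of inradius and circumradius (`IsInscribed.cos_thickness`), and its half side
is exactly `y` (`IsInscribed.exists_perim_eq`). For even `n` there is no reduced `W`, so nothing is
to be compared. A smaller convex body misses a vertex of the regular polygon, and tilting the
hemisphere tangent there gives a thinner lune (`IsInscribed.isReducedBody`). Existence follows from
the intermediate value theorem applied to the circumradius (`exists_radius`). -/

lemma inner_coord (a b : E3) : inner ℝ a b = a 0 * b 0 + a 1 * b 1 + a 2 * b 2 := by
  simp only [PiLp.inner_apply, Fin.sum_univ_three, RCLike.inner_apply, conj_trivial]
  ring

lemma E3.ext {a b : E3} (h0 : a 0 = b 0) (h1 : a 1 = b 1) (h2 : a 2 = b 2) : a = b := by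
  ext i; fin_cases i
  exacts [h0, h1, h2]

/-- The cross product of two vectors. -/
def cr (a b : E3) : E3 :=
  !₂[a 1 * b 2 - a 2 * b 1, a 2 * b 0 - a 0 * b 2, a 0 * b 1 - a 1 * b 0]

@[simp] lemma cr_zero (a b : E3) : cr a b 0 = a 1 * b 2 - a 2 * b 1 := rfl
@[simp] lemma cr_one (a b : E3) : cr a b 1 = a 2 * b 0 - a 0 * b 2 := rfl
@[simp] lemma cr_two (a b : E3) : cr a b 2 = a 0 * b 1 - a 1 * b 0 := rfl

/-- The determinant of three vectors. -/
def det3 (a b c : E3) : ℝ :=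
  a 0 * (b 1 * c 2 - b 2 * c 1) + a 1 * (b 2 * c 0 - b 0 * c 2) + a 2 * (b 0 * c 1 - b 1 * c 0)

lemma orient_eq (a b c : S2) : orient a b c = det3 a b c := by
  simp [orient, det3, Matrix.det_fin_three]
  ring

lemma inner_cr (a b c : E3) : inner ℝ (cr a b) c = det3 a b c := by
  simp only [inner_coord, det3, cr_zero, cr_one, cr_two]; ring

lemma det3_rotate (a b c : E3) : det3 a b c = det3 b c a := by
  simp only [det3]; ring

lemma det3_swap (a b c : E3) : det3 a b c = -det3 b a c := by
  simp only [det3]; ring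

lemma det3_swap_right (a b c : E3) : det3 a b c = -det3 a c b := by
  simp only [det3]; ring

lemma det3_self_left (a c : E3) : det3 a a c = 0 := by simp only [det3]; ring
lemma det3_self_right (a c : E3) : det3 a c c = 0 := by simp only [det3]; ring
lemma det3_self_outer (a c : E3) : det3 a c a = 0 := by simp only [det3]; ring

lemma det3_add_right (a b c d : E3) : det3 a b (c + d) = det3 a b c + det3 a b d := by
  simp only [det3, PiLp.add_apply]; ring

lemma det3_smul_right (a b c : E3) (r : ℝ) : det3 a b (r • c) = r * det3 a b c := by
  simp only [det3, PiLp.smul_apply, smul_eq_mul]; ring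

lemma det3_add_mid (a b c d : E3) : det3 a (b + d) c = det3 a b c + det3 a d c := by
  simp only [det3, PiLp.add_apply]; ring

lemma det3_smul_mid (a b c : E3) (r : ℝ) : det3 a (r • b) c = r * det3 a b c := by
  simp only [det3, PiLp.smul_apply, smul_eq_mul]; ring

lemma det3_add_left (a b c d : E3) : det3 (a + d) b c = det3 a b c + det3 d b c := by
  simp only [det3, PiLp.add_apply]; ring

lemma det3_smul_left (a b c : E3) (r : ℝ) : det3 (r • a) b c = r * det3 a b c := by
  simp only [det3, PiLp.smul_apply, smul_eq_mul]; ring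

lemma inner_cr_left (a b : E3) : inner ℝ (cr a b) a = 0 := by
  rw [inner_cr, det3_self_outer]

lemma inner_cr_right (a b : E3) : inner ℝ (cr a b) b = 0 := by
  rw [inner_cr, det3_self_right]

lemma inner_cr_cr (a b c d : E3) :
    inner ℝ (cr a b) (cr c d) = inner ℝ a c * inner ℝ b d - inner ℝ a d * inner ℝ b c := by
  simp only [inner_coord, cr_zero, cr_one, cr_two]; ring

lemma cr_cr (a b c : E3) : cr (cr a b) c = inner ℝ a c • b - inner ℝ b c • a := by
  apply E3.ext <;>
  simp only [inner_coord, cr_zero, cr_one, cr_two, PiLp.sub_apply, PiLp.smul_apply,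
    smul_eq_mul] <;> ring

/-- For a convex quadrilateral all four coefficients are nonnegative, and both sides represent the
point where the diagonals `ac` and `bd` cross. -/
lemma four_vector_relation (a b c d : E3) :
    det3 b c d • a + det3 a b d • c = det3 a c d • b + det3 a b c • d := by
  apply E3.ext <;>
  simp only [det3, PiLp.add_apply, PiLp.smul_apply, smul_eq_mul] <;> ring

/-- Cramer's rule. -/
lemma det3_smul_eq (a b c x : E3) :
    det3 a b c • x = det3 x b c • a + det3 a x c • b + det3 a b x • c := by
  apply E3.ext <;>
  simp only [det3, PiLp.add_apply, PiLp.smul_apply, smul_eq_mul] <;> ring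

/-- The three-term Plücker relation, which carries positivity of determinants from neighbouring
indices to distant ones. -/
lemma plucker (p a b c d : E3) :
    det3 p a c * det3 p b d = det3 p a b * det3 p c d + det3 p a d * det3 p b c := by
  simp only [det3]; ring

/-- Expansion of an inner product in the frame `a`, `b`, `a × b`. -/
lemma gram_expansion (a b p q : E3) (ha : inner ℝ a a = (1 : ℝ)) (hb : inner ℝ b b = (1 : ℝ)) :
    (1 - inner ℝ a b ^ 2) * inner ℝ p q = det3 a b p * det3 a b q +
      (inner ℝ p a * inner ℝ q a + inner ℝ p b * inner ℝ q b -
        inner ℝ a b * (inner ℝ p a * inner ℝ q b + inner ℝ p b * inner ℝ q a)) := by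
  have key : (inner ℝ a a * inner ℝ b b - inner ℝ a b ^ 2) * inner ℝ p q =
      det3 a b p * det3 a b q +
      (inner ℝ b b * (inner ℝ p a * inner ℝ q a) + inner ℝ a a * (inner ℝ p b * inner ℝ q b) -
        inner ℝ a b * (inner ℝ p a * inner ℝ q b + inner ℝ p b * inner ℝ q a)) := by
    simp only [inner_coord, det3]; ring
  rw [ha, hb] at key
  linarith

lemma inner_self_of_norm {a : E3} (ha : ‖a‖ = 1) : inner ℝ a a = (1 : ℝ) := by
  rw [real_inner_self_eq_norm_sq, ha]; norm_num

lemma norm_of_inner_self {a : E3} (ha : inner ℝ a a = (1 : ℝ)) : ‖a‖ = 1 := by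
  rw [real_inner_self_eq_norm_sq] at ha
  nlinarith [norm_nonneg a]

lemma S2.norm (a : S2) : ‖(a : E3)‖ = 1 := by simp

lemma S2.inner_self (a : S2) : inner ℝ (a : E3) (a : E3) = (1 : ℝ) :=
  inner_self_of_norm a.norm

/-- A vector of norm one, as a point of the sphere. -/
def S2.mk (a : E3) (ha : ‖a‖ = 1) : S2 := ⟨a, by simpa using ha⟩

@[simp] lemma S2.coe_mk (a : E3) (ha : ‖a‖ = 1) : ((S2.mk a ha : S2) : E3) = a := rfl

/-- The radial projection of a nonzero vector to the sphere. -/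
def S2.normalize (a : E3) (ha : a ≠ 0) : S2 :=
  S2.mk (‖a‖⁻¹ • a) (by rw [norm_smul, norm_inv, norm_norm, inv_mul_cancel₀ (norm_ne_zero_iff.2 ha)])

lemma S2.coe_normalize (a : E3) (ha : a ≠ 0) : ((S2.normalize a ha : S2) : E3) = ‖a‖⁻¹ • a := rfl

lemma S2.ext' {a b : S2} (h : (a : E3) = b) : a = b := Subtype.ext h

lemma angle_unit {a b : E3} (ha : ‖a‖ = 1) (hb : ‖b‖ = 1) :
    angle a b = Real.arccos (inner ℝ a b) := by
  simp [InnerProductGeometry.angle, ha, hb]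

lemma sphDist_eq (a b : S2) : sphDist a b = Real.arccos (inner ℝ (a : E3) (b : E3)) :=
  angle_unit a.norm b.norm

lemma cos_sphDist (a b : S2) : Real.cos (sphDist a b) = inner ℝ (a : E3) (b : E3) := by
  simp [sphDist, InnerProductGeometry.cos_angle]

lemma abs_inner_le_one {a b : E3} (ha : ‖a‖ = 1) (hb : ‖b‖ = 1) : |inner ℝ a b| ≤ (1 : ℝ) := by
  have := abs_real_inner_le_norm a b
  rwa [ha, hb, one_mul] at this

lemma inner_lt_one_of_ne {a b : E3} (ha : ‖a‖ = 1) (hb : ‖b‖ = 1) (h : a ≠ b) :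
    inner ℝ a b < (1 : ℝ) := by
  exact inner_lt_one_iff_real_of_norm_eq_one ha hb |>.2 h

lemma neg_one_lt_inner_of_ne {a b : E3} (ha : ‖a‖ = 1) (hb : ‖b‖ = 1) (h : a ≠ -b) :
    (-1 : ℝ) < inner ℝ a b := by
  have := inner_lt_one_of_ne ha (b := -b) (by simpa using hb) h
  rw [inner_neg_right] at this
  linarith

lemma norm_sq_sub_smul {a b : E3} (ha : ‖a‖ = 1) (hb : ‖b‖ = 1) :
    ‖a - (inner ℝ a b : ℝ) • b‖ ^ 2 = 1 - (inner ℝ a b : ℝ) ^ 2 := by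
  rw [← real_inner_self_eq_norm_sq]
  simp only [inner_sub_left, inner_sub_right, real_inner_smul_left, real_inner_smul_right,
    inner_self_of_norm ha, inner_self_of_norm hb, real_inner_comm a b]
  ring

/-! ### Lunes -/

lemma ne_zero_of_norm_one {a : E3} (ha : ‖a‖ = 1) : a ≠ 0 := by
  rintro rfl
  simp at ha

lemma mem_hemisphere {k x : S2} : x ∈ hemisphere k ↔ 0 ≤ (inner ℝ (k : E3) (x : E3) : ℝ) := by
  simp [hemisphere, sphDist_eq, Real.arccos_le_pi_div_two]

lemma mem_boundingCircle {k x : S2} :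
    x ∈ boundingCircle k ↔ (inner ℝ (k : E3) (x : E3) : ℝ) = 0 := by
  simp [boundingCircle, sphDist_eq, Real.arccos_eq_pi_div_two]

lemma mem_luneSide {a b x : S2} : x ∈ luneSide a b ↔
    (inner ℝ (a : E3) (x : E3) : ℝ) = 0 ∧ 0 ≤ (inner ℝ (b : E3) (x : E3) : ℝ) := by
  simp only [luneSide, lune, Set.mem_inter_iff, mem_boundingCircle, mem_hemisphere]
  constructor
  · rintro ⟨h1, h2, h3⟩
    exact ⟨h1, h3⟩
  · rintro ⟨h1, h2⟩
    exact ⟨h1, h1.ge, h2⟩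

lemma FormLune.symm {a b : S2} (h : FormLune a b) : FormLune b a :=
  ⟨h.1.symm, fun h' => h.2 (by rw [h', neg_neg])⟩

lemma FormLune.sq_lt_one {a b : S2} (h : FormLune a b) :
    (inner ℝ (a : E3) (b : E3) : ℝ) ^ 2 < 1 := by
  have h1 := inner_lt_one_of_ne a.norm b.norm (fun h' => h.1 (S2.ext' h'))
  have h2 := neg_one_lt_inner_of_ne a.norm b.norm h.2
  nlinarith

/-- When `a ≠ ±b`, the vectors `a`, `b`, `a × b` form a basis. Vector identities below are often
checked by pairing with these three. -/
lemma eq_zero_of_orthogonal {a b y : E3} (ha : ‖a‖ = 1) (hb : ‖b‖ = 1)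
    (hab : (inner ℝ a b : ℝ) ^ 2 < 1) (h1 : (inner ℝ y a : ℝ) = 0) (h2 : (inner ℝ y b : ℝ) = 0)
    (h3 : det3 a b y = 0) : y = 0 := by
  have := gram_expansion a b y y (inner_self_of_norm ha) (inner_self_of_norm hb)
  rw [h1, h2, h3] at this
  have h4 : (inner ℝ y y : ℝ) = 0 := by
    have : (1 - (inner ℝ a b : ℝ) ^ 2) * inner ℝ y y = 0 := by rw [this]; ring
    rcases mul_eq_zero.1 this with h | h
    · linarith
    · exact h
  exact inner_self_eq_zero.1 h4

/-- The endpoints of the semicircle are the two unit multiples of `a × b`. A centre within `π / 2`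
of both is orthogonal to `a × b`, hence lies in the plane of `a` and `b`; there, orthogonality to
`a`, the sign against `b` and the norm determine it. -/
lemma isSemicircleCenter_iff {a b c : S2} (h : FormLune a b) :
    IsSemicircleCenter c (luneSide a b) ↔
      (c : E3) = (√(1 - (inner ℝ (a : E3) (b : E3) : ℝ) ^ 2))⁻¹ •
        ((b : E3) - (inner ℝ (a : E3) (b : E3) : ℝ) • (a : E3)) := by
  set p : ℝ := inner ℝ (a : E3) (b : E3) with hp
  have hp1 : p ^ 2 < 1 := h.sq_lt_one
  have hs : 0 < √(1 - p ^ 2) := Real.sqrt_pos.2 (by linarith)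
  have hss : √(1 - p ^ 2) ^ 2 = 1 - p ^ 2 := Real.sq_sqrt (by linarith)
  have haa := a.inner_self
  have hbb := b.inner_self
  have hba : (inner ℝ (b : E3) (a : E3) : ℝ) = p := by rw [real_inner_comm]
  constructor
  · rintro ⟨hc, hmax⟩
    rw [mem_luneSide] at hc
    obtain ⟨hac, hbc⟩ := hc
    have hcr : cr a b ≠ 0 := by
      intro h0
      have := inner_cr_cr a b a b
      rw [h0, inner_zero_left, haa, hbb, hba, ← hp] at this
      nlinarith
    have side : ∀ e : ℝ, e ≠ 0 → 0 ≤ (inner ℝ (c : E3) (e • cr a b) : ℝ) := by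
      intro e he
      have hne : e • cr (a : E3) b ≠ 0 := smul_ne_zero he hcr
      have hmem : S2.normalize _ hne ∈ luneSide a b := by
        rw [mem_luneSide, S2.coe_normalize]
        simp only [real_inner_smul_right, real_inner_comm (cr (a : E3) b), inner_cr_left,
          inner_cr_right]
        simp
      have := hmax _ hmem
      have h2 : (0 : ℝ) ≤ inner ℝ (c : E3) (S2.normalize _ hne : E3) := mem_hemisphere.1 this
      rw [S2.coe_normalize, real_inner_smul_right] at h2
      exact (mul_nonneg_iff_of_pos_left (inv_pos.2 (norm_pos_iff.2 hne))).1 h2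
    have hdet : det3 a b c = 0 := by
      have h1 := side 1 one_ne_zero
      have h2 := side (-1) (by norm_num)
      rw [real_inner_smul_right, real_inner_comm, inner_cr] at h1 h2
      linarith
    set r : ℝ := (inner ℝ (c : E3) (b : E3) : ℝ) / (1 - p ^ 2) with hr
    have hr0 : 0 ≤ r := div_nonneg (by rwa [real_inner_comm]) (by linarith)
    have hca : (inner ℝ (c : E3) (a : E3) : ℝ) = 0 := by rw [real_inner_comm]; exact hac
    have hy : (c : E3) - r • ((b : E3) - p • (a : E3)) = 0 := by
      apply eq_zero_of_orthogonal a.norm b.norm h.sq_lt_one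
      · simp only [inner_sub_left, real_inner_smul_left, hca, haa, hba]; ring
      · simp only [inner_sub_left, real_inner_smul_left, hbb, ← hp]
        rw [hr]
        field_simp [show (1 - p ^ 2) ≠ 0 by linarith]
        ring
      · rw [sub_eq_add_neg, ← neg_smul, det3_add_right, det3_smul_right, sub_eq_add_neg,
          ← neg_smul, det3_add_right, det3_smul_right, det3_self_right, det3_self_outer, hdet]
        ring
    rw [sub_eq_zero] at hy
    have hn : r ^ 2 * (1 - p ^ 2) = 1 := by
      have := c.inner_self
      rw [hy] at this
      simp only [inner_sub_left, inner_sub_right, real_inner_smul_left, real_inner_smul_right,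
        haa, hbb, hba, ← hp] at this
      linarith
    have : r = (√(1 - p ^ 2))⁻¹ := by
      apply eq_inv_of_mul_eq_one_left
      rw [← hss] at hn
      have h0 : 0 ≤ r * √(1 - p ^ 2) := by positivity
      nlinarith
    rw [← this]; exact hy
  · intro hc
    refine ⟨?_, ?_⟩
    · rw [mem_luneSide, hc]
      simp only [real_inner_smul_right, inner_sub_right, haa, hbb, hba, ← hp]
      refine ⟨by ring, mul_nonneg (inv_nonneg.2 hs.le) (by nlinarith)⟩
    · intro x hx
      rw [mem_luneSide] at hx
      apply mem_hemisphere.2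
      rw [hc]
      simp only [real_inner_smul_left, inner_sub_left, hx.1]
      have := hx.2
      rw [mul_zero, sub_zero]
      exact mul_nonneg (inv_nonneg.2 hs.le) this

/-- The explicit centres have inner product `-⟪a, b⟫`. Thin lunes therefore correspond to hemisphere
centres that are far apart. -/
lemma luneHasThickness_iff {a b : S2} (h : FormLune a b) (t : ℝ) :
    LuneHasThickness a b t ↔ t = Real.arccos (-(inner ℝ (a : E3) (b : E3) : ℝ)) := by
  set p : ℝ := inner ℝ (a : E3) (b : E3) with hp
  have hp1 : p ^ 2 < 1 := h.sq_lt_one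
  have hs : 0 < √(1 - p ^ 2) := Real.sqrt_pos.2 (by linarith)
  have hss : √(1 - p ^ 2) ^ 2 = 1 - p ^ 2 := Real.sq_sqrt (by linarith)
  have haa := a.inner_self
  have hbb := b.inner_self
  have hba : (inner ℝ (b : E3) (a : E3) : ℝ) = p := by rw [real_inner_comm]
  have key : ∀ c d : S2, IsSemicircleCenter c (luneSide a b) →
      IsSemicircleCenter d (luneSide b a) → sphDist c d = Real.arccos (-p) := by
    intro c d hc hd
    rw [isSemicircleCenter_iff h] at hc
    rw [isSemicircleCenter_iff h.symm, hba] at hd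
    rw [sphDist_eq, hc, hd, ← hp]
    congr 1
    simp only [real_inner_smul_left, real_inner_smul_right, inner_sub_left, inner_sub_right,
      haa, hbb, hba, ← hp]
    have : (√(1 - p ^ 2))⁻¹ * ((√(1 - p ^ 2))⁻¹ * (p - p * 1 - p * (1 - p * p))) =
        (√(1 - p ^ 2) ^ 2)⁻¹ * (-p * (1 - p ^ 2)) := by
      rw [← inv_pow]; ring
    have h2 : (1 - p ^ 2) ≠ 0 := by linarith
    trans (√(1 - p ^ 2) ^ 2)⁻¹ * (-p * (1 - p ^ 2))
    · rw [← inv_pow]; ring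
    · rw [hss]; field_simp
  have unit : ∀ (a b : S2), FormLune a b →
      ‖(√(1 - (inner ℝ (a : E3) (b : E3) : ℝ) ^ 2))⁻¹ •
        ((b : E3) - (inner ℝ (a : E3) (b : E3) : ℝ) • (a : E3))‖ = 1 := by
    intro a b h
    have h1 := norm_sq_sub_smul b.norm a.norm
    rw [real_inner_comm] at h1
    have h2 := h.sq_lt_one
    have h3 : ‖(b : E3) - (inner ℝ (a : E3) (b : E3) : ℝ) • (a : E3)‖ =
        √(1 - (inner ℝ (a : E3) (b : E3) : ℝ) ^ 2) := by
      rw [← h1, Real.sqrt_sq (norm_nonneg _)]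
    rw [norm_smul, h3, norm_inv, Real.norm_of_nonneg (Real.sqrt_nonneg _), inv_mul_cancel₀]
    exact (Real.sqrt_pos.2 (by linarith)).ne'
  constructor
  · rintro ⟨c, d, hc, hd, rfl⟩
    exact key c d hc hd
  · rintro rfl
    have hc := (isSemicircleCenter_iff (c := S2.mk _ (unit a b h)) h).2 rfl
    have hd := (isSemicircleCenter_iff (c := S2.mk _ (unit b a h.symm)) h.symm).2 rfl
    exact ⟨_, _, hc, hd, (key _ _ hc hd).symm⟩

/-! ### Dual cones and width pairs -/

/-- The cone of all vectors having nonnegative inner product with every point of `C`. -/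
def dualCone (C : Set S2) : Set E3 := {k | ∀ x ∈ C, 0 ≤ (inner ℝ k (x : E3) : ℝ)}

lemma dualCone_anti {C D : Set S2} (h : C ⊆ D) : dualCone D ⊆ dualCone C :=
  fun _ hk x hx => hk x (h hx)

lemma dualCone_add {C : Set S2} {a b : E3} (ha : a ∈ dualCone C) (hb : b ∈ dualCone C) :
    a + b ∈ dualCone C := fun x hx => by
  rw [inner_add_left]; exact add_nonneg (ha x hx) (hb x hx)

lemma dualCone_smul {C : Set S2} {a : E3} (ha : a ∈ dualCone C) {r : ℝ} (hr : 0 ≤ r) :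
    r • a ∈ dualCone C := fun x hx => by
  rw [real_inner_smul_left]; exact mul_nonneg hr (ha x hx)

lemma subset_lune_iff {C : Set S2} {a b : S2} :
    C ⊆ lune a b ↔ (a : E3) ∈ dualCone C ∧ (b : E3) ∈ dualCone C := by
  simp only [lune, Set.subset_inter_iff]
  constructor
  · exact fun h => ⟨fun x hx => mem_hemisphere.1 (h.1 hx), fun x hx => mem_hemisphere.1 (h.2 hx)⟩
  · exact fun h => ⟨fun x hx => mem_hemisphere.2 (h.1 x hx), fun x hx => mem_hemisphere.2 (h.2 x hx)⟩

/-- The unit vectors `a`, `b` are the centres of two hemispheres that contain `C` and are as far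
apart as possible. -/
structure IsWidthPair (C : Set S2) (a b : E3) : Prop where
  norm_left : ‖a‖ = 1
  norm_right : ‖b‖ = 1
  left_mem : a ∈ dualCone C
  right_mem : b ∈ dualCone C
  -- The homogeneous form allows testing with sums and perturbations that are not unit vectors.
  minimal : ∀ p ∈ dualCone C, ∀ q ∈ dualCone C,
    (inner ℝ a b : ℝ) * (‖p‖ * ‖q‖) ≤ (inner ℝ p q : ℝ)

lemma IsWidthPair.symm {C : Set S2} {a b : E3} (h : IsWidthPair C a b) : IsWidthPair C b a :=
  ⟨h.norm_right, h.norm_left, h.right_mem, h.left_mem, fun p hp q hq => by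
    rw [real_inner_comm]; exact h.minimal p hp q hq⟩

lemma IsWidthPair.of_le {C : Set S2} {a b p q : E3} (h : IsWidthPair C a b) (hp : ‖p‖ = 1)
    (hq : ‖q‖ = 1) (hpC : p ∈ dualCone C) (hqC : q ∈ dualCone C)
    (hle : (inner ℝ p q : ℝ) ≤ (inner ℝ a b : ℝ)) : IsWidthPair C p q :=
  ⟨hp, hq, hpC, hqC, fun x hx y hy =>
    (mul_le_mul_of_nonneg_right hle (by positivity)).trans (h.minimal x hx y hy)⟩

lemma IsWidthPair.inner_le {C : Set S2} {a b p q : E3} (h : IsWidthPair C a b) (hp : ‖p‖ = 1)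
    (hq : ‖q‖ = 1) (hpC : p ∈ dualCone C) (hqC : q ∈ dualCone C) :
    (inner ℝ a b : ℝ) ≤ (inner ℝ p q : ℝ) := by
  have := h.minimal p hpC q hqC
  rwa [hp, hq, one_mul, mul_one] at this

lemma IsWidthPair.inner_eq {C : Set S2} {a b p q : E3} (h : IsWidthPair C a b)
    (h' : IsWidthPair C p q) : (inner ℝ a b : ℝ) = (inner ℝ p q : ℝ) :=
  le_antisymm (h.inner_le h'.norm_left h'.norm_right h'.left_mem h'.right_mem)
    (h'.inner_le h.norm_left h.norm_right h.left_mem h.right_mem)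

lemma isClosed_dualCone (C : Set S2) : IsClosed (dualCone C) := by
  have : dualCone C = ⋂ x ∈ C, {k : E3 | 0 ≤ (inner ℝ k (x : E3) : ℝ)} := by
    ext k; simp [dualCone]
  rw [this]
  exact isClosed_biInter fun x _ => isClosed_le continuous_const (by fun_prop)

lemma exists_isWidthPair {C : Set S2} {k : E3} (hk : k ∈ dualCone C) (hk0 : k ≠ 0) :
    ∃ a b, IsWidthPair C a b := by
  set U : Set E3 := Metric.sphere 0 1 ∩ dualCone C with hU
  have hUc : IsCompact U := (isCompact_sphere 0 1).inter_right (isClosed_dualCone C)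
  have hnorm : ∀ p ∈ dualCone C, p ≠ 0 → ‖p‖⁻¹ • p ∈ U := by
    intro p hp hp0
    refine ⟨?_, dualCone_smul hp (by positivity)⟩
    rw [mem_sphere_zero_iff_norm, norm_smul, norm_inv, norm_norm,
      inv_mul_cancel₀ (norm_ne_zero_iff.2 hp0)]
  have hne : (U ×ˢ U).Nonempty := ⟨(_, _), hnorm k hk hk0, hnorm k hk hk0⟩
  obtain ⟨⟨a, b⟩, ⟨ha, hb⟩, hmin⟩ := (hUc.prod hUc).exists_isMinOn hne
    (f := fun x : E3 × E3 => (inner ℝ x.1 x.2 : ℝ)) (by fun_prop)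
  refine ⟨a, b, by simpa using ha.1, by simpa using hb.1, ha.2, hb.2, ?_⟩
  intro p hp q hq
  by_cases hp0 : p = 0
  · simp [hp0]
  by_cases hq0 : q = 0
  · simp [hq0]
  have h1 := hmin (Set.mk_mem_prod (hnorm p hp hp0) (hnorm q hq hq0))
  simp only [Set.mem_ofPred_eq, real_inner_smul_left, real_inner_smul_right] at h1
  have hp' := norm_pos_iff.2 hp0
  have hq' := norm_pos_iff.2 hq0
  calc (inner ℝ a b : ℝ) * (‖p‖ * ‖q‖) ≤ (‖q‖⁻¹ * (‖p‖⁻¹ * inner ℝ p q)) * (‖p‖ * ‖q‖) :=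
        mul_le_mul_of_nonneg_right h1 (by positivity)
    _ = inner ℝ p q := by field_simp

/-- A nonzero vector of the dual cone is positive on interior points. -/
lemma inner_pos_of_mem_interior {C : Set S2} {k : E3} (hk : k ∈ dualCone C) (hk0 : k ≠ 0)
    {z : S2} (hz : z ∈ interior C) : 0 < (inner ℝ k (z : E3) : ℝ) := by
  refine lt_of_le_of_ne (hk z (interior_subset hz)) fun h0 => ?_
  -- If `k` vanished at the interior point `z`, the projections of `z - t • k` for small `t > 0`
  -- would still lie in `C`, although `k` is negative on them.
  have hne : ∀ t : ℝ, (z : E3) - t • k ≠ 0 := by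
    intro t ht
    have : (inner ℝ ((z : E3) - t • k) (z : E3) : ℝ) = 0 := by rw [ht, inner_zero_left]
    rw [inner_sub_left, real_inner_smul_left, ← h0, z.inner_self] at this
    norm_num at this
  let f : ℝ → S2 := fun t => S2.normalize _ (hne t)
  have hf : Continuous f := by
    apply Continuous.subtype_mk
    exact ((by fun_prop : Continuous fun t : ℝ => ‖(z : E3) - t • k‖).inv₀
      (fun t => norm_ne_zero_iff.2 (hne t))).smul (by fun_prop)
  have hf0 : f 0 = z := by
    apply S2.ext'
    simp [f, S2.coe_normalize]
  have hev : ∀ᶠ t in nhds (0 : ℝ), f t ∈ interior C :=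
    hf.continuousAt.eventually_mem (by rw [hf0]; exact isOpen_interior.mem_nhds hz)
  obtain ⟨ε, hε, hball⟩ := Metric.eventually_nhds_iff.1 hev
  have h1 := hball (y := ε / 2) (by simp [abs_of_pos hε]; linarith)
  have h2 := hk _ (interior_subset h1)
  simp only [f, S2.coe_normalize, real_inner_smul_right, inner_sub_right, ← h0] at h2
  have h3 : 0 < ‖(z : E3) - (ε / 2) • k‖⁻¹ := inv_pos.2 (norm_pos_iff.2 (hne _))
  have h4 : 0 < (inner ℝ k k : ℝ) := real_inner_self_pos.2 hk0
  have h5 : 0 < ‖(z : E3) - (ε / 2) • k‖⁻¹ * (ε / 2 * inner ℝ k k) := by positivity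
  nlinarith

lemma ne_neg_of_mem_dualCone {C : Set S2} (hC : (interior C).Nonempty) {a b : E3} (ha0 : a ≠ 0)
    (ha : a ∈ dualCone C) (hb : b ∈ dualCone C) : a ≠ -b := by
  obtain ⟨z, hz⟩ := hC
  intro h
  have h1 := inner_pos_of_mem_interior ha ha0 hz
  have h2 := hb z (interior_subset hz)
  rw [h, inner_neg_left] at h1
  linarith

/-- Equal centres do not form a lune and are excluded by hypothesis; antipodal ones are excluded by
the nonempty interior. -/
lemma thickness_le {C : Set S2} (hC : (interior C).Nonempty) {a b : E3} (ha : ‖a‖ = 1)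
    (hb : ‖b‖ = 1) (haC : a ∈ dualCone C) (hbC : b ∈ dualCone C) (hab : a ≠ b) :
    thickness C ≤ Real.arccos (-(inner ℝ a b : ℝ)) := by
  have hF : FormLune (S2.mk a ha) (S2.mk b hb) :=
    ⟨fun h => hab (congrArg Subtype.val h), ne_neg_of_mem_dualCone hC
      (ne_zero_of_norm_one ha) haC hbC⟩
  refine csInf_le ⟨0, ?_⟩ ⟨_, _, hF, subset_lune_iff.2 ⟨haC, hbC⟩, ?_⟩
  · rintro t ⟨a, b, h1, -, h2⟩
    rw [(luneHasThickness_iff h1 t).1 h2]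
    exact Real.arccos_nonneg _
  · exact (luneHasThickness_iff hF _).2 rfl

lemma IsWidthPair.thickness_eq {C : Set S2} (hC : (interior C).Nonempty) {a b : E3}
    (h : IsWidthPair C a b) (hab : a ≠ b) : thickness C = Real.arccos (-(inner ℝ a b : ℝ)) := by
  apply le_antisymm (thickness_le hC h.norm_left h.norm_right h.left_mem h.right_mem hab)
  have hF : FormLune (S2.mk a h.norm_left) (S2.mk b h.norm_right) :=
    ⟨fun h => hab (congrArg Subtype.val h), ne_neg_of_mem_dualCone hC
      (ne_zero_of_norm_one h.norm_left) h.left_mem h.right_mem⟩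
  refine le_csInf ⟨_, _, _, hF, subset_lune_iff.2 ⟨h.left_mem, h.right_mem⟩,
    (luneHasThickness_iff hF _).2 rfl⟩ ?_
  rintro t ⟨a', b', h1, h2, h3⟩
  rw [(luneHasThickness_iff h1 t).1 h3]
  rw [subset_lune_iff] at h2
  apply Real.arccos_le_arccos
  have := h.inner_le a'.norm b'.norm h2.1 h2.2
  linarith

/-- The width pairs of a set with two distinct supporting hemispheres are non-degenerate. -/
lemma IsWidthPair.ne {C : Set S2} {a b p q : E3} (h : IsWidthPair C a b) (hp : ‖p‖ = 1)
    (hq : ‖q‖ = 1) (hpC : p ∈ dualCone C) (hqC : q ∈ dualCone C) (hpq : p ≠ q) : a ≠ b := by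
  intro hab
  have h1 := h.inner_le hp hq hpC hqC
  rw [hab, inner_self_of_norm h.norm_right] at h1
  have h2 := inner_lt_one_of_ne hp hq hpq
  linarith

/-! ### Convex sets and their cones -/

lemma IsSphConvex.add_mem_cone {C : Set S2} (hC : IsSphConvex C) {a b : S2} (ha : a ∈ C)
    (hb : b ∈ C) {s t : ℝ} (hs : 0 ≤ s) (ht : 0 ≤ t) (hst : 0 < s + t) :
    ∃ r : ℝ, 0 < r ∧ ∃ x ∈ C, s • (a : E3) + t • (b : E3) = r • (x : E3) := by
  have hne : s • (a : E3) + t • (b : E3) ≠ 0 := by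
    intro h0
    have h1 : ‖s • (a : E3)‖ = ‖t • (b : E3)‖ := by
      rw [eq_neg_of_add_eq_zero_left h0, norm_neg]
    rw [norm_smul, norm_smul, a.norm, b.norm, Real.norm_of_nonneg hs, Real.norm_of_nonneg ht] at h1
    have hs' : s = t := by linarith
    subst hs'
    have hs0 : s ≠ 0 := by intro h; rw [h] at hst; norm_num at hst
    rw [← smul_add, smul_eq_zero] at h0
    have h2 : (a : E3) = -(b : E3) := eq_neg_of_add_eq_zero_left (h0.resolve_left hs0)
    have h3 := (hC a ha b hb).1
    rw [sphDist_eq, h2, inner_neg_left, b.inner_self, Real.arccos_neg_one] at h3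
    exact lt_irrefl _ h3
  refine ⟨_, norm_pos_iff.2 hne, S2.normalize _ hne, (hC a ha b hb).2 ?_, ?_⟩
  · refine ⟨‖s • (a : E3) + t • (b : E3)‖⁻¹ * s, ‖s • (a : E3) + t • (b : E3)‖⁻¹ * t,
      by positivity, by positivity, ?_⟩
    rw [S2.coe_normalize, smul_add, smul_smul, smul_smul]
  · rw [S2.coe_normalize, smul_smul, mul_inv_cancel₀ (norm_ne_zero_iff.2 hne), one_smul]

/-- The closed convex cone spanned by a nonempty closed convex subset of the sphere. -/
def coneOf (C : Set S2) (hcl : IsClosed C) (hC : IsSphConvex C) (hne : C.Nonempty) :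
    ProperCone ℝ E3 where
  carrier := {y | ∃ t : ℝ, 0 ≤ t ∧ ∃ x ∈ C, y = t • (x : E3)}
  zero_mem' := ⟨0, le_rfl, hne.some, hne.some_mem, by simp⟩
  add_mem' := by
    rintro _ _ ⟨s, hs, x, hx, rfl⟩ ⟨t, ht, y, hy, rfl⟩
    rcases (add_nonneg hs ht).eq_or_lt with h | h
    · have h1 : s = 0 := by linarith
      have h2 : t = 0 := by linarith
      exact ⟨0, le_rfl, x, hx, by simp [h1, h2]⟩
    · obtain ⟨r, hr, z, hz, h⟩ := hC.add_mem_cone hx hy hs ht h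
      exact ⟨r, hr.le, z, hz, h⟩
  smul_mem' := by
    rintro c _ ⟨t, ht, x, hx, rfl⟩
    exact ⟨c * t, mul_nonneg c.2 ht, x, hx, by rw [mul_smul]; rfl⟩
  isClosed' := by
    -- The cone is the projection of a closed set of pairs (vector, direction) along the compact
    -- sphere.
    have h1 : IsClosed {z : E3 × S2 | z.2 ∈ C ∧ z.1 = ‖z.1‖ • (z.2 : E3)} :=
      (hcl.preimage continuous_snd).inter (isClosed_eq (by fun_prop) (by fun_prop))
    have h2 := isClosedMap_fst_of_compactSpace _ h1
    convert h2 using 1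
    ext y
    constructor
    · rintro ⟨t, ht, x, hx, rfl⟩
      refine ⟨(t • (x : E3), x), ⟨hx, ?_⟩, rfl⟩
      simp only [norm_smul, x.norm, Real.norm_of_nonneg ht, mul_one]
    · rintro ⟨⟨y, x⟩, ⟨hx, hy⟩, rfl⟩
      exact ⟨‖y‖, norm_nonneg _, x, hx, hy⟩

/-- The bipolar theorem on the sphere. -/
lemma exists_mem_of_forall_dualCone {C : Set S2} (hcl : IsClosed C) (hC : IsSphConvex C)
    (hne : C.Nonempty) {y : E3} (hy : ∀ k ∈ dualCone C, 0 ≤ (inner ℝ k y : ℝ)) :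
    ∃ t : ℝ, 0 ≤ t ∧ ∃ x ∈ C, y = t • (x : E3) := by
  by_contra hcon
  obtain ⟨k, hk, hky⟩ := ProperCone.hyperplane_separation' (coneOf C hcl hC hne) (x₀ := y) hcon
  have : k ∈ dualCone C := by
    intro x hx
    rw [real_inner_comm]
    exact hk x ⟨1, zero_le_one, x, hx, by simp⟩
  have h2 := hy k this
  rw [real_inner_comm] at h2
  linarith

/-- The centres of the two semicircles bounding a lune of minimal thickness belong to the set. -/
lemma IsWidthPair.exists_center {C : Set S2} (hC : IsSphConvexBody C) {a b : E3}
    (h : IsWidthPair C a b) (hp : (inner ℝ a b : ℝ) ≤ 0) :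
    ∃ x ∈ C, a - (inner ℝ a b : ℝ) • b = √(1 - (inner ℝ a b : ℝ) ^ 2) • (x : E3) := by
  set p : ℝ := inner ℝ a b with hpdef
  -- By the bipolar theorem it suffices to pair `a - p • b` with the dual cone. The pairing with `k`
  -- is the derivative at `0` of the inner product of `a` with the normalised `b + ε • k`, which
  -- minimality keeps nonnegative.
  have hy : ∀ k ∈ dualCone C, 0 ≤ (inner ℝ k (a - p • b) : ℝ) := by
    intro k hk
    rw [inner_sub_right, real_inner_smul_right]
    by_contra hneg
    push Not at hneg
    set D : ℝ := inner ℝ k a - p * inner ℝ k b with hD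
    have key : ∀ ε : ℝ, 0 < ε → p * ε * ‖k‖ ^ 2 / 2 ≤ D := by
      intro ε hε
      have h1 := h.minimal a h.left_mem (b + ε • k) (dualCone_add h.right_mem
        (dualCone_smul hk hε.le))
      rw [h.norm_left, one_mul, inner_add_right, real_inner_smul_right, ← hpdef] at h1
      have h2 : ‖b + ε • k‖ ^ 2 = 1 + 2 * (ε * inner ℝ k b) + ε ^ 2 * ‖k‖ ^ 2 := by
        rw [norm_add_sq_real, h.norm_right, real_inner_smul_right, norm_smul,
          Real.norm_of_nonneg hε.le, real_inner_comm]
        ring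
      have h3 : ‖b + ε • k‖ ≤ 1 + ε * inner ℝ k b + ε ^ 2 * ‖k‖ ^ 2 / 2 := by
        nlinarith [sq_nonneg (‖b + ε • k‖ - 1)]
      have h4 := mul_le_mul_of_nonpos_left h3 hp
      rw [real_inner_comm] at h1
      have h5 : ε * (p * ε * ‖k‖ ^ 2 / 2) ≤ ε * D := by rw [hD]; nlinarith
      exact le_of_mul_le_mul_left h5 hε
    have hk2 : 0 ≤ ‖k‖ ^ 2 := by positivity
    -- For `D < 0` this `ε` is small enough for the first-order term to dominate the quadratic
    -- error.
    have h1 := key (-D / (1 - p * ‖k‖ ^ 2)) (div_pos (by linarith) (by nlinarith))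
    have h2 : 0 < 1 - p * ‖k‖ ^ 2 := by nlinarith
    have h3 : p * (-D / (1 - p * ‖k‖ ^ 2)) * ‖k‖ ^ 2 / 2 =
        (-D) * (p * ‖k‖ ^ 2) / (2 * (1 - p * ‖k‖ ^ 2)) := by
      field_simp
    rw [h3, div_le_iff₀ (by positivity)] at h1
    nlinarith [mul_nonneg (by linarith : (0:ℝ) ≤ -D) (by nlinarith : (0:ℝ) ≤ -(p * ‖k‖ ^ 2))]
  obtain ⟨t, ht, x, hx, hxy⟩ := exists_mem_of_forall_dualCone hC.1 hC.2.1
    (hC.2.2.mono interior_subset) hy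
  refine ⟨x, hx, ?_⟩
  have h1 := norm_sq_sub_smul h.norm_left h.norm_right
  rw [← hpdef, hxy, norm_smul, x.norm, mul_one, Real.norm_of_nonneg ht] at h1
  rw [← h1, Real.sqrt_sq ht]
  exact hxy

/-- Each end of a width pair of thickness less than `π / 2` determines the other one. -/
lemma IsWidthPair.right_unique {C : Set S2} {a b b' : E3} (h : IsWidthPair C a b)
    (h' : IsWidthPair C a b') (hp : (inner ℝ a b : ℝ) < 0) : b = b' := by
  -- If `b ≠ b'`, then `‖b + b'‖ < 2`, and the normalised `b + b'` would be even farther from `a`.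
  have h1 := h.minimal a h.left_mem (b + b') (dualCone_add h.right_mem h'.right_mem)
  rw [h.norm_left, one_mul, inner_add_right, ← h.inner_eq h'] at h1
  have h2 : 2 ≤ ‖b + b'‖ := by nlinarith
  have h3 : ‖b + b'‖ ^ 2 = 2 + 2 * inner ℝ b b' := by
    rw [norm_add_sq_real, h.norm_right, h'.norm_right]; ring
  by_contra hne
  have h4 := inner_lt_one_of_ne h.norm_right h'.norm_right hne
  nlinarith

/-- Tilting `a` towards `ν` and `b` towards `-ν` moves them apart: `T • a + g • ν` and `T • b - g •
ν` have equal norms, and their inner product falls short of the minimal value by `(1 + ⟪a, b⟫) * g ^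
2 * ‖ν‖ ^ 2`. Both stay in the dual cone for large `T`. -/
lemma IsWidthPair.not_rotate {C : Set S2} {a b ν : E3} (h : IsWidthPair C a b)
    (hp : (-1 : ℝ) < inner ℝ a b) (hν : ν ≠ 0) (haν : (inner ℝ a ν : ℝ) = 0)
    (hbν : (inner ℝ b ν : ℝ) = 0) {α γ β γ' : ℝ} (hγ : 0 < γ) (hγ' : 0 < γ')
    (h1 : α • a + γ • ν ∈ dualCone C) (h2 : β • b - γ' • ν ∈ dualCone C) : False := by
  -- `T` is large enough to correct the coefficients of the given vectors by adding nonnegative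
  -- multiples of `a` and `b`.
  set T : ℝ := |γ' * α| + |γ * β| with hT
  have hT1 : 0 ≤ T - γ' * α := by
    rw [hT]; linarith [le_abs_self (γ' * α), abs_nonneg (γ * β)]
  have hT2 : 0 ≤ T - γ * β := by
    rw [hT]; linarith [le_abs_self (γ * β), abs_nonneg (γ' * α)]
  have e1 : T • a + (γ * γ') • ν ∈ dualCone C := by
    have := dualCone_add (dualCone_smul h.left_mem hT1) (dualCone_smul h1 hγ'.le)
    convert this using 1
    module
  have e2 : T • b - (γ * γ') • ν ∈ dualCone C := by
    have := dualCone_add (dualCone_smul h.right_mem hT2) (dualCone_smul h2 hγ.le)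
    convert this using 1
    module
  have hm := h.minimal _ e1 _ e2
  set g := γ * γ' with hg
  have hg0 : 0 < g := mul_pos hγ hγ'
  have hN : 0 < (inner ℝ ν ν : ℝ) := real_inner_self_pos.2 hν
  have haν' : (inner ℝ ν a : ℝ) = 0 := by rw [real_inner_comm]; exact haν
  have hbν' : (inner ℝ ν b : ℝ) = 0 := by rw [real_inner_comm]; exact hbν
  have n1 : ‖T • a + g • ν‖ ^ 2 = T ^ 2 + g ^ 2 * inner ℝ ν ν := by
    rw [← real_inner_self_eq_norm_sq]
    simp only [inner_add_left, inner_add_right, real_inner_smul_left, real_inner_smul_right,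
      inner_self_of_norm h.norm_left, haν, haν']
    ring
  have n2 : ‖T • b - g • ν‖ ^ 2 = T ^ 2 + g ^ 2 * inner ℝ ν ν := by
    rw [← real_inner_self_eq_norm_sq]
    simp only [inner_sub_left, inner_sub_right, real_inner_smul_left, real_inner_smul_right,
      inner_self_of_norm h.norm_right, hbν, hbν']
    ring
  have n3 : ‖T • a + g • ν‖ = ‖T • b - g • ν‖ := by
    rw [← Real.sqrt_sq (norm_nonneg (T • a + g • ν)), n1, ← n2, Real.sqrt_sq (norm_nonneg _)]
  rw [n3, ← sq, n2] at hm
  simp only [inner_add_left, inner_sub_right, real_inner_smul_left, real_inner_smul_right,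
    haν, hbν'] at hm
  have : 0 < g ^ 2 * inner ℝ ν ν := by positivity
  nlinarith

/-! ### Cyclic indices -/

/-- The residue of an integer modulo `n`, as an element of `Fin n`. -/
def cyc (n : ℕ) [NeZero n] (z : ℤ) : Fin n :=
  ⟨(z % n).toNat, by
    have h : (n : ℤ) ≠ 0 := by exact_mod_cast NeZero.ne n
    have h1 := Int.emod_nonneg z h
    have h2 := Int.emod_lt_of_pos z (by omega : (0 : ℤ) < n)
    omega⟩

section cyc
variable {n : ℕ} [NeZero n]

lemma coe_cyc (z : ℤ) : (((cyc n z : Fin n) : ℕ) : ℤ) = z % n := by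
  have h : (n : ℤ) ≠ 0 := by exact_mod_cast NeZero.ne n
  exact Int.toNat_of_nonneg (Int.emod_nonneg z h)

lemma cyc_eq_iff {a b : ℤ} : cyc n a = cyc n b ↔ a % n = b % n := by
  rw [← coe_cyc, ← coe_cyc, Fin.ext_iff]; norm_cast

lemma cyc_coe (i : Fin n) : cyc n (i : ℕ) = i := by
  ext
  have := coe_cyc (n := n) ((i : ℕ) : ℤ)
  rw [Int.emod_eq_of_lt (by omega) (by exact_mod_cast i.2)] at this
  exact_mod_cast this

lemma cyc_add_one (z : ℤ) : cyc n (z + 1) = cyc n z + 1 := by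
  apply Fin.ext
  zify
  rw [coe_cyc, Fin.val_add]
  push_cast
  rw [coe_cyc, Fin.val_one']
  push_cast
  simp

lemma cyc_add_card (z : ℤ) : cyc n (z + n) = cyc n z := by
  rw [cyc_eq_iff]; simp

lemma cyc_sub_one (z : ℤ) : cyc n (z - 1) = cyc n z - 1 := by
  have := cyc_add_one (n := n) (z - 1)
  rw [sub_add_cancel] at this
  rw [this, add_sub_cancel_right]

lemma cyc_ne {a b : ℤ} (h : a < b) (h' : b < a + n) : cyc n a ≠ cyc n b := by
  intro he
  rw [cyc_eq_iff] at he
  have h1 := Int.emod_emod_of_dvd (b - a) (dvd_refl (n : ℤ))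
  have h2 : (b - a) % n = 0 := by rw [Int.sub_emod, he, sub_self, Int.zero_emod]
  rw [Int.emod_eq_of_lt (by omega) (by omega)] at h2
  omega

/-- Every residue has a representative in any window of length `n`. -/
lemma exists_cyc_eq (i : Fin n) (a : ℤ) : ∃ z, a ≤ z ∧ z < a + n ∧ cyc n z = i := by
  have hn : (0 : ℤ) < n := by exact_mod_cast Nat.pos_of_ne_zero (NeZero.ne n)
  refine ⟨a + ((i : ℕ) - a) % n, ?_, ?_, ?_⟩
  · linarith [Int.emod_nonneg ((i : ℕ) - a : ℤ) hn.ne']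
  · linarith [Int.emod_lt_of_pos ((i : ℕ) - a : ℤ) hn]
  · rw [← cyc_coe i, cyc_eq_iff, cyc_coe, Int.add_emod, Int.emod_emod_of_dvd _ (dvd_refl _),
      ← Int.add_emod]
    congr 1
    ring

end cyc

/-! ### Cyclically ordered vectors -/

/-- Induction on the gap between `q` and `r`: the Plücker relation at the apex `f p`, with `f (p +
1)` as auxiliary vector, expresses the next determinant through positive ones. It serves both the
vertices and the side normals of a polygon. -/
lemma det3_pos_of_adjacent {n : ℕ} {f : ℤ → E3} (hper : ∀ z, f (z + n) = f z)
    (hadj : ∀ p r : ℤ, p + 1 < r → r < p + n → 0 < det3 (f p) (f (p + 1)) (f r))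
    {p q r : ℤ} (hpq : p < q) (hqr : q < r) (hrp : r < p + n) :
    0 < det3 (f p) (f q) (f r) := by
  have base : ∀ q : ℤ, p < q → q + 1 < p + n → 0 < det3 (f p) (f q) (f (q + 1)) := by
    intro q h1 h2
    have := hadj q (p + n) h2 (by omega)
    rwa [hper, det3_rotate, det3_rotate] at this
  have key : ∀ d : ℕ, q + 1 + d < p + n → 0 < det3 (f p) (f q) (f (q + 1 + d)) := by
    intro d
    induction d with
    | zero => intro h; simpa using base q hpq (by push_cast at h; omega)
    | succ d ih =>
      intro h
      push_cast at h ⊢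
      have ih' := ih (by omega)
      rcases (show p + 1 ≤ q by omega).eq_or_lt with h1 | h1
      · rw [← h1]
        exact hadj p _ (by omega) (by omega)
      · have hp := plucker (f p) (f (p + 1)) (f q) (f (q + 1 + d)) (f (q + 1 + d + 1))
        have e1 := hadj p q h1 (by omega)
        have e2 := hadj p (q + 1 + d) (by omega) (by omega)
        have e3 := hadj p (q + 1 + d + 1) (by omega) (by omega)
        have e4 := base (q + 1 + d) (by omega) (by omega)
        rw [← add_assoc]
        have : 0 < det3 (f p) (f (p + 1)) (f (q + 1 + d)) *
            det3 (f p) (f q) (f (q + 1 + d + 1)) := by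
          rw [hp]; positivity
        exact (mul_pos_iff_of_pos_left e2).1 this
  have := key (r - (q + 1)).toNat (by omega)
  rwa [Int.toNat_of_nonneg (by omega), show q + 1 + (r - (q + 1)) = r by ring] at this

lemma eq_zero_of_det3_ne_zero {a b c y : E3} (h : det3 a b c ≠ 0) (ha : (inner ℝ y a : ℝ) = 0)
    (hb : (inner ℝ y b : ℝ) = 0) (hc : (inner ℝ y c : ℝ) = 0) : y = 0 := by
  have h1 := congrArg (fun z => (inner ℝ y z : ℝ)) (det3_smul_eq a b c y)
  simp only [inner_add_right, real_inner_smul_right, ha, hb, hc, mul_zero, add_zero] at h1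
  exact inner_self_eq_zero.1 ((mul_eq_zero.1 h1).resolve_left h)

/-- All three of `p`, `q`, `y` lie in the plane orthogonal to `m`, where pairing with `l` and `r`
gives coordinates diagonal in `p`, `q`. With `m` a vertex this describes the supporting hemispheres
there, with `m` a side normal the points of the side. -/
lemma exists_nonneg_combination {l m r p q y : E3} (h : det3 l m r ≠ 0)
    (hpm : (inner ℝ p m : ℝ) = 0) (hqm : (inner ℝ q m : ℝ) = 0) (hym : (inner ℝ y m : ℝ) = 0)
    (hpl : (inner ℝ p l : ℝ) = 0) (hpr : 0 < (inner ℝ p r : ℝ)) (hqr : (inner ℝ q r : ℝ) = 0)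
    (hql : 0 < (inner ℝ q l : ℝ)) (hyr : 0 ≤ (inner ℝ y r : ℝ)) (hyl : 0 ≤ (inner ℝ y l : ℝ)) :
    ∃ α β : ℝ, 0 ≤ α ∧ 0 ≤ β ∧ y = α • p + β • q := by
  refine ⟨inner ℝ y r / inner ℝ p r, inner ℝ y l / inner ℝ q l, by positivity, by positivity, ?_⟩
  rw [← sub_eq_zero]
  apply eq_zero_of_det3_ne_zero h <;>
  simp only [inner_sub_left, inner_add_left, real_inner_smul_left, hpm, hqm, hym, hpl, hqr]
  · field_simp; ring
  · ring
  · field_simp; ring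

/-! ### Polygons as cones over their vertices -/

section Cone

variable {n : ℕ} {v : Fin n → S2}

/-- The first alternative covers the zero sum, which has no radial projection; otherwise points are
added one at a time by convexity. -/
lemma exists_mem_of_sum {C : Set S2} (hC : IsSphConvex C) (hv : Set.range v ⊆ C)
    {lam : Fin n → ℝ} (h0 : ∀ i, 0 ≤ lam i) (s : Finset (Fin n)) :
    (∀ i ∈ s, lam i = 0) ∨
      ∃ r : ℝ, 0 < r ∧ ∃ x ∈ C, ∑ i ∈ s, lam i • (v i : E3) = r • (x : E3) := by
  classical
  induction s using Finset.induction_on with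
  | empty => left; simp
  | insert a s ha ih =>
    rw [Finset.sum_insert ha]
    rcases (h0 a).eq_or_lt with h | h
    · rcases ih with ih | ⟨r, hr, x, hx, ih⟩
      · left
        intro i hi
        rcases Finset.mem_insert.1 hi with rfl | hi
        · exact h.symm
        · exact ih i hi
      · right
        exact ⟨r, hr, x, hx, by rw [ih, ← h, zero_smul, zero_add]⟩
    · right
      rcases ih with ih | ⟨r, hr, x, hx, ih⟩
      · refine ⟨lam a, h, v a, hv ⟨a, rfl⟩, ?_⟩
        rw [Finset.sum_eq_zero (fun i hi => by rw [ih i hi, zero_smul]), add_zero]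
      · rw [ih]
        exact hC.add_mem_cone (hv ⟨a, rfl⟩) hx (h0 a) hr.le (by positivity)

lemma mem_of_eq_sum {C : Set S2} (hC : IsSphConvex C) (hv : Set.range v ⊆ C)
    {lam : Fin n → ℝ} (h0 : ∀ i, 0 ≤ lam i) {x : S2} (hx : (x : E3) = ∑ i, lam i • (v i : E3)) :
    x ∈ C := by
  rcases exists_mem_of_sum hC hv h0 Finset.univ with h | ⟨r, hr, y, hy, h⟩
  · exfalso
    rw [Finset.sum_eq_zero (fun i hi => by rw [h i hi, zero_smul])] at hx
    exact ne_zero_of_norm_one x.norm hx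
  · rw [h] at hx
    have h1 := x.norm
    rw [hx, norm_smul, y.norm, mul_one, Real.norm_of_nonneg hr.le] at h1
    rw [h1, one_smul] at hx
    rwa [S2.ext' hx]

/-- The points of the sphere that are nonnegative combinations of the points `v i`. -/
def coneSet (v : Fin n → S2) : Set S2 :=
  {x | ∃ lam : Fin n → ℝ, (∀ i, 0 ≤ lam i) ∧ (x : E3) = ∑ i, lam i • (v i : E3)}

lemma vertex_mem_coneSet (v : Fin n → S2) (i : Fin n) : v i ∈ coneSet v := by
  classical
  exact ⟨Pi.single i 1, fun j => by
    by_cases h : j = i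
    · subst h; simp
    · simp [h], by simp [Pi.single_apply]⟩

lemma inner_pos_of_mem_coneSet {k : E3} (hk : ∀ i, 0 < (inner ℝ k (v i : E3) : ℝ)) {x : S2}
    (hx : x ∈ coneSet v) : 0 < (inner ℝ k (x : E3) : ℝ) := by
  obtain ⟨lam, h0, hx⟩ := hx
  have hne : ∃ i, lam i ≠ 0 := by
    by_contra h
    push Not at h
    rw [Finset.sum_eq_zero (fun i _ => by rw [h i, zero_smul])] at hx
    exact ne_zero_of_norm_one x.norm hx
  obtain ⟨i, hi⟩ := hne
  rw [hx, inner_sum]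
  simp only [real_inner_smul_right]
  exact Finset.sum_pos' (fun j _ => mul_nonneg (h0 j) (hk j).le)
    ⟨i, Finset.mem_univ _, mul_pos (lt_of_le_of_ne (h0 i) hi.symm) (hk i)⟩

lemma isSphConvex_coneSet {k : E3} (hk : ∀ i, 0 < (inner ℝ k (v i : E3) : ℝ)) :
    IsSphConvex (coneSet v) := by
  intro a ha b hb
  constructor
  · have h1 := inner_pos_of_mem_coneSet hk ha
    have h2 := inner_pos_of_mem_coneSet hk hb
    rw [sphDist_eq]
    refine lt_of_le_of_ne (Real.arccos_le_pi _) fun h => ?_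
    rw [Real.arccos_eq_pi] at h
    have h3 := neg_one_lt_inner_of_ne a.norm b.norm (fun h' => by
      rw [h', inner_neg_right] at h1; linarith)
    linarith
  · rintro x ⟨s, t, hs, ht, hx⟩
    obtain ⟨la, hla, ha⟩ := ha
    obtain ⟨lb, hlb, hb⟩ := hb
    refine ⟨fun i => s * la i + t * lb i, fun i => add_nonneg (mul_nonneg hs (hla i))
      (mul_nonneg ht (hlb i)), ?_⟩
    rw [hx, ha, hb, Finset.smul_sum, Finset.smul_sum, ← Finset.sum_add_distrib]
    exact Finset.sum_congr rfl fun i _ => by module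

lemma polygon_eq_coneSet {k : E3} (hk : ∀ i, 0 < (inner ℝ k (v i : E3) : ℝ)) :
    polygon v = coneSet v := by
  apply Set.Subset.antisymm
  · apply Set.sInter_subset_of_mem
    refine ⟨isSphConvex_coneSet hk, ?_⟩
    rintro _ ⟨i, rfl⟩
    exact vertex_mem_coneSet v i
  · rintro x ⟨lam, h0, hx⟩ C ⟨hC, hvC⟩
    exact mem_of_eq_sum hC hvC h0 hx

/-- The set is the continuous image of the standard simplex under the normalised sum; lying in an
open hemisphere keeps the sum away from zero. -/
lemma isClosed_coneSet {k : E3} (hk : ∀ i, 0 < (inner ℝ k (v i : E3) : ℝ)) :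
    IsClosed (coneSet v) := by
  have hne : ∀ lam : stdSimplex ℝ (Fin n), ∑ i, lam.1 i • (v i : E3) ≠ 0 := by
    intro lam h0
    have h1 : (inner ℝ k (∑ i, lam.1 i • (v i : E3)) : ℝ) = 0 := by
      rw [h0, inner_zero_right]
    rw [inner_sum] at h1
    simp only [real_inner_smul_right] at h1
    rw [Finset.sum_eq_zero_iff_of_nonneg (fun i _ => mul_nonneg (lam.2.1 i) (hk i).le)] at h1
    have h2 := lam.2.2
    rw [Finset.sum_eq_zero (fun i hi => (mul_eq_zero.1 (h1 i hi)).resolve_right (hk i).ne')] at h2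
    exact zero_ne_one h2
  let F : stdSimplex ℝ (Fin n) → S2 := fun lam => S2.normalize _ (hne lam)
  have hcont : Continuous fun lam : stdSimplex ℝ (Fin n) =>
      ∑ i, lam.1 i • (v i : E3) :=
    continuous_finsetSum _ fun i _ =>
      ((continuous_apply i).comp continuous_subtype_val).smul continuous_const
  have hF : Continuous F := by
    apply Continuous.subtype_mk
    exact (hcont.norm.inv₀ (fun t => norm_ne_zero_iff.2 (hne t))).smul hcont
  have : CompactSpace (stdSimplex ℝ (Fin n)) :=
    isCompact_iff_compactSpace.1 (isCompact_stdSimplex ℝ (Fin n))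
  have hr : coneSet v = Set.range F := by
    ext x
    constructor
    · rintro ⟨lam, h0, hx⟩
      have hS : 0 < ∑ i, lam i := by
        refine lt_of_le_of_ne (Finset.sum_nonneg fun i _ => h0 i) fun h => ?_
        rw [eq_comm, Finset.sum_eq_zero_iff_of_nonneg (fun i _ => h0 i)] at h
        rw [Finset.sum_eq_zero (fun i hi => by rw [h i hi, zero_smul])] at hx
        exact ne_zero_of_norm_one x.norm hx
      have hmem : (fun i => (∑ i, lam i)⁻¹ * lam i) ∈ stdSimplex ℝ (Fin n) :=
        ⟨fun i => mul_nonneg (inv_nonneg.2 hS.le) (h0 i),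
          by rw [← Finset.mul_sum, inv_mul_cancel₀ hS.ne']⟩
      refine ⟨⟨_, hmem⟩, ?_⟩
      · apply S2.ext'
        simp only [F, S2.coe_normalize]
        have e : ∑ i, ((∑ i, lam i)⁻¹ * lam i) • (v i : E3) = (∑ i, lam i)⁻¹ • (x : E3) := by
          rw [hx, Finset.smul_sum]
          exact Finset.sum_congr rfl fun i _ => by rw [mul_smul]
        rw [e, norm_smul, x.norm, mul_one, norm_inv, Real.norm_of_nonneg hS.le, inv_inv, smul_smul,
          mul_inv_cancel₀ hS.ne', one_smul]
    · rintro ⟨lam, rfl⟩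
      refine ⟨fun i => ‖∑ i, lam.1 i • (v i : E3)‖⁻¹ * lam.1 i,
        fun i => mul_nonneg (by positivity) (lam.2.1 i), ?_⟩
      simp only [F, S2.coe_normalize, mul_smul, Finset.smul_sum]
  rw [hr]
  exact (isCompact_range hF).isClosed

/-- By Cramer's rule, positivity of three determinants describes an open set of combinations of
three vertices. The normalised sum of the three belongs to it. -/
lemma interior_coneSet_nonempty {i j l : Fin n} (hij : i ≠ j) (hil : i ≠ l) (hjl : j ≠ l)
    (h : 0 < det3 (v i : E3) (v j) (v l)) : (interior (coneSet v)).Nonempty := by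
  classical
  let O : Set S2 := {x | 0 < det3 (x : E3) (v j) (v l)} ∩ ({x | 0 < det3 (v i : E3) x (v l)} ∩
    {x | 0 < det3 (v i : E3) (v j) x})
  have hO : IsOpen O := by
    have hc : ∀ m : Fin 3, Continuous fun x : S2 => (x : E3) m := by
      intro m
      exact (continuous_apply m).comp ((PiLp.continuous_ofLp 2 _).comp continuous_subtype_val)
    have h0 := hc 0
    have h1 := hc 1
    have h2 := hc 2
    refine (isOpen_lt continuous_const ?_).inter ((isOpen_lt continuous_const ?_).inter
      (isOpen_lt continuous_const ?_)) <;> simp only [det3] <;> fun_prop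
  have hOC : O ⊆ coneSet v := by
    rintro x ⟨h1, h2, h3⟩
    rw [Set.mem_ofPred_eq] at h1 h2 h3
    set D := det3 (v i : E3) (v j) (v l)
    refine ⟨fun m => D⁻¹ * (if m = i then det3 (x : E3) (v j) (v l) else
      if m = j then det3 (v i : E3) x (v l) else if m = l then det3 (v i : E3) (v j) x else 0),
      fun m => mul_nonneg (inv_nonneg.2 h.le) (by split_ifs <;> linarith), ?_⟩
    have hx := det3_smul_eq (v i) (v j) (v l) x
    have e : ∑ m, (D⁻¹ * (if m = i then det3 (x : E3) (v j) (v l) else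
        if m = j then det3 (v i : E3) x (v l) else
        if m = l then det3 (v i : E3) (v j) x else 0)) • (v m : E3) =
        D⁻¹ • (det3 (x : E3) (v j) (v l) • (v i : E3) + det3 (v i : E3) x (v l) • (v j : E3) +
          det3 (v i : E3) (v j) x • (v l : E3)) := by
      rw [Finset.sum_eq_add_sum_sdiff_singleton_of_mem (Finset.mem_univ i),
        Finset.sum_eq_add_sum_sdiff_singleton_of_mem (i := j) (by simp [hij.symm]),
        Finset.sum_eq_add_sum_sdiff_singleton_of_mem (i := l) (by simp [hil.symm, hjl.symm]),
        Finset.sum_eq_zero]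
      · simp only [hij.symm, hil.symm, hjl.symm, if_true, if_false]
        module
      · intro m hm
        simp only [Finset.mem_sdiff, Finset.mem_univ, Finset.mem_singleton, true_and] at hm
        simp [hm.1.1, hm.1.2, hm.2]
    rw [e, ← hx, smul_smul, inv_mul_cancel₀ h.ne', one_smul]
  have hne : (v i : E3) + v j + v l ≠ 0 := by
    intro h0
    have : det3 (v i : E3) (v j) (v i + v j + v l) = 0 := by
      rw [h0]; simp [det3]
    rw [det3_add_right, det3_add_right, det3_self_outer, det3_self_right] at this
    linarith
  refine ⟨S2.normalize _ hne, mem_interior.2 ⟨O, hOC, hO, ?_⟩⟩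
  have hp : 0 < ‖(v i : E3) + v j + v l‖⁻¹ := inv_pos.2 (norm_pos_iff.2 hne)
  refine ⟨?_, ?_, ?_⟩ <;> rw [Set.mem_ofPred_eq, S2.coe_normalize] <;>
  simp only [det3_smul_left, det3_smul_mid, det3_smul_right, det3_add_left, det3_add_mid,
    det3_add_right, det3_self_left, det3_self_right, det3_self_outer, add_zero, zero_add] <;>
  positivity

end Cone

/-! ### Vertices and poles of polygons -/

section Polygon

variable {n : ℕ} [NeZero n]

/-- The vertices of a polygon as a periodic sequence of vectors. -/
def vtx (v : Fin n → S2) (z : ℤ) : E3 := v (cyc n z)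

/-- The unit normal, pointing inwards, of the side joining the vertices `z` and `z + 1`. -/
def pole (v : Fin n → S2) (z : ℤ) : E3 :=
  ‖cr (vtx v z) (vtx v (z + 1))‖⁻¹ • cr (vtx v z) (vtx v (z + 1))

lemma vtx_norm (v : Fin n → S2) (z : ℤ) : ‖vtx v z‖ = 1 := S2.norm _

lemma vtx_period (v : Fin n → S2) (z : ℤ) : vtx v (z + n) = vtx v z := by
  rw [vtx, cyc_add_card]; rfl

lemma pole_period (v : Fin n → S2) (z : ℤ) : pole v (z + n) = pole v z := by
  rw [pole, vtx_period, add_right_comm, vtx_period]; rfl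

variable {v : Fin n → S2}

namespace IsConvexPolygon

lemma det3_adjacent_pos (hv : IsConvexPolygon v) (p r : ℤ) (h1 : p + 1 < r) (h2 : r < p + n) :
    0 < det3 (vtx v p) (vtx v (p + 1)) (vtx v r) := by
  have := hv.counterclockwise (cyc n p) (cyc n r) (cyc_ne (by omega) h2).symm
    (by rw [← cyc_add_one]; exact (cyc_ne h1 (by omega)).symm)
  rw [orient_eq, ← cyc_add_one] at this
  exact this

lemma det3_vtx_pos (hv : IsConvexPolygon v) {p q r : ℤ} (hpq : p < q) (hqr : q < r)
    (hrp : r < p + n) : 0 < det3 (vtx v p) (vtx v q) (vtx v r) :=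
  det3_pos_of_adjacent (vtx_period v) hv.det3_adjacent_pos hpq hqr hrp

lemma cr_ne_zero (hv : IsConvexPolygon v) (z : ℤ) : cr (vtx v z) (vtx v (z + 1)) ≠ 0 := by
  intro h
  have h3 := hv.three_le
  have := hv.det3_adjacent_pos z (z + 2) (by omega) (by omega)
  rw [← inner_cr, h, inner_zero_left] at this
  exact lt_irrefl _ this

lemma pole_norm (hv : IsConvexPolygon v) (z : ℤ) : ‖pole v z‖ = 1 := by
  rw [pole, norm_smul, norm_inv, norm_norm, inv_mul_cancel₀ (norm_ne_zero_iff.2 (hv.cr_ne_zero z))]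

lemma inner_pole_pos (hv : IsConvexPolygon v) {z w : ℤ} (h1 : z + 1 < w) (h2 : w < z + n) :
    0 < (inner ℝ (pole v z) (vtx v w) : ℝ) := by
  rw [pole, real_inner_smul_left, inner_cr]
  exact mul_pos (inv_pos.2 (norm_pos_iff.2 (hv.cr_ne_zero z))) (hv.det3_adjacent_pos z w h1 h2)

end IsConvexPolygon

lemma inner_pole_left (v : Fin n → S2) (z : ℤ) : (inner ℝ (pole v z) (vtx v z) : ℝ) = 0 := by
  rw [pole, real_inner_smul_left, inner_cr_left, mul_zero]

lemma inner_pole_right (v : Fin n → S2) (z : ℤ) :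
    (inner ℝ (pole v z) (vtx v (z + 1)) : ℝ) = 0 := by
  rw [pole, real_inner_smul_left, inner_cr_right, mul_zero]

lemma inner_pole_right' (v : Fin n → S2) (z : ℤ) :
    (inner ℝ (pole v (z - 1)) (vtx v z) : ℝ) = 0 := by
  simpa using inner_pole_right v (z - 1)

lemma exists_vtx_eq (v : Fin n → S2) (i : Fin n) (a : ℤ) :
    ∃ z, a ≤ z ∧ z < a + n ∧ (v i : E3) = vtx v z := by
  obtain ⟨z, h1, h2, h3⟩ := exists_cyc_eq i a
  exact ⟨z, h1, h2, by rw [vtx, h3]⟩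

namespace IsConvexPolygon

lemma inner_pole_nonneg (hv : IsConvexPolygon v) (z : ℤ) (i : Fin n) :
    0 ≤ (inner ℝ (pole v z) (v i : E3) : ℝ) := by
  obtain ⟨w, h1, h2, h3⟩ := exists_vtx_eq v i z
  rw [h3]
  rcases h1.eq_or_lt with h | h
  · rw [← h, inner_pole_left]
  rcases (show z + 1 ≤ w by omega).eq_or_lt with h' | h'
  · rw [← h', inner_pole_right]
  · exact (hv.inner_pole_pos h' h2).le

/-- The sum of all side normals works: each is nonnegative at every vertex, and the normal of the
side `i + 1` is positive at the vertex `i`. -/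
lemma exists_inner_pos (hv : IsConvexPolygon v) :
    ∃ k : E3, ∀ i, 0 < (inner ℝ k (v i : E3) : ℝ) := by
  refine ⟨∑ j : Fin n, pole v (j : ℕ), fun i => ?_⟩
  rw [sum_inner]
  apply Finset.sum_pos'
  · exact fun j _ => hv.inner_pole_nonneg _ _
  · have h3 := hv.three_le
    refine ⟨i + 1, Finset.mem_univ _, ?_⟩
    have e1 : pole v (((i + 1 : Fin n) : ℕ) : ℤ) = pole v ((i : ℕ) + 1) := by
      have : ∀ z, pole v z = pole v ((cyc n z : ℕ) : ℤ) := by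
        intro z
        have h1 : cyc n (((cyc n z : Fin n) : ℕ) : ℤ) = cyc n z := cyc_coe _
        rw [pole, pole, vtx, vtx, vtx, vtx, cyc_add_one, cyc_add_one, h1]
      rw [this ((i : ℕ) + 1), cyc_add_one, cyc_coe]
    have e2 : (v i : E3) = vtx v ((i : ℕ) + n) := by rw [vtx_period, vtx, cyc_coe]
    rw [e1, e2]
    exact hv.inner_pole_pos (by omega) (by omega)

end IsConvexPolygon

namespace IsConvexPolygon

lemma polygon_eq (hv : IsConvexPolygon v) : polygon v = coneSet v := by
  obtain ⟨k, hk⟩ := hv.exists_inner_pos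
  exact polygon_eq_coneSet hk

lemma isSphConvexBody (hv : IsConvexPolygon v) : IsSphConvexBody (polygon v) := by
  obtain ⟨k, hk⟩ := hv.exists_inner_pos
  rw [hv.polygon_eq]
  refine ⟨isClosed_coneSet hk, isSphConvex_coneSet hk, ?_⟩
  have h3 := hv.three_le
  exact interior_coneSet_nonempty (cyc_ne (a := 0) (b := 1) (by omega) (by omega))
    (cyc_ne (a := 0) (b := 2) (by omega) (by omega))
    (cyc_ne (a := 1) (b := 2) (by omega) (by omega))
    (hv.det3_vtx_pos (p := 0) (q := 1) (r := 2) (by omega) (by omega) (by omega))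

lemma vertex_mem (hv : IsConvexPolygon v) (i : Fin n) : v i ∈ polygon v := by
  rw [hv.polygon_eq]; exact vertex_mem_coneSet v i

lemma mem_dualCone_iff (hv : IsConvexPolygon v) {k : E3} :
    k ∈ dualCone (polygon v) ↔ ∀ i, 0 ≤ (inner ℝ k (v i : E3) : ℝ) := by
  constructor
  · exact fun h i => h _ (hv.vertex_mem i)
  · rintro h x hx
    rw [hv.polygon_eq] at hx
    obtain ⟨lam, h0, hx⟩ := hx
    rw [hx, inner_sum]
    simp only [real_inner_smul_right]
    exact Finset.sum_nonneg fun i _ => mul_nonneg (h0 i) (h i)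

lemma inner_vtx_nonneg (hv : IsConvexPolygon v) {k : E3} (hk : k ∈ dualCone (polygon v)) (z : ℤ) :
    0 ≤ (inner ℝ k (vtx v z) : ℝ) := hv.mem_dualCone_iff.1 hk _

lemma pole_mem (hv : IsConvexPolygon v) (z : ℤ) : pole v z ∈ dualCone (polygon v) :=
  hv.mem_dualCone_iff.2 (hv.inner_pole_nonneg z)

lemma pole_ne (hv : IsConvexPolygon v) (z : ℤ) : pole v z ≠ pole v (z + 1) := by
  intro h
  have h3 := hv.three_le
  have h1 := hv.inner_pole_pos (z := z) (w := z + 2) (by omega) (by omega)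
  have h2 := inner_pole_right v (z + 1)
  rw [h, show z + 2 = z + 1 + 1 by ring, h2] at h1
  exact lt_irrefl _ h1

/-- The cross product of adjacent normals is a positive multiple of the common vertex, so the
determinant has the sign of the pairing of that vertex with the third normal. Thus the normals are
in convex position too, and this is the input for `det3_pos_of_adjacent`. -/
lemma det3_pole_adjacent_pos (hv : IsConvexPolygon v) (p r : ℤ) (h1 : p + 1 < r)
    (h2 : r < p + n) : 0 < det3 (pole v p) (pole v (p + 1)) (pole v r) := by
  have h3 := hv.three_le
  have e1 := hv.det3_adjacent_pos p (p + 2) (by omega) (by omega)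
  have e2 : 0 < (inner ℝ (pole v r) (vtx v (p + 1)) : ℝ) := by
    rw [← vtx_period]; exact hv.inner_pole_pos (by omega) (by omega)
  have hcr : cr (cr (vtx v p) (vtx v (p + 1))) (cr (vtx v (p + 1)) (vtx v (p + 1 + 1))) =
      det3 (vtx v p) (vtx v (p + 1)) (vtx v (p + 2)) • vtx v (p + 1) := by
    rw [cr_cr, real_inner_comm, inner_cr, real_inner_comm, inner_cr_left, zero_smul, sub_zero,
      show p + 1 + 1 = p + 2 by ring, ← det3_rotate]
  conv_rhs => rw [pole, pole]
  rw [det3_smul_left, det3_smul_mid, ← inner_cr, hcr, real_inner_smul_left, real_inner_comm]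
  have p1 := inv_pos.2 (norm_pos_iff.2 (hv.cr_ne_zero p))
  have p2 := inv_pos.2 (norm_pos_iff.2 (hv.cr_ne_zero (p + 1)))
  positivity

lemma det3_pole_pos (hv : IsConvexPolygon v) {p q r : ℤ} (hpq : p < q) (hqr : q < r)
    (hrp : r < p + n) : 0 < det3 (pole v p) (pole v q) (pole v r) :=
  det3_pos_of_adjacent (pole_period v) hv.det3_pole_adjacent_pos hpq hqr hrp

/-- Supporting hemispheres through a vertex. -/
lemma exists_eq_pole_combination (hv : IsConvexPolygon v) {b : E3}
    (hb : b ∈ dualCone (polygon v)) {i : ℤ} (hbi : (inner ℝ b (vtx v i) : ℝ) = 0) :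
    ∃ α β : ℝ, 0 ≤ α ∧ 0 ≤ β ∧ b = α • pole v (i - 1) + β • pole v i := by
  have h3 := hv.three_le
  refine exists_nonneg_combination (l := vtx v (i - 1)) (m := vtx v i) (r := vtx v (i + 1))
    ?_ (inner_pole_right' v i) (inner_pole_left v i) hbi (inner_pole_left v (i - 1)) ?_
    (inner_pole_right v i) ?_ (hv.inner_vtx_nonneg hb _) (hv.inner_vtx_nonneg hb _)
  · exact (hv.det3_vtx_pos (by omega) (by omega) (by omega)).ne'
  · exact hv.inner_pole_pos (by omega) (by omega)
  · rw [← vtx_period]; exact hv.inner_pole_pos (by omega) (by omega)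

/-- The points of a side. -/
lemma exists_eq_vtx_combination (hv : IsConvexPolygon v) {x : S2}
    (hx : x ∈ polygon v) {j : ℤ} (hxj : (inner ℝ (pole v j) (x : E3) : ℝ) = 0) :
    ∃ α β : ℝ, 0 ≤ α ∧ 0 ≤ β ∧ (x : E3) = α • vtx v j + β • vtx v (j + 1) := by
  have h3 := hv.three_le
  refine exists_nonneg_combination (l := pole v (j - 1)) (m := pole v j) (r := pole v (j + 1))
    ?_ ?_ ?_ ?_ ?_ ?_ ?_ ?_ ?_ ?_
  · exact (hv.det3_pole_pos (by omega) (by omega) (by omega)).ne'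
  all_goals rw [real_inner_comm]
  · exact inner_pole_left v j
  · exact inner_pole_right v j
  · exact hxj
  · exact inner_pole_right' v j
  · rw [← vtx_period]; exact hv.inner_pole_pos (by omega) (by omega)
  · exact inner_pole_left v (j + 1)
  · exact hv.inner_pole_pos (by omega) (by omega)
  · exact hv.pole_mem _ x hx
  · exact hv.pole_mem _ x hx

/-- A supporting great circle through two vertices contains a side. -/
lemma exists_eq_pole (hv : IsConvexPolygon v) {a : E3} (hn : ‖a‖ = 1)
    (ha : a ∈ dualCone (polygon v)) {i l : ℤ} (hil : i < l) (hli : l < i + n)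
    (hai : (inner ℝ a (vtx v i) : ℝ) = 0) (hal : (inner ℝ a (vtx v l) : ℝ) = 0) :
    ∃ j, a = pole v j := by
  have unit : ∀ (r : ℝ) (z : ℤ), 0 ≤ r → a = r • pole v z → a = pole v z := by
    intro r z hr h
    have h1 := hn
    rw [h, norm_smul, hv.pole_norm, mul_one, Real.norm_of_nonneg hr] at h1
    rw [h, h1, one_smul]
  obtain ⟨α, β, hα, hβ, h⟩ := hv.exists_eq_pole_combination ha hai
  rw [h, inner_add_left, real_inner_smul_left, real_inner_smul_left] at hal
  have h1 := hv.inner_pole_nonneg (i - 1) (cyc n l)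
  have h2 := hv.inner_pole_nonneg i (cyc n l)
  have h3 := hv.three_le
  change 0 ≤ (inner ℝ (pole v (i - 1)) (vtx v l) : ℝ) at h1
  change 0 ≤ (inner ℝ (pole v i) (vtx v l) : ℝ) at h2
  have z1 : α * (inner ℝ (pole v (i - 1)) (vtx v l) : ℝ) = 0 := by
    linarith [mul_nonneg hα h1, mul_nonneg hβ h2]
  have z2 : β * (inner ℝ (pole v i) (vtx v l) : ℝ) = 0 := by
    linarith [mul_nonneg hα h1, mul_nonneg hβ h2]
  by_cases hα0 : α = 0
  · exact ⟨i, unit β i hβ (by rw [h, hα0, zero_smul, zero_add])⟩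
  -- If the normal of the side `i - 1` occurs, it vanishes at the vertex `l`, which is then the
  -- other end of that side modulo `n`.
  · have hl : l = i + n - 1 := by
      by_contra hl
      have := hv.inner_pole_pos (z := i - 1) (w := l) (by omega) (by omega)
      exact hα0 ((mul_eq_zero.1 z1).resolve_right this.ne')
    have := hv.inner_pole_pos (z := i) (w := l) (by omega) (by omega)
    have hβ0 := (mul_eq_zero.1 z2).resolve_right this.ne'
    exact ⟨i - 1, unit α (i - 1) hα (by rw [h, hβ0, zero_smul, add_zero])⟩

end IsConvexPolygon

end Polygon

/-! ### Width pairs of reduced polygons -/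

section Reduced

variable {n : ℕ} [NeZero n] {v : Fin n → S2}

lemma sin_pos_of_lt {ω : ℝ} (h : 0 < ω) (h' : ω < Real.pi / 2) : 0 < Real.sin ω :=
  Real.sin_pos_of_pos_of_lt_pi h (by linarith [Real.pi_pos])

lemma cos_pos_of_lt {ω : ℝ} (h : 0 < ω) (h' : ω < Real.pi / 2) : 0 < Real.cos ω :=
  Real.cos_pos_of_mem_Ioo ⟨by linarith [Real.pi_pos], h'⟩

lemma sqrt_one_sub_cos_sq {ω : ℝ} (h : 0 < ω) (h' : ω < Real.pi / 2) :
    √(1 - (-Real.cos ω) ^ 2) = Real.sin ω := by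
  rw [neg_sq, ← Real.sin_sq, Real.sqrt_sq (sin_pos_of_lt h h').le]

namespace IsConvexPolygon

lemma exists_widthPair (hv : IsConvexPolygon v) : ∃ a b, IsWidthPair (polygon v) a b :=
  exists_isWidthPair (hv.pole_mem 0) (ne_zero_of_norm_one (hv.pole_norm 0))

lemma inner_widthPair (hv : IsConvexPolygon v) {a b : E3} (h : IsWidthPair (polygon v) a b) :
    (inner ℝ a b : ℝ) = -Real.cos (thickness (polygon v)) := by
  have hne := h.ne (hv.pole_norm 0) (hv.pole_norm (0 + 1)) (hv.pole_mem 0) (hv.pole_mem (0 + 1))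
    (hv.pole_ne 0)
  rw [h.thickness_eq hv.isSphConvexBody.2.2 hne, Real.cos_arccos, neg_neg]
  · linarith [(abs_le.1 (abs_inner_le_one h.norm_left h.norm_right)).2]
  · linarith [(abs_le.1 (abs_inner_le_one h.norm_left h.norm_right)).1]

/-- The sum of the two normals at a vertex touches the polygon there only. The uniform gap `δ` at
the other vertices allows a small corner to be cut off. -/
lemma exists_supporting (hv : IsConvexPolygon v) (i : Fin n) :
    ∃ k ∈ dualCone (polygon v), ∃ δ : ℝ, 0 < δ ∧ (inner ℝ k (v i : E3) : ℝ) = 0 ∧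
      ∀ l, l ≠ i → δ ≤ (inner ℝ k (v l : E3) : ℝ) := by
  classical
  set k : E3 := pole v ((i : ℕ) - 1) + pole v (i : ℕ) with hk
  have hi : (v i : E3) = vtx v (i : ℕ) := by rw [vtx, cyc_coe]
  have h3 := hv.three_le
  have hpos : ∀ l, l ≠ i → 0 < (inner ℝ k (v l : E3) : ℝ) := by
    intro l hl
    obtain ⟨z, h1, h2, hzl⟩ := exists_cyc_eq l ((i : ℕ) : ℤ)
    have h4 : (v l : E3) = vtx v z := by rw [vtx, hzl]
    have e1 := hv.inner_pole_nonneg ((i : ℕ) - 1) l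
    have e2 := hv.inner_pole_nonneg (i : ℕ) l
    rw [hk, inner_add_left]
    have hz : z ≠ (i : ℕ) := by
      rintro rfl
      rw [cyc_coe] at hzl
      exact hl hzl.symm
    by_cases hz1 : z = (i : ℕ) + 1
    · have := hv.inner_pole_pos (z := (i : ℕ) - 1) (w := z) (by omega) (by omega)
      rw [← h4] at this
      linarith
    · have := hv.inner_pole_pos (z := (i : ℕ)) (w := z) (by omega) (by omega)
      rw [← h4] at this
      linarith
  obtain ⟨l₀, hl₀⟩ := Finite.exists_min
    (fun l : Fin n => if l = i then (1 : ℝ) else inner ℝ k (v l : E3))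
  refine ⟨k, dualCone_add (hv.pole_mem _) (hv.pole_mem _),
    if l₀ = i then (1 : ℝ) else inner ℝ k (v l₀ : E3), ?_, ?_, fun l hl => ?_⟩
  · split_ifs with h
    · exact one_pos
    · exact hpos _ h
  · rw [hi, hk, inner_add_left, inner_pole_left, inner_pole_right', add_zero]
  · have := hl₀ l
    simpa only [if_neg hl] using this

end IsConvexPolygon

/-- Cutting off a small piece at a vertex of a reduced polygon produces a thinner lune, one of
whose semicircles has its centre near that vertex. -/
lemma exists_thin_lune (hv : IsConvexPolygon v) (hr : IsReducedBody (polygon v)) {ω : ℝ}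
    (h0 : 0 < ω) (hω' : ω < Real.pi / 2) (hω : thickness (polygon v) = ω) (i : Fin n) :
    ∃ η₀ : ℝ, 0 < η₀ ∧ ∀ η : ℝ, 0 < η → η < η₀ → ∃ a b : E3, ‖a‖ = 1 ∧ ‖b‖ = 1 ∧
      (inner ℝ a b : ℝ) ≤ -Real.cos ω ∧ (∀ l, -η ≤ (inner ℝ a (v l : E3) : ℝ)) ∧
      (∀ l, -η ≤ (inner ℝ b (v l : E3) : ℝ)) ∧
      ‖a - (inner ℝ a b : ℝ) • b - √(1 - (inner ℝ a b : ℝ) ^ 2) • (v i : E3)‖ ≤ 4 * η := by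
  obtain ⟨k₀, hk₀, δ, hδ, hki, hkl⟩ := hv.exists_supporting i
  have hbody := hv.isSphConvexBody
  obtain ⟨z, hz⟩ := hbody.2.2
  have h3 := hv.three_le
  obtain ⟨l₁, hl₁⟩ : ∃ l : Fin n, l ≠ i := by
    have : Nontrivial (Fin n) := Fin.nontrivial_iff_two_le.2 (by omega)
    exact exists_ne i
  have hk₀0 : k₀ ≠ 0 := by
    rintro rfl
    have := hkl l₁ hl₁
    rw [inner_zero_left] at this
    linarith
  have hkz := inner_pos_of_mem_interior hk₀ hk₀0 hz
  have hω0 := cos_pos_of_lt h0 hω'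
  -- The second bound makes `ε < ⟪k₀, z⟫`, so the interior point `z` survives the cut.
  refine ⟨min (1 / 2) (2 * (inner ℝ k₀ (z : E3) : ℝ) / δ), by positivity, fun η hη hη' => ?_⟩
  have hη1 : η < 1 / 2 := hη'.trans_le (min_le_left _ _)
  have hη2 : η * δ / 2 < (inner ℝ k₀ (z : E3) : ℝ) := by
    have := hη'.trans_le (min_le_right _ _)
    rw [lt_div_iff₀ hδ] at this
    linarith
  -- With this `ε`, the vector `k` is `-ε` at vertex `i` and at least `δ / 2` at the others, so the
  -- cut removes vertex `i` but keeps the directions `v i + η • v l`.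
  set ε := η * δ / 2 with hε
  have hε0 : 0 < ε := by positivity
  set k : E3 := k₀ - ε • (v i : E3) with hk
  have hkx : ∀ x : S2, (inner ℝ k (x : E3) : ℝ) =
      inner ℝ k₀ (x : E3) - ε * inner ℝ (v i : E3) (x : E3) := by
    intro x; rw [hk, inner_sub_left, real_inner_smul_left]
  have hle1 : ∀ x y : S2, (inner ℝ (x : E3) (y : E3) : ℝ) ≤ 1 := fun x y =>
    (abs_le.1 (abs_inner_le_one x.norm y.norm)).2
  have hkvi : (inner ℝ k (v i : E3) : ℝ) = -ε := by
    rw [hkx, hki, S2.inner_self]; ring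
  have hkvl : ∀ l, l ≠ i → δ / 2 ≤ (inner ℝ k (v l : E3) : ℝ) := by
    intro l hl
    have e1 := hkl l hl
    have e2 := hle1 (v i) (v l)
    rw [hkx]
    nlinarith
  set R : Set S2 := polygon v ∩ {x | 0 ≤ (inner ℝ k (x : E3) : ℝ)} with hR
  have hRsub : R ⊆ polygon v := Set.inter_subset_left
  have hvl : ∀ l, l ≠ i → v l ∈ R := by
    intro l hl
    refine ⟨hv.vertex_mem l, ?_⟩
    rw [Set.mem_ofPred_eq]
    linarith [hkvl l hl]
  have hRbody : IsSphConvexBody R := by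
    refine ⟨hbody.1.inter (isClosed_le continuous_const (by fun_prop)), ?_, ?_⟩
    · rintro a ⟨ha, ha'⟩ b ⟨hb, hb'⟩
      refine ⟨(hbody.2.1 a ha b hb).1, fun x hx => ⟨(hbody.2.1 a ha b hb).2 hx, ?_⟩⟩
      obtain ⟨s, t, hs, ht, hx⟩ := hx
      rw [Set.mem_ofPred_eq] at ha' hb' ⊢
      rw [hx, inner_add_right, real_inner_smul_right, real_inner_smul_right]
      exact add_nonneg (mul_nonneg hs ha') (mul_nonneg ht hb')
    · have hO : IsOpen (interior (polygon v) ∩ {x : S2 | 0 < (inner ℝ k (x : E3) : ℝ)}) :=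
        isOpen_interior.inter (isOpen_lt continuous_const (by fun_prop))
      refine ⟨z, mem_interior.2 ⟨_, ?_, hO, hz, ?_⟩⟩
      · rintro x ⟨h1, h2⟩
        refine ⟨interior_subset h1, ?_⟩
        rw [Set.mem_ofPred_eq] at h2 ⊢
        exact h2.le
      · rw [Set.mem_ofPred_eq, hkx]
        have := hle1 (v i) z
        nlinarith
  have hRss : R ⊂ polygon v := by
    refine ⟨hRsub, fun h => ?_⟩
    have := (h (hv.vertex_mem i)).2
    rw [Set.mem_ofPred_eq, hkvi] at this
    linarith
  have hthin := hr.2 R hRbody hRss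
  obtain ⟨a, b, hab⟩ := exists_isWidthPair (dualCone_anti hRsub hk₀) hk₀0
  have hne := hab.ne (hv.pole_norm 0) (hv.pole_norm (0 + 1)) (dualCone_anti hRsub (hv.pole_mem 0))
    (dualCone_anti hRsub (hv.pole_mem (0 + 1))) (hv.pole_ne 0)
  rw [hab.thickness_eq hRbody.2.2 hne, hω] at hthin
  have hp : (inner ℝ a b : ℝ) < -Real.cos ω := by
    have h1 := abs_le.1 (abs_inner_le_one hab.norm_left hab.norm_right)
    have h2 := Real.strictAntiOn_cos ⟨Real.arccos_nonneg _, Real.arccos_le_pi _⟩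
      ⟨h0.le, by linarith [Real.pi_pos]⟩ hthin
    rw [Real.cos_arccos (by linarith) (by linarith)] at h2
    linarith
  clear hthin hne
  have hvi : ∀ c ∈ dualCone R, ∀ l, l ≠ i →
      0 ≤ (inner ℝ c (v i : E3) : ℝ) + η * inner ℝ c (v l : E3) := by
    intro c hc l hl
    have hsum : (v i : E3) + η • (v l : E3) = (1 : ℝ) • (v i : E3) + η • (v l : E3) := by
      rw [one_smul]
    obtain ⟨r, hr, x, hx, he⟩ := hbody.2.1.add_mem_cone (hv.vertex_mem i) (hv.vertex_mem l)
      zero_le_one hη.le (by positivity)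
    have hxR : x ∈ R := by
      refine ⟨hx, ?_⟩
      rw [Set.mem_ofPred_eq]
      have h1 : 0 ≤ (inner ℝ k (r • (x : E3)) : ℝ) := by
        rw [← he, inner_add_right, real_inner_smul_right, real_inner_smul_right, hkvi]
        have := hkvl l hl
        have : η * (δ / 2) ≤ η * inner ℝ k (v l : E3) := mul_le_mul_of_nonneg_left this hη.le
        linarith
      rw [real_inner_smul_right] at h1
      exact (mul_nonneg_iff_of_pos_left hr).1 h1
    have h1 : 0 ≤ (inner ℝ c (r • (x : E3)) : ℝ) := by
      rw [real_inner_smul_right]; exact mul_nonneg hr.le (hc x hxR)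
    rw [← he, inner_add_right, real_inner_smul_right, real_inner_smul_right, one_mul] at h1
    exact h1
  have hlow : ∀ c ∈ dualCone R, ‖c‖ = 1 → ∀ l, -η ≤ (inner ℝ c (v l : E3) : ℝ) := by
    intro c hc hc1 l
    by_cases hl : l = i
    · subst hl
      have h1 := hvi c hc l₁ hl₁
      have h2 := (abs_le.1 (abs_inner_le_one hc1 (v l₁).norm)).2
      nlinarith
    · linarith [hc _ (hvl l hl)]
  -- The thinner lune must cut off vertex `i`; otherwise it would contain the whole polygon.
  have hneg : (inner ℝ a (v i : E3) : ℝ) < 0 ∨ (inner ℝ b (v i : E3) : ℝ) < 0 := by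
    by_contra hcon
    push Not at hcon
    have hmem : ∀ c ∈ dualCone R, 0 ≤ (inner ℝ c (v i : E3) : ℝ) → c ∈ dualCone (polygon v) := by
      intro c hc hci
      rw [hv.mem_dualCone_iff]
      intro l
      by_cases hl : l = i
      · rw [hl]; exact hci
      · exact hc _ (hvl l hl)
    obtain ⟨a', b', h'⟩ := hv.exists_widthPair
    have h1 := h'.inner_le hab.norm_left hab.norm_right (hmem a hab.left_mem hcon.1)
      (hmem b hab.right_mem hcon.2)
    rw [hv.inner_widthPair h', hω] at h1
    linarith
  -- The centre `x` on the boundary of the hemisphere of `b` is a combination of vertices. As `b` is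
  -- negative at vertex `i` and, by `hvi`, larger by a factor `1 / η` at the others, `⟪b, x⟫ = 0`
  -- forces the other weights to total at most `η * lam i`; hence `x` is within `4 * η` of the
  -- vertex.
  have main : ∀ a b : E3, IsWidthPair R a b → (inner ℝ a b : ℝ) < -Real.cos ω →
      (inner ℝ b (v i : E3) : ℝ) < 0 →
      ‖a - (inner ℝ a b : ℝ) • b - √(1 - (inner ℝ a b : ℝ) ^ 2) • (v i : E3)‖ ≤ 4 * η := by
    intro a b hab hp hbi
    obtain ⟨x, hx, he⟩ := hab.exists_center hRbody (by linarith)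
    set p : ℝ := inner ℝ a b
    have hs1 : √(1 - p ^ 2) ≤ 1 := by
      rw [Real.sqrt_le_one]; nlinarith
    have hs0 : 0 ≤ √(1 - p ^ 2) := Real.sqrt_nonneg _
    have hxb : (inner ℝ b (x : E3) : ℝ) = 0 := by
      have h1 : (inner ℝ b (a - p • b) : ℝ) = 0 := by
        rw [inner_sub_right, real_inner_smul_right, inner_self_of_norm hab.norm_right,
          real_inner_comm]
        simp [p]
      rw [he, real_inner_smul_right] at h1
      refine (mul_eq_zero.1 h1).resolve_left (Real.sqrt_pos.2 ?_).ne'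
      have h2 := hab.ne (hv.pole_norm 0) (hv.pole_norm (0 + 1))
        (dualCone_anti hRsub (hv.pole_mem 0)) (dualCone_anti hRsub (hv.pole_mem (0 + 1)))
        (hv.pole_ne 0)
      have h3 := ne_neg_of_mem_dualCone hRbody.2.2 (ne_zero_of_norm_one hab.norm_left)
        hab.left_mem hab.right_mem
      have h4 := inner_lt_one_of_ne hab.norm_left hab.norm_right h2
      have h5 := neg_one_lt_inner_of_ne hab.norm_left hab.norm_right h3
      nlinarith
    have hx' := hRsub hx
    rw [hv.polygon_eq] at hx'
    obtain ⟨lam, hlam, hxl⟩ := hx'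
    rw [← Finset.add_sum_erase _ _ (Finset.mem_univ i)] at hxl
    set S := ∑ l ∈ Finset.univ.erase i, lam l with hS
    have hS0 : 0 ≤ S := Finset.sum_nonneg fun l _ => hlam l
    have hSle : S ≤ η * lam i := by
      have h1 := hxb
      rw [hxl, inner_add_right, inner_sum, real_inner_smul_right] at h1
      simp only [real_inner_smul_right] at h1
      have h2 : S * -(inner ℝ b (v i : E3) : ℝ) ≤
          η * ∑ l ∈ Finset.univ.erase i, lam l * inner ℝ b (v l : E3) := by
        rw [hS, Finset.sum_mul, Finset.mul_sum]
        refine Finset.sum_le_sum fun l hl => ?_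
        have := hvi b hab.right_mem l (Finset.ne_of_mem_erase hl)
        nlinarith [hlam l]
      have h3 : S * -(inner ℝ b (v i : E3) : ℝ) ≤ η * lam i * -(inner ℝ b (v i : E3) : ℝ) := by
        have : ∑ l ∈ Finset.univ.erase i, lam l * (inner ℝ b (v l : E3) : ℝ) =
            lam i * -(inner ℝ b (v i : E3) : ℝ) := by linarith
        rw [this] at h2
        linarith
      exact le_of_mul_le_mul_right h3 (by linarith)
    have hdist : ‖(x : E3) - lam i • (v i : E3)‖ ≤ S := by
      rw [hxl, add_sub_cancel_left]
      refine (norm_sum_le _ _).trans (Finset.sum_le_sum fun l _ => ?_)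
      rw [norm_smul, (v l).norm, mul_one, Real.norm_of_nonneg (hlam l)]
    have hn : ‖lam i • (v i : E3)‖ = lam i := by
      rw [norm_smul, (v i).norm, mul_one, Real.norm_of_nonneg (hlam i)]
    have hl1 : |1 - lam i| ≤ S := by
      have := abs_norm_sub_norm_le (x : E3) (lam i • (v i : E3))
      rw [x.norm, hn] at this
      exact this.trans hdist
    have hl2 : lam i ≤ 2 := by
      have := (abs_le.1 hl1).1
      nlinarith [hlam i]
    have hxv : ‖(x : E3) - (v i : E3)‖ ≤ 4 * η := by
      calc ‖(x : E3) - (v i : E3)‖ =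
          ‖((x : E3) - lam i • (v i : E3)) - (1 - lam i) • (v i : E3)‖ := by congr 1; module
        _ ≤ ‖(x : E3) - lam i • (v i : E3)‖ + ‖(1 - lam i) • (v i : E3)‖ := norm_sub_le _ _
        _ ≤ S + S := by
          refine add_le_add hdist ?_
          rw [norm_smul, (v i).norm, mul_one]
          exact hl1
        _ ≤ 4 * η := by nlinarith
    rw [he, ← smul_sub, norm_smul, Real.norm_of_nonneg hs0]
    nlinarith [norm_nonneg ((x : E3) - (v i : E3))]
  rcases hneg with h | h
  · refine ⟨b, a, hab.norm_right, hab.norm_left, ?_, hlow b hab.right_mem hab.norm_right,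
      hlow a hab.left_mem hab.norm_left, ?_⟩
    · rw [real_inner_comm]; exact hp.le
    · exact main b a hab.symm (by rw [real_inner_comm]; exact hp) h
  · exact ⟨a, b, hab.norm_left, hab.norm_right, hp.le, hlow a hab.left_mem hab.norm_left,
      hlow b hab.right_mem hab.norm_right, main a b hab hp h⟩

/-- Every vertex of a reduced polygon is the centre of one of the semicircles bounding a lune of
minimal thickness that contains the polygon. -/
lemma exists_widthPair_center (hv : IsConvexPolygon v) (hr : IsReducedBody (polygon v)) {ω : ℝ}
    (h0 : 0 < ω) (hω' : ω < Real.pi / 2) (hω : thickness (polygon v) = ω) (i : Fin n) :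
    ∃ a b : E3, IsWidthPair (polygon v) a b ∧
      a + Real.cos ω • b = Real.sin ω • (v i : E3) := by
  obtain ⟨η₀, hη₀, hη⟩ := exists_thin_lune hv hr h0 hω' hω i
  -- The thin lunes for `η → 0` have a convergent subsequence. The shift by `2` gives `e m < η₀`
  -- even for `m = 0`.
  let e : ℕ → ℝ := fun m => η₀ / ((m : ℝ) + 2)
  have he0 : ∀ m, 0 < e m := fun m => by positivity
  have he1 : ∀ m, e m < η₀ := fun m => by
    rw [div_lt_iff₀ (by positivity)]
    have : (0 : ℝ) ≤ m := Nat.cast_nonneg m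
    nlinarith
  have helim : Filter.Tendsto e Filter.atTop (nhds 0) := by
    refine Filter.Tendsto.div_atTop tendsto_const_nhds ?_
    exact Filter.tendsto_atTop_add_const_right _ _ tendsto_natCast_atTop_atTop
  choose a b ha hb hp hal hbl hd using fun m => hη (e m) (he0 m) (he1 m)
  have hK : IsCompact (Metric.sphere (0 : E3) 1 ×ˢ Metric.sphere (0 : E3) 1) :=
    (isCompact_sphere 0 1).prod (isCompact_sphere 0 1)
  obtain ⟨⟨A, B⟩, ⟨hA, hB⟩, φ, hφ, hlim⟩ := hK.tendsto_subseq (x := fun m => (a m, b m))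
    (fun m => ⟨by simpa using ha m, by simpa using hb m⟩)
  have hA1 : ‖A‖ = 1 := by simpa using hA
  have hB1 : ‖B‖ = 1 := by simpa using hB
  have hlA : Filter.Tendsto (fun m => a (φ m)) Filter.atTop (nhds A) :=
    (continuous_fst.tendsto _).comp hlim
  have hlB : Filter.Tendsto (fun m => b (φ m)) Filter.atTop (nhds B) :=
    (continuous_snd.tendsto _).comp hlim
  have hle : Filter.Tendsto (fun m => e (φ m)) Filter.atTop (nhds 0) :=
    helim.comp hφ.tendsto_atTop
  have hmem : ∀ (c : ℕ → E3) (C : E3), Filter.Tendsto (fun m => c (φ m)) Filter.atTop (nhds C) →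
      (∀ m l, -e m ≤ (inner ℝ (c m) (v l : E3) : ℝ)) → C ∈ dualCone (polygon v) := by
    intro c C hc hcl
    rw [hv.mem_dualCone_iff]
    intro l
    have h1 : Filter.Tendsto (fun m => (inner ℝ (c (φ m)) (v l : E3) : ℝ)) Filter.atTop
        (nhds (inner ℝ C (v l : E3))) := hc.inner tendsto_const_nhds
    have h2 : Filter.Tendsto (fun m => -e (φ m)) Filter.atTop (nhds 0) := by simpa using hle.neg
    exact le_of_tendsto_of_tendsto' h2 h1 fun m => hcl (φ m) l
  have hinner : Filter.Tendsto (fun m => (inner ℝ (a (φ m)) (b (φ m)) : ℝ)) Filter.atTop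
      (nhds (inner ℝ A B)) := hlA.inner hlB
  have hAB : (inner ℝ A B : ℝ) ≤ -Real.cos ω := le_of_tendsto' hinner fun m => hp (φ m)
  obtain ⟨a', b', h'⟩ := hv.exists_widthPair
  have hi' := hv.inner_widthPair h'
  rw [hω] at hi'
  have hpair : IsWidthPair (polygon v) A B :=
    h'.of_le hA1 hB1 (hmem a A hlA hal) (hmem b B hlB hbl) (by rw [hi']; exact hAB)
  have hpe := hv.inner_widthPair hpair
  rw [hω] at hpe
  refine ⟨A, B, hpair, ?_⟩
  have hcont : Filter.Tendsto (fun m => ‖a (φ m) - (inner ℝ (a (φ m)) (b (φ m)) : ℝ) • b (φ m) -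
      √(1 - (inner ℝ (a (φ m)) (b (φ m)) : ℝ) ^ 2) • (v i : E3)‖) Filter.atTop
      (nhds ‖A - (inner ℝ A B : ℝ) • B - √(1 - (inner ℝ A B : ℝ) ^ 2) • (v i : E3)‖) := by
    refine Filter.Tendsto.norm ((hlA.sub (hinner.smul hlB)).sub (Filter.Tendsto.smul ?_
      tendsto_const_nhds))
    exact (Real.continuous_sqrt.tendsto _).comp (tendsto_const_nhds.sub (hinner.pow 2))
  have hz : ‖A - (inner ℝ A B : ℝ) • B - √(1 - (inner ℝ A B : ℝ) ^ 2) • (v i : E3)‖ ≤ 0 := by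
    have h4 : Filter.Tendsto (fun m => 4 * e (φ m)) Filter.atTop (nhds 0) := by
      simpa using hle.const_mul 4
    exact le_of_tendsto_of_tendsto' hcont h4 fun m => hd (φ m)
  rw [norm_le_zero_iff, hpe, sqrt_one_sub_cos_sq h0 hω', sub_eq_zero, neg_smul, sub_neg_eq_add] at hz
  exact hz

/-- If the centre of one of the semicircles bounding a lune of minimal thickness is a vertex, then
the other semicircle contains a side of the polygon. -/
lemma IsWidthPair.exists_eq_pole (hv : IsConvexPolygon v) {ω : ℝ}
    (h0 : 0 < ω) (hω' : ω < Real.pi / 2) (hω : thickness (polygon v) = ω) {a b : E3}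
    (hab : IsWidthPair (polygon v) a b) {i : ℤ}
    (hi : a + Real.cos ω • b = Real.sin ω • vtx v i) : ∃ j, a = pole v j := by
  have hs := sin_pos_of_lt h0 hω'
  have hc := cos_pos_of_lt h0 hω'
  have hsc := Real.sin_sq_add_cos_sq ω
  have hp := hv.inner_widthPair hab
  rw [hω] at hp
  have haa := inner_self_of_norm hab.norm_left
  have hbb := inner_self_of_norm hab.norm_right
  have hba : (inner ℝ b a : ℝ) = -Real.cos ω := by rw [real_inner_comm]; exact hp
  obtain ⟨x, hx, hxe⟩ := hab.symm.exists_center hv.isSphConvexBody (by linarith)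
  rw [hba, sqrt_one_sub_cos_sq h0 hω', neg_smul, sub_neg_eq_add] at hxe
  have hax : (inner ℝ a (x : E3) : ℝ) = 0 := by
    have : (inner ℝ a (Real.sin ω • (x : E3)) : ℝ) = 0 := by
      rw [← hxe, inner_add_right, real_inner_smul_right, haa, hp]; ring
    rw [real_inner_smul_right] at this
    exact (mul_eq_zero.1 this).resolve_left hs.ne'
  have hbi : (inner ℝ b (vtx v i) : ℝ) = 0 := by
    have : (inner ℝ b (Real.sin ω • vtx v i) : ℝ) = 0 := by
      rw [← hi, inner_add_right, real_inner_smul_right, hbb, hba]; ring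
    rw [real_inner_smul_right] at this
    exact (mul_eq_zero.1 this).resolve_left hs.ne'
  -- Otherwise the great circle of `a` meets the polygon in a single vertex `l`, so `a` can be
  -- tilted slightly both ways along `ν = a × b`, while `b` can be tilted at least one way about the
  -- vertex `i`. Opposite tilts contradict `IsWidthPair.not_rotate`.
  by_contra hcon
  have huniq : ∀ l l' : Fin n, l ≠ l' → (inner ℝ a (v l : E3) : ℝ) = 0 →
      0 < (inner ℝ a (v l' : E3) : ℝ) := by
    intro l l' hll hl
    refine lt_of_le_of_ne (hv.mem_dualCone_iff.1 hab.left_mem l') fun hl' => hcon ?_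
    obtain ⟨z, h1, h2, h3⟩ := exists_cyc_eq l' ((l : ℕ) : ℤ)
    refine hv.exists_eq_pole hab.norm_left hab.left_mem (i := (l : ℕ)) (l := z) ?_ h2
      (by rw [vtx, cyc_coe]; exact hl) (by rw [vtx, h3]; exact hl'.symm)
    refine lt_of_le_of_ne h1 ?_
    rintro rfl
    rw [cyc_coe] at h3
    exact hll h3
  have hx' := hx
  rw [hv.polygon_eq] at hx'
  obtain ⟨lam, hlam, hxl⟩ := hx'
  have hact : ∀ l, lam l ≠ 0 → (inner ℝ a (v l : E3) : ℝ) = 0 := by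
    have h1 := hax
    rw [hxl, inner_sum] at h1
    simp only [real_inner_smul_right] at h1
    rw [Finset.sum_eq_zero_iff_of_nonneg (fun l _ => mul_nonneg (hlam l)
      (hv.mem_dualCone_iff.1 hab.left_mem l))] at h1
    exact fun l hl => (mul_eq_zero.1 (h1 l (Finset.mem_univ l))).resolve_left hl
  obtain ⟨l, hl⟩ : ∃ l, lam l ≠ 0 := by
    by_contra h
    push Not at h
    rw [Finset.sum_eq_zero (fun i _ => by rw [h i, zero_smul])] at hxl
    exact ne_zero_of_norm_one x.norm hxl
  have hlz := hact l hl
  have hother : ∀ l', l' ≠ l → lam l' = 0 := by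
    intro l' hl'
    by_contra h
    have := huniq l l' hl'.symm hlz
    rw [hact l' h] at this
    exact lt_irrefl _ this
  have hxl' : (x : E3) = lam l • (v l : E3) := by
    rw [hxl]
    exact Finset.sum_eq_single l (fun b _ hb => by rw [hother b hb, zero_smul]) (by simp)
  set ν := cr a b with hν
  have hνν : (inner ℝ ν ν : ℝ) = 1 - Real.cos ω ^ 2 := by
    rw [hν, inner_cr_cr, haa, hbb, hp, hba]; ring
  have hνν0 : 0 < (inner ℝ ν ν : ℝ) := by rw [hνν]; nlinarith
  have hν0 : ν ≠ 0 := fun h => by rw [h, inner_zero_left] at hνν0; exact lt_irrefl _ hνν0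
  have haν : (inner ℝ a ν : ℝ) = 0 := by rw [real_inner_comm]; exact inner_cr_left a b
  have hbν : (inner ℝ b ν : ℝ) = 0 := by rw [real_inner_comm]; exact inner_cr_right a b
  have hνl : (inner ℝ ν (v l : E3) : ℝ) = 0 := by
    have h1 : (inner ℝ ν (Real.sin ω • (x : E3)) : ℝ) = 0 := by
      rw [← hxe, inner_add_right, real_inner_smul_right, hν, inner_cr_left, inner_cr_right]; ring
    rw [hxl', real_inner_smul_right, real_inner_smul_right] at h1
    exact (mul_eq_zero.1 ((mul_eq_zero.1 h1).resolve_left hs.ne')).resolve_left hl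
  have hiν : (inner ℝ (vtx v i) ν : ℝ) = 0 := by
    have h1 : (inner ℝ (Real.sin ω • vtx v i) ν : ℝ) = 0 := by
      rw [← hi, inner_add_left, real_inner_smul_left, haν, hbν]; ring
    rw [real_inner_smul_left] at h1
    exact (mul_eq_zero.1 h1).resolve_left hs.ne'
  have hdet : det3 (vtx v i) b ν ≠ 0 := by
    intro h
    have h1 : det3 (Real.sin ω • vtx v i) b ν = 0 := by rw [det3_smul_left, h, mul_zero]
    rw [← hi, det3_add_left, det3_smul_left, det3_self_left, ← inner_cr, ← hν] at h1
    linarith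
  have hdecomp : ∀ k : E3, (inner ℝ k (vtx v i) : ℝ) = 0 →
      k = (inner ℝ k b : ℝ) • b - (-((inner ℝ k ν : ℝ) / inner ℝ ν ν)) • ν := by
    intro k hk
    rw [← sub_eq_zero]
    apply eq_zero_of_det3_ne_zero hdet
    · simp only [inner_sub_left, real_inner_smul_left, hk, hbi, real_inner_comm (vtx v i) ν, hiν]
      ring
    · simp only [inner_sub_left, real_inner_smul_left, hbb, real_inner_comm b ν, hbν]
      ring
    · simp only [inner_sub_left, real_inner_smul_left, hbν]
      field_simp
      ring
  -- The normals of the two sides at the vertex are distinct, so they are not both `b`, and one of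
  -- them has a component along `ν`.
  obtain ⟨k, hkmem, hki, hkν⟩ : ∃ k ∈ dualCone (polygon v), (inner ℝ k (vtx v i) : ℝ) = 0 ∧
      (inner ℝ k ν : ℝ) ≠ 0 := by
    by_contra hno
    push Not at hno
    have heq : ∀ z, (inner ℝ (pole v z) (vtx v i) : ℝ) = 0 → pole v z = b := by
      intro z hz
      have h1 := hdecomp _ hz
      rw [hno _ (hv.pole_mem z) hz, zero_div, neg_zero, zero_smul, sub_zero] at h1
      have h2 := hv.pole_norm z
      rw [h1, norm_smul, hab.norm_right, mul_one, Real.norm_eq_abs] at h2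
      rcases (abs_eq zero_le_one).1 h2 with h3 | h3
      · rw [h1, h3, one_smul]
      · exfalso
        rw [h3] at h1
        exact ne_neg_of_mem_dualCone hv.isSphConvexBody.2.2
          (ne_zero_of_norm_one (hv.pole_norm z)) (hv.pole_mem z) hab.right_mem
          (by rw [h1]; simp)
    have e1 := heq i (inner_pole_left v i)
    have e2 := heq (i - 1) (inner_pole_right' v i)
    have e3 := hv.pole_ne (i - 1)
    rw [sub_add_cancel] at e3
    exact e3 (e2.trans e1.symm)
  obtain ⟨δ, hδ, hδl⟩ : ∃ δ : ℝ, 0 < δ ∧ ∀ l', δ * |(inner ℝ ν (v l' : E3) : ℝ)| ≤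
      inner ℝ a (v l' : E3) := by
    classical
    obtain ⟨l₀, hl₀⟩ := Finite.exists_min (fun l' : Fin n => if l' = l then (1 : ℝ) else
      inner ℝ a (v l' : E3) / (1 + |(inner ℝ ν (v l' : E3) : ℝ)|))
    refine ⟨if l₀ = l then (1 : ℝ) else
      inner ℝ a (v l₀ : E3) / (1 + |(inner ℝ ν (v l₀ : E3) : ℝ)|), ?_, fun l' => ?_⟩
    · split_ifs with h
      · exact one_pos
      · have := huniq l l₀ (Ne.symm h) hlz
        positivity
    · by_cases h : l' = l
      · rw [h, hνl, hlz]; simp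
      · have h1 := hl₀ l'
        simp only [if_neg h] at h1
        rw [le_div_iff₀ (by positivity)] at h1
        have h2 : (0 : ℝ) ≤ if l₀ = l then (1 : ℝ) else
            inner ℝ a (v l₀ : E3) / (1 + |(inner ℝ ν (v l₀ : E3) : ℝ)|) := by
          split_ifs
          · exact zero_le_one
          · exact div_nonneg (hv.mem_dualCone_iff.1 hab.left_mem l₀) (by positivity)
        nlinarith
  have hmove : ∀ e : ℝ, |e| = δ → (1 : ℝ) • a + e • ν ∈ dualCone (polygon v) := by
    intro e he
    rw [hv.mem_dualCone_iff]
    intro l'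
    rw [one_smul, inner_add_left, real_inner_smul_left]
    have h1 := hδl l'
    have h2 : |e * (inner ℝ ν (v l' : E3) : ℝ)| ≤ inner ℝ a (v l' : E3) := by
      rw [abs_mul, he]; exact h1
    linarith [(abs_le.1 h2).1]
  have hk := hdecomp k hki
  have hpm : (-1 : ℝ) < inner ℝ a b := by rw [hp]; nlinarith
  rcases lt_or_gt_of_ne hkν with h | h
  · refine hab.not_rotate hpm hν0 haν hbν hδ (γ' := -((inner ℝ k ν : ℝ) / inner ℝ ν ν)) ?_
      (hmove δ (abs_of_pos hδ)) (by rw [← hk]; exact hkmem)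
    exact neg_pos.2 (div_neg_of_neg_of_pos h hνν0)
  · refine hab.not_rotate hpm (neg_ne_zero.2 hν0) (by rw [inner_neg_right, haν, neg_zero])
      (by rw [inner_neg_right, hbν, neg_zero]) hδ
      (γ' := ((inner ℝ k ν : ℝ) / inner ℝ ν ν)) (α := 1) (β := inner ℝ k b) (div_pos h hνν0) ?_ ?_
    · have := hmove (-δ) (by rw [abs_neg, abs_of_pos hδ])
      rwa [neg_smul, ← smul_neg] at this
    · rw [smul_neg, sub_neg_eq_add]
      rw [neg_smul, sub_neg_eq_add] at hk
      rw [← hk]; exact hkmem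

end Reduced

/-! ### Crossing of width pairs -/

lemma angle_eq_add_of_combination {x z : E3} {s t : ℝ} (hs : 0 ≤ s) (ht : 0 ≤ t)
    (hne : s • x + t • z ≠ 0) :
    angle x z = angle x (s • x + t • z) + angle (s • x + t • z) z := by
  apply angle_eq_angle_add_add_angle_add_of_mem_span hne
  rw [Submodule.mem_span_pair]
  exact ⟨⟨s, hs⟩, ⟨t, ht⟩, rfl⟩

/-- Two width pairs cannot be opposite sides of a convex quadrilateral, unless they coincide. -/
lemma IsWidthPair.eq_of_cross {C : Set S2} (hC : (interior C).Nonempty) {q₁ q₂ q₃ q₄ : E3}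
    (h : IsWidthPair C q₁ q₂) (h' : IsWidthPair C q₃ q₄) (hp : (inner ℝ q₁ q₂ : ℝ) < 0)
    (d234 : 0 ≤ det3 q₂ q₃ q₄) (d134 : 0 ≤ det3 q₁ q₃ q₄) (d124 : 0 ≤ det3 q₁ q₂ q₄)
    (d123 : 0 ≤ det3 q₁ q₂ q₃)
    (hpos : 0 < det3 q₂ q₃ q₄ + det3 q₁ q₃ q₄ + det3 q₁ q₂ q₄ + det3 q₁ q₂ q₃) :
    q₃ = q₂ ∧ q₄ = q₁ := by
  obtain ⟨x, hx⟩ := hC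
  have pos : ∀ k ∈ dualCone C, ‖k‖ = 1 → 0 < (inner ℝ k (x : E3) : ℝ) := fun k hk hk1 =>
    inner_pos_of_mem_interior hk (ne_zero_of_norm_one hk1) hx
  have p1 := pos _ h.left_mem h.norm_left
  have p2 := pos _ h.right_mem h.norm_right
  have p3 := pos _ h'.left_mem h'.norm_left
  have p4 := pos _ h'.right_mem h'.norm_right
  -- Through the crossing point `z`, the triangle inequality bounds the sides `q₁q₂` and `q₃q₄`
  -- together by the two diagonals. These sides already have the maximal length in the dual cone, so
  -- the diagonals are width pairs as well and `right_unique` identifies the ends.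
  have hrel := four_vector_relation q₁ q₂ q₃ q₄
  have hne : det3 q₂ q₃ q₄ • q₁ + det3 q₁ q₂ q₄ • q₃ ≠ 0 := by
    intro h0
    have e1 : (inner ℝ (det3 q₂ q₃ q₄ • q₁ + det3 q₁ q₂ q₄ • q₃) (x : E3) : ℝ) = 0 := by
      rw [h0, inner_zero_left]
    have e2 : (inner ℝ (det3 q₁ q₃ q₄ • q₂ + det3 q₁ q₂ q₃ • q₄) (x : E3) : ℝ) = 0 := by
      rw [← hrel, h0, inner_zero_left]
    rw [inner_add_left, real_inner_smul_left, real_inner_smul_left] at e1 e2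
    have f1 := mul_nonneg d234 p1.le
    have f2 := mul_nonneg d124 p3.le
    have f3 := mul_nonneg d134 p2.le
    have f4 := mul_nonneg d123 p4.le
    have g1 := (mul_eq_zero.1 (by linarith : det3 q₂ q₃ q₄ * inner ℝ q₁ (x : E3) = 0)).resolve_right
      p1.ne'
    have g2 := (mul_eq_zero.1 (by linarith : det3 q₁ q₂ q₄ * inner ℝ q₃ (x : E3) = 0)).resolve_right
      p3.ne'
    have g3 := (mul_eq_zero.1 (by linarith : det3 q₁ q₃ q₄ * inner ℝ q₂ (x : E3) = 0)).resolve_right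
      p2.ne'
    have g4 := (mul_eq_zero.1 (by linarith : det3 q₁ q₂ q₃ * inner ℝ q₄ (x : E3) = 0)).resolve_right
      p4.ne'
    linarith
  have a13 := angle_eq_add_of_combination d234 d124 hne
  have a24 := angle_eq_add_of_combination d134 d123 (by rw [← hrel]; exact hne)
  rw [← hrel] at a24
  set z := det3 q₂ q₃ q₄ • q₁ + det3 q₁ q₂ q₄ • q₃
  have t12 := angle_le_angle_add_angle q₁ z q₂
  have t34 := angle_le_angle_add_angle q₃ z q₄
  have hle : ∀ p q : E3, ‖p‖ = 1 → ‖q‖ = 1 → p ∈ dualCone C → q ∈ dualCone C →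
      angle p q ≤ Real.arccos (inner ℝ q₁ q₂) := by
    intro p q hp hq hpC hqC
    rw [angle_unit hp hq]
    exact Real.arccos_le_arccos (h.inner_le hp hq hpC hqC)
  have l13 := hle q₁ q₃ h.norm_left h'.norm_left h.left_mem h'.left_mem
  have l24 := hle q₂ q₄ h.norm_right h'.norm_right h.right_mem h'.right_mem
  have e12 := angle_unit h.norm_left h.norm_right
  have e34 := angle_unit h'.norm_left h'.norm_right
  rw [← h.inner_eq h'] at e34
  have c1 := angle_comm z q₂
  have c2 := angle_comm z q₃
  have hinj : ∀ p q : E3, ‖p‖ = 1 → ‖q‖ = 1 → angle p q = Real.arccos (inner ℝ q₁ q₂) →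
      (inner ℝ p q : ℝ) = inner ℝ q₁ q₂ := by
    intro p q hp hq he
    rw [angle_unit hp hq] at he
    have b1 := abs_le.1 (abs_inner_le_one hp hq)
    have b2 := abs_le.1 (abs_inner_le_one h.norm_left h.norm_right)
    exact Real.arccos_injOn ⟨b1.1, b1.2⟩ ⟨b2.1, b2.2⟩ he
  have i13 := hinj q₁ q₃ h.norm_left h'.norm_left (by linarith)
  have i24 := hinj q₂ q₄ h.norm_right h'.norm_right (by linarith)
  have w13 := h.of_le h.norm_left h'.norm_left h.left_mem h'.left_mem i13.le
  have w24 := h.of_le h.norm_right h'.norm_right h.right_mem h'.right_mem i24.le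
  exact ⟨w13.right_unique h (by rw [i13]; exact hp), w24.right_unique h.symm (by rw [i24]; exact hp)⟩

/-- A lune of minimal thickness cannot be rotated about its axis. -/
lemma IsWidthPair.not_rotate' {C : Set S2} {a b w w' k₁ k₂ y₁ y₂ : E3} (h : IsWidthPair C a b)
    {ω e : ℝ} (h0 : 0 < ω) (hω' : ω < Real.pi / 2) (hp : (inner ℝ a b : ℝ) = -Real.cos ω)
    (hw : a + Real.cos ω • b = Real.sin ω • w) (hw' : b + Real.cos ω • a = Real.sin ω • w')
    (hk₁ : k₁ ∈ dualCone C) (hk₂ : k₂ ∈ dualCone C)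
    (h1 : (inner ℝ k₁ w' : ℝ) = 0) (h2 : (inner ℝ k₂ w : ℝ) = 0)
    (ha1 : (inner ℝ a y₁ : ℝ) = 0) (hb2 : (inner ℝ b y₂ : ℝ) = 0)
    (hy₁ : 0 < (inner ℝ k₁ y₁ : ℝ)) (hy₂ : 0 < (inner ℝ k₂ y₂ : ℝ))
    (hd₁ : 0 < e * det3 w w' y₁) (hd₂ : e * det3 w w' y₂ < 0) : False := by
  have hs := sin_pos_of_lt h0 hω'
  have hc := cos_pos_of_lt h0 hω'
  have hsc := Real.sin_sq_add_cos_sq ω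
  have haa := inner_self_of_norm h.norm_left
  have hbb := inner_self_of_norm h.norm_right
  have hba : (inner ℝ b a : ℝ) = -Real.cos ω := by rw [real_inner_comm]; exact hp
  -- The change of basis from `a`, `b` to `w`, `w'` has determinant `(1 - cos ω ^ 2) / sin ω ^ 2 =
  -- 1`.
  have hdet : ∀ y, det3 w w' y = det3 a b y := by
    intro y
    have : Real.sin ω * (Real.sin ω * det3 w w' y) = Real.sin ω * (Real.sin ω * det3 a b y) := by
      rw [← det3_smul_mid, ← det3_smul_left, ← hw, ← hw', det3_add_left, det3_add_mid,
        det3_add_mid, det3_smul_left, det3_smul_left, det3_smul_mid, det3_smul_mid,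
        det3_self_left, det3_self_left, det3_swap b a]
      linear_combination -det3 a b y * hsc
    exact mul_left_cancel₀ hs.ne' (mul_left_cancel₀ hs.ne' this)
  rw [hdet] at hd₁ hd₂
  have he : e ≠ 0 := by rintro rfl; simp at hd₁
  set ν := e • cr a b with hν
  have hνy : ∀ y, (inner ℝ ν y : ℝ) = e * det3 a b y := fun y => by
    rw [hν, real_inner_smul_left, inner_cr]
  have hνa : (inner ℝ ν a : ℝ) = 0 := by rw [hνy, det3_self_outer, mul_zero]
  have hνb : (inner ℝ ν b : ℝ) = 0 := by rw [hνy, det3_self_right, mul_zero]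
  have haν : (inner ℝ a ν : ℝ) = 0 := by rw [real_inner_comm]; exact hνa
  have hbν : (inner ℝ b ν : ℝ) = 0 := by rw [real_inner_comm]; exact hνb
  have hν0 : ν ≠ 0 := by
    intro h0
    rw [← hνy, h0, inner_zero_left] at hd₁
    exact lt_irrefl _ hd₁
  have hνν : 0 < (inner ℝ ν ν : ℝ) := real_inner_self_pos.2 hν0
  have hsq : (inner ℝ a b : ℝ) ^ 2 < 1 := by rw [hp]; nlinarith
  -- Being orthogonal to `w'`, the vector `k₁` lies in the plane of `a` and `ν`. Since `a` vanishes
  -- at `y₁`, the sign of the `ν`-component is read off there; `k₂` and `y₂` are handled likewise.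
  have hdec1 : k₁ = (inner ℝ k₁ a : ℝ) • a + ((inner ℝ k₁ ν : ℝ) / inner ℝ ν ν) • ν := by
    rw [← sub_eq_zero]
    have z1 : (inner ℝ (k₁ - ((inner ℝ k₁ a : ℝ) • a + ((inner ℝ k₁ ν : ℝ) / inner ℝ ν ν) • ν)) a
        : ℝ) = 0 := by
      simp only [inner_sub_left, inner_add_left, real_inner_smul_left, haa, hνa]; ring
    apply eq_zero_of_orthogonal h.norm_left h.norm_right hsq z1
    · have hb : b = Real.sin ω • w' - Real.cos ω • a := by rw [← hw']; abel
      have e1 : (inner ℝ k₁ b : ℝ) = -Real.cos ω * inner ℝ k₁ a := by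
        rw [hb, inner_sub_right, real_inner_smul_right, real_inner_smul_right, h1]; ring
      simp only [inner_sub_left, inner_add_left, real_inner_smul_left, e1, hp, hνb]; ring
    · have : e * det3 a b (k₁ - ((inner ℝ k₁ a : ℝ) • a + ((inner ℝ k₁ ν : ℝ) / inner ℝ ν ν) • ν))
          = 0 := by
        rw [← hνy]
        simp only [inner_sub_right, inner_add_right, real_inner_smul_right, hνa,
          real_inner_comm k₁ ν]
        field_simp
        ring
      exact (mul_eq_zero.1 this).resolve_left he
  have hdec2 : k₂ = (inner ℝ k₂ b : ℝ) • b - (-((inner ℝ k₂ ν : ℝ) / inner ℝ ν ν)) • ν := by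
    rw [← sub_eq_zero]
    have z1 : (inner ℝ (k₂ - ((inner ℝ k₂ b : ℝ) • b -
        (-((inner ℝ k₂ ν : ℝ) / inner ℝ ν ν)) • ν)) b : ℝ) = 0 := by
      simp only [inner_sub_left, real_inner_smul_left, hbb, hνb]; ring
    refine eq_zero_of_orthogonal h.norm_left h.norm_right hsq ?_ z1 ?_
    · have ha : a = Real.sin ω • w - Real.cos ω • b := by rw [← hw]; abel
      have e1 : (inner ℝ k₂ a : ℝ) = -Real.cos ω * inner ℝ k₂ b := by
        rw [ha, inner_sub_right, real_inner_smul_right, real_inner_smul_right, h2]; ring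
      simp only [inner_sub_left, real_inner_smul_left, e1, hba, hνa]; ring
    · have : e * det3 a b (k₂ - ((inner ℝ k₂ b : ℝ) • b -
          (-((inner ℝ k₂ ν : ℝ) / inner ℝ ν ν)) • ν)) = 0 := by
        rw [← hνy]
        simp only [inner_sub_right, real_inner_smul_right, hνb, real_inner_comm k₂ ν]
        field_simp
        ring
      exact (mul_eq_zero.1 this).resolve_left he
  rw [← hνy] at hd₁ hd₂
  refine h.not_rotate (by rw [hp]; nlinarith) hν0 haν hbν
    (γ := (inner ℝ k₁ ν : ℝ) / inner ℝ ν ν) (γ' := -((inner ℝ k₂ ν : ℝ) / inner ℝ ν ν)) ?_ ?_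
    (by rw [← hdec1]; exact hk₁) (by rw [← hdec2]; exact hk₂)
  · rw [hdec1, inner_add_left, real_inner_smul_left, real_inner_smul_left, ha1, mul_zero,
      zero_add] at hy₁
    exact (pos_iff_pos_of_mul_pos hy₁).2 hd₁
  · rw [hdec2, inner_sub_left, real_inner_smul_left, real_inner_smul_left, hb2, mul_zero,
      zero_sub, ← mul_neg] at hy₂
    exact (pos_iff_pos_of_mul_pos hy₂).2 (by linarith)

/-! ### Combinatorial structure of reduced polygons -/

section Structure

variable {n : ℕ} [NeZero n] {v : Fin n → S2}

lemma vtx_congr {a b : ℤ} (h : cyc n a = cyc n b) : vtx v a = vtx v b := by rw [vtx, vtx, h]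

lemma pole_congr {a b : ℤ} (h : cyc n a = cyc n b) : pole v a = pole v b := by
  have h' : vtx v (a + 1) = vtx v (b + 1) := vtx_congr (by rw [cyc_add_one, cyc_add_one, h])
  rw [pole, pole, (vtx_congr h : vtx v a = vtx v b), h']

namespace IsConvexPolygon

lemma vtx_ne (hv : IsConvexPolygon v) {z w : ℤ} (h1 : z < w) (h2 : w < z + n) :
    vtx v z ≠ vtx v w := by
  have h3 := hv.three_le
  intro h
  by_cases hw : w = z + 1
  · have := hv.inner_pole_pos (z := z - 1) (w := w) (by omega) (by omega)
    rw [← h, inner_pole_right'] at this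
    exact lt_irrefl _ this
  · have := hv.inner_pole_pos (z := z) (w := w) (by omega) (by omega)
    rw [← h, inner_pole_left] at this
    exact lt_irrefl _ this

lemma det3_pole_nonneg (hv : IsConvexPolygon v) {p q r : ℤ} (hpq : p ≤ q) (hqr : q ≤ r)
    (hrp : r ≤ p + n) : 0 ≤ det3 (pole v p) (pole v q) (pole v r) := by
  rcases hpq.eq_or_lt with rfl | h1
  · rw [det3_self_left]
  rcases hqr.eq_or_lt with rfl | h2
  · rw [det3_self_right]
  rcases hrp.eq_or_lt with rfl | h3
  · rw [pole_period, det3_self_outer]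
  exact (hv.det3_pole_pos h1 h2 h3).le

end IsConvexPolygon

/-- A lune of minimal thickness whose semicircles are centred at the vertex `i` and at a point of
the side `j`; the hemispheres have the centres `b` and `pole v j`. -/
structure IsChord (v : Fin n → S2) (ω : ℝ) (i j : ℤ) (b : E3) : Prop where
  pair : IsWidthPair (polygon v) (pole v j) b
  vtx_eq : pole v j + Real.cos ω • b = Real.sin ω • vtx v i

namespace IsChord

variable {ω : ℝ} {i j i' j' : ℤ} {b b' : E3}

lemma congr (h : IsChord v ω i j b) (hi : cyc n i = cyc n i') (hj : cyc n j = cyc n j') :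
    IsChord v ω i' j' b :=
  ⟨by rw [← pole_congr hj]; exact h.pair,
    by rw [← pole_congr hj, ← vtx_congr hi]; exact h.vtx_eq⟩

lemma inner_pair (hv : IsConvexPolygon v) (hω : thickness (polygon v) = ω)
    (h : IsChord v ω i j b) : (inner ℝ (pole v j) b : ℝ) = -Real.cos ω := by
  rw [← hω]; exact hv.inner_widthPair h.pair

lemma inner_pole (hv : IsConvexPolygon v) (h0 : 0 < ω) (hω' : ω < Real.pi / 2)
    (hω : thickness (polygon v) = ω) (h : IsChord v ω i j b) :
    (inner ℝ (pole v j) (vtx v i) : ℝ) = Real.sin ω := by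
  have hs := sin_pos_of_lt h0 hω'
  have : Real.sin ω * (inner ℝ (pole v j) (vtx v i) : ℝ) = Real.sin ω * Real.sin ω := by
    rw [← real_inner_smul_right, ← h.vtx_eq, inner_add_right, real_inner_smul_right,
      inner_self_of_norm (hv.pole_norm j), h.inner_pair hv hω]
    linear_combination -Real.sin_sq_add_cos_sq ω
  exact mul_left_cancel₀ hs.ne' this

lemma inner_vtx (hv : IsConvexPolygon v) (h0 : 0 < ω) (hω' : ω < Real.pi / 2)
    (hω : thickness (polygon v) = ω) (h : IsChord v ω i j b) :
    (inner ℝ b (vtx v i) : ℝ) = 0 := by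
  have hs := sin_pos_of_lt h0 hω'
  have : Real.sin ω * (inner ℝ b (vtx v i) : ℝ) = 0 := by
    rw [← real_inner_smul_right, ← h.vtx_eq, inner_add_right, real_inner_smul_right,
      inner_self_of_norm h.pair.norm_right, real_inner_comm, h.inner_pair hv hω]
    ring
  exact (mul_eq_zero.1 this).resolve_left hs.ne'

lemma exists_combination (hv : IsConvexPolygon v) (h0 : 0 < ω) (hω' : ω < Real.pi / 2)
    (hω : thickness (polygon v) = ω) (h : IsChord v ω i j b) :
    ∃ α β : ℝ, 0 ≤ α ∧ 0 ≤ β ∧ b = α • pole v (i - 1) + β • pole v i ∧ 0 < α + β ∧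
      (α = 0 → b = pole v i) ∧ (β = 0 → b = pole v (i - 1)) := by
  obtain ⟨α, β, hα, hβ, he⟩ := hv.exists_eq_pole_combination h.pair.right_mem
    (h.inner_vtx hv h0 hω' hω)
  have hn := h.pair.norm_right
  refine ⟨α, β, hα, hβ, he, ?_, ?_, ?_⟩
  · refine lt_of_le_of_ne (add_nonneg hα hβ) fun h0 => ?_
    rw [he, show α = 0 by linarith, show β = 0 by linarith] at hn
    simp at hn
  · rintro rfl
    rw [zero_smul, zero_add] at he
    rw [he, norm_smul, hv.pole_norm, mul_one, Real.norm_of_nonneg hβ] at hn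
    rw [he, hn, one_smul]
  · rintro rfl
    rw [zero_smul, add_zero] at he
    rw [he, norm_smul, hv.pole_norm, mul_one, Real.norm_of_nonneg hα] at hn
    rw [he, hn, one_smul]

/-- Distinct vertices have distinct opposite sides. -/
lemma side_ne (hv : IsConvexPolygon v) (h0 : 0 < ω) (hω' : ω < Real.pi / 2)
    (hω : thickness (polygon v) = ω) (h : IsChord v ω i j b) (h' : IsChord v ω i' j b')
    (h1 : i < i') (h2 : i' < i + n) : False := by
  have hb : b = b' := h.pair.right_unique h'.pair
    (by rw [h.inner_pair hv hω]; linarith [cos_pos_of_lt h0 hω'])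
  have e := h.vtx_eq.symm.trans (hb ▸ h'.vtx_eq)
  exact hv.vtx_ne h1 h2 (smul_right_injective _ (sin_pos_of_lt h0 hω').ne' e)

/-- Nested chords do not exist. -/
lemma not_nested (hv : IsConvexPolygon v) (h0 : 0 < ω) (hω' : ω < Real.pi / 2)
    (hω : thickness (polygon v) = ω) (h : IsChord v ω i j b) (h' : IsChord v ω i' j' b')
    (h1 : i < i') (h2 : i' < j') (h3 : j' < j) (h4 : j ≤ i + n - 2) : False := by
  obtain ⟨α, β, hα, hβ, hb, hαβ, -, -⟩ := h.exists_combination hv h0 hω' hω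
  obtain ⟨α', β', hα', hβ', hb', hαβ', -, -⟩ := h'.exists_combination hv h0 hω' hω
  -- Here and below `b` is a nonnegative combination of the poles `i - 1` and `i`, and `b'` of the
  -- poles `i' - 1` and `i'`. The determinants expand into determinants of poles in cyclic order.
  have d234 : 0 ≤ det3 b b' (pole v j') := by
    rw [hb, hb']
    simp only [det3_add_left, det3_add_mid, det3_smul_left, det3_smul_mid]
    have e1 := hv.det3_pole_nonneg (p := i - 1) (q := i' - 1) (r := j') (by omega) (by omega)
      (by omega)
    have e2 := hv.det3_pole_nonneg (p := i - 1) (q := i') (r := j') (by omega) (by omega)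
      (by omega)
    have e3 := hv.det3_pole_nonneg (p := i) (q := i' - 1) (r := j') (by omega) (by omega)
      (by omega)
    have e4 := hv.det3_pole_nonneg (p := i) (q := i') (r := j') (by omega) (by omega)
      (by omega)
    positivity
  have d134 : 0 < det3 (pole v j) b' (pole v j') := by
    rw [det3_rotate, hb']
    simp only [det3_add_left, det3_smul_left]
    have e1 := hv.det3_pole_pos (p := i' - 1) (q := j') (r := j) (by omega) (by omega) (by omega)
    have e2 := hv.det3_pole_pos (p := i') (q := j') (r := j) (by omega) (by omega) (by omega)
    rcases hα'.eq_or_lt with hz | hz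
    · have : 0 < β' := by linarith
      positivity
    · positivity
  have d124 : 0 ≤ det3 (pole v j) b (pole v j') := by
    rw [det3_rotate, hb]
    simp only [det3_add_left, det3_smul_left]
    have e1 := hv.det3_pole_nonneg (p := i - 1) (q := j') (r := j) (by omega) (by omega) (by omega)
    have e2 := hv.det3_pole_nonneg (p := i) (q := j') (r := j) (by omega) (by omega) (by omega)
    positivity
  have d123 : 0 ≤ det3 (pole v j) b b' := by
    rw [det3_rotate, hb, hb']
    simp only [det3_add_left, det3_add_mid, det3_smul_left, det3_smul_mid]
    have e1 := hv.det3_pole_nonneg (p := i - 1) (q := i' - 1) (r := j) (by omega) (by omega)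
      (by omega)
    have e2 := hv.det3_pole_nonneg (p := i - 1) (q := i') (r := j) (by omega) (by omega)
      (by omega)
    have e3 := hv.det3_pole_nonneg (p := i) (q := i' - 1) (r := j) (by omega) (by omega)
      (by omega)
    have e4 := hv.det3_pole_nonneg (p := i) (q := i') (r := j) (by omega) (by omega)
      (by omega)
    positivity
  have hc := h.pair.eq_of_cross hv.isSphConvexBody.2.2 h'.pair.symm
    (by rw [h.inner_pair hv hω]; linarith [cos_pos_of_lt h0 hω']) d234 d134.le d124 d123
    (by linarith)
  have e := h.vtx_eq
  rw [← hc.1, ← hc.2, h'.vtx_eq] at e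
  exact hv.vtx_ne h1 (by omega) (smul_right_injective _ (sin_pos_of_lt h0 hω').ne' e).symm

/-- Two chords with the cyclic order vertex, side, vertex, side of their ends do not exist if the
outer ends belong to one of them. -/
lemma not_alternating (hv : IsConvexPolygon v) (h0 : 0 < ω) (hω' : ω < Real.pi / 2)
    (hω : thickness (polygon v) = ω) (h : IsChord v ω i j b) (h' : IsChord v ω i' j' b')
    (h1 : i ≤ j') (h2 : j' ≤ i' - 2) (h3 : i' ≤ j) (h4 : j ≤ i + n - 2) : False := by
  obtain ⟨α, β, hα, hβ, hb, hαβ, hα0, -⟩ := h.exists_combination hv h0 hω' hω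
  obtain ⟨α', β', hα', hβ', hb', hαβ', hα0', -⟩ := h'.exists_combination hv h0 hω' hω
  have d234 : 0 ≤ det3 b (pole v j') b' := by
    rw [hb, hb']
    simp only [det3_add_left, det3_add_right, det3_smul_left, det3_smul_right]
    have e1 := hv.det3_pole_nonneg (p := i - 1) (q := j') (r := i' - 1) (by omega) (by omega)
      (by omega)
    have e2 := hv.det3_pole_nonneg (p := i - 1) (q := j') (r := i') (by omega) (by omega)
      (by omega)
    have e3 := hv.det3_pole_nonneg (p := i) (q := j') (r := i' - 1) (by omega) (by omega)
      (by omega)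
    have e4 := hv.det3_pole_nonneg (p := i) (q := j') (r := i') (by omega) (by omega)
      (by omega)
    positivity
  have d134 : 0 ≤ det3 (pole v j) (pole v j') b' ∧
      (det3 (pole v j) (pole v j') b' = 0 → b' = pole v j) := by
    rw [det3_rotate, hb']
    simp only [det3_add_mid, det3_smul_mid]
    have e1 := hv.det3_pole_pos (p := j') (q := i' - 1) (r := j) (by omega) (by omega) (by omega)
    have e2 := hv.det3_pole_nonneg (p := j') (q := i') (r := j) (by omega) (by omega) (by omega)
    refine ⟨by positivity, fun hz => ?_⟩
    rw [← hb']
    have f1 := mul_nonneg hα' e1.le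
    have f2 := mul_nonneg hβ' e2
    have hα'0 := (mul_eq_zero.1 (by linarith : α' * det3 (pole v j') (pole v (i' - 1)) (pole v j)
      = 0)).resolve_right e1.ne'
    rcases h3.eq_or_lt with h3 | h3
    · rw [hα0' hα'0, h3]
    · exfalso
      have e3 := hv.det3_pole_pos (p := j') (q := i') (r := j) (by omega) (by omega) (by omega)
      have := (mul_eq_zero.1 (by linarith : β' * det3 (pole v j') (pole v i') (pole v j)
        = 0)).resolve_right e3.ne'
      linarith
  have d124 : 0 ≤ det3 (pole v j) b b' := by
    rw [det3_rotate, hb, hb']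
    simp only [det3_add_left, det3_add_mid, det3_smul_left, det3_smul_mid]
    have e1 := hv.det3_pole_nonneg (p := i - 1) (q := i' - 1) (r := j) (by omega) (by omega)
      (by omega)
    have e2 := hv.det3_pole_nonneg (p := i - 1) (q := i') (r := j) (by omega) (by omega)
      (by omega)
    have e3 := hv.det3_pole_nonneg (p := i) (q := i' - 1) (r := j) (by omega) (by omega)
      (by omega)
    have e4 := hv.det3_pole_nonneg (p := i) (q := i') (r := j) (by omega) (by omega)
      (by omega)
    positivity
  have d123 : 0 ≤ det3 (pole v j) b (pole v j') ∧
      (det3 (pole v j) b (pole v j') = 0 → pole v j' = b) := by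
    rw [det3_rotate, hb]
    simp only [det3_add_left, det3_smul_left]
    have e1 := hv.det3_pole_pos (p := i - 1) (q := j') (r := j) (by omega) (by omega) (by omega)
    have e2 := hv.det3_pole_nonneg (p := i) (q := j') (r := j) (by omega) (by omega) (by omega)
    refine ⟨by positivity, fun hz => ?_⟩
    rw [← hb]
    have f1 := mul_nonneg hα e1.le
    have f2 := mul_nonneg hβ e2
    have hα0' := (mul_eq_zero.1 (by linarith : α * det3 (pole v (i - 1)) (pole v j') (pole v j)
      = 0)).resolve_right e1.ne'
    rcases h1.eq_or_lt with h1 | h1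
    · rw [hα0 hα0', h1]
    · exfalso
      have e3 := hv.det3_pole_pos (p := i) (q := j') (r := j) (by omega) (by omega) (by omega)
      have := (mul_eq_zero.1 (by linarith : β * det3 (pole v i) (pole v j') (pole v j)
        = 0)).resolve_right e3.ne'
      linarith
  -- If the quadrilateral degenerates so far that all determinants vanish, the identifications come
  -- from the vanishing clauses of `d123` and `d134`.
  have hc : pole v j' = b ∧ b' = pole v j := by
    by_cases hpos : 0 < det3 b (pole v j') b' + det3 (pole v j) (pole v j') b' +
        det3 (pole v j) b b' + det3 (pole v j) b (pole v j')
    · exact h.pair.eq_of_cross hv.isSphConvexBody.2.2 h'.pair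
        (by rw [h.inner_pair hv hω]; linarith [cos_pos_of_lt h0 hω']) d234 d134.1 d124 d123.1 hpos
    · exact ⟨d123.2 (by linarith [d134.1, d123.1]), d134.2 (by linarith [d134.1, d123.1])⟩
  obtain ⟨hc1, hc2⟩ := hc
  -- Now both chords span the same lune: it is bounded by the sides `i` and `i'`, with semicircle
  -- centres at the vertices `i` and `i'`. The two sides leave these centres on opposite sides of
  -- the great circle joining them, so `not_rotate'` applies.
  have hj' : j' = i := by
    by_contra hne
    have := hv.inner_pole_pos (z := j') (w := i + n) (by omega) (by omega)
    rw [vtx_period, hc1, h.inner_vtx hv h0 hω' hω] at this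
    exact lt_irrefl _ this
  have hj : j = i' := by
    by_contra hne
    have := hv.inner_pole_pos (z := j) (w := i' + n) (by omega) (by omega)
    rw [vtx_period, ← hc2, h'.inner_vtx hv h0 hω' hω] at this
    exact lt_irrefl _ this
  subst hj' hj
  have hw' := h'.vtx_eq
  rw [hc1, hc2] at hw'
  refine h.pair.not_rotate' (e := 1) h0 hω' (h.inner_pair hv hω) h.vtx_eq hw'
    (hv.pole_mem (j - 1)) (hv.pole_mem (j' - 1)) (inner_pole_right' v j) (inner_pole_right' v j')
    (y₁ := vtx v (j + 1)) (y₂ := vtx v (j' + 1)) (inner_pole_right v j)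
    (by rw [← hc1]; exact inner_pole_right v j') ?_ ?_ ?_ ?_
  · exact hv.inner_pole_pos (by omega) (by omega)
  · exact hv.inner_pole_pos (by omega) (by omega)
  · rw [one_mul]
    exact hv.det3_vtx_pos (by omega) (by omega) (by omega)
  · rw [one_mul, det3_swap_right, neg_neg_iff_pos]
    exact hv.det3_vtx_pos (by omega) (by omega) (by omega)

/-- The mirror image of `not_alternating`. -/
lemma not_alternating' (hv : IsConvexPolygon v) (h0 : 0 < ω) (hω' : ω < Real.pi / 2)
    (hω : thickness (polygon v) = ω) (h : IsChord v ω i j b) (h' : IsChord v ω i' j' b')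
    (h1 : i + 1 ≤ j) (h2 : j + 1 ≤ i') (h3 : i' + 1 ≤ j') (h4 : j' ≤ i + n - 1) : False := by
  obtain ⟨α, β, hα, hβ, hb, hαβ, -, hβ0⟩ := h.exists_combination hv h0 hω' hω
  obtain ⟨α', β', hα', hβ', hb', hαβ', -, hβ0'⟩ := h'.exists_combination hv h0 hω' hω
  -- Adding `n` places the indices of `b` after `j'`, as the cyclic order requires.
  have hb2 : b = α • pole v (i + n - 1) + β • pole v (i + n) := by
    rw [hb, ← pole_period v (i - 1), ← pole_period v i, show i - 1 + (n : ℤ) = i + n - 1 by ring]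
  have d234 : 0 ≤ det3 (pole v j') b (pole v j) ∧
      (det3 (pole v j') b (pole v j) = 0 → b = pole v j') := by
    rw [hb2, ← pole_period v j]
    simp only [det3_add_mid, det3_smul_mid]
    have e1 := hv.det3_pole_nonneg (p := j') (q := i + n - 1) (r := j + n) (by omega) (by omega)
      (by omega)
    have e2 := hv.det3_pole_pos (p := j') (q := i + n) (r := j + n) (by omega) (by omega) (by omega)
    refine ⟨by positivity, fun hz => ?_⟩
    rw [← hb2]
    have f1 := mul_nonneg hα e1
    have f2 := mul_nonneg hβ e2.le
    have hβ00 := (mul_eq_zero.1 (by linarith : β * det3 (pole v j') (pole v (i + n))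
      (pole v (j + n)) = 0)).resolve_right e2.ne'
    rcases h4.eq_or_lt with h4 | h4
    · rw [hβ0 hβ00, h4, ← pole_period v (i - 1), show i - 1 + (n : ℤ) = i + n - 1 by ring]
    · exfalso
      have e3 := hv.det3_pole_pos (p := j') (q := i + n - 1) (r := j + n) (by omega) (by omega)
        (by omega)
      have := (mul_eq_zero.1 (by linarith : α * det3 (pole v j') (pole v (i + n - 1))
        (pole v (j + n)) = 0)).resolve_right e3.ne'
      linarith
  have d134 : 0 ≤ det3 b' b (pole v j) := by
    rw [hb2, hb', ← pole_period v j]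
    simp only [det3_add_left, det3_add_mid, det3_smul_left, det3_smul_mid]
    have e1 := hv.det3_pole_nonneg (p := i' - 1) (q := i + n - 1) (r := j + n) (by omega) (by omega)
      (by omega)
    have e2 := hv.det3_pole_nonneg (p := i' - 1) (q := i + n) (r := j + n) (by omega) (by omega)
      (by omega)
    have e3 := hv.det3_pole_nonneg (p := i') (q := i + n - 1) (r := j + n) (by omega) (by omega)
      (by omega)
    have e4 := hv.det3_pole_nonneg (p := i') (q := i + n) (r := j + n) (by omega) (by omega)
      (by omega)
    positivity
  have d124 : 0 ≤ det3 b' (pole v j') (pole v j) ∧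
      (det3 b' (pole v j') (pole v j) = 0 → pole v j = b') := by
    rw [hb', ← pole_period v j]
    simp only [det3_add_left, det3_smul_left]
    have e1 := hv.det3_pole_nonneg (p := i' - 1) (q := j') (r := j + n) (by omega) (by omega)
      (by omega)
    have e2 := hv.det3_pole_pos (p := i') (q := j') (r := j + n) (by omega) (by omega) (by omega)
    refine ⟨by positivity, fun hz => ?_⟩
    rw [← hb', pole_period]
    have f1 := mul_nonneg hα' e1
    have f2 := mul_nonneg hβ' e2.le
    have hβ00 := (mul_eq_zero.1 (by linarith : β' * det3 (pole v i') (pole v j')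
      (pole v (j + n)) = 0)).resolve_right e2.ne'
    rcases h2.eq_or_lt with h2 | h2
    · rw [hβ0' hβ00, ← h2, add_sub_cancel_right]
    · exfalso
      have e3 := hv.det3_pole_pos (p := i' - 1) (q := j') (r := j + n) (by omega) (by omega)
        (by omega)
      have := (mul_eq_zero.1 (by linarith : α' * det3 (pole v (i' - 1)) (pole v j')
        (pole v (j + n)) = 0)).resolve_right e3.ne'
      linarith
  have d123 : 0 ≤ det3 b' (pole v j') b := by
    rw [hb2, hb']
    simp only [det3_add_left, det3_add_right, det3_smul_left, det3_smul_right]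
    have e1 := hv.det3_pole_nonneg (p := i' - 1) (q := j') (r := i + n - 1) (by omega) (by omega)
      (by omega)
    have e2 := hv.det3_pole_nonneg (p := i' - 1) (q := j') (r := i + n) (by omega) (by omega)
      (by omega)
    have e3 := hv.det3_pole_nonneg (p := i') (q := j') (r := i + n - 1) (by omega) (by omega)
      (by omega)
    have e4 := hv.det3_pole_nonneg (p := i') (q := j') (r := i + n) (by omega) (by omega)
      (by omega)
    positivity
  have hc : b = pole v j' ∧ pole v j = b' := by
    by_cases hpos : 0 < det3 (pole v j') b (pole v j) + det3 b' b (pole v j) +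
        det3 b' (pole v j') (pole v j) + det3 b' (pole v j') b
    · exact h'.pair.symm.eq_of_cross hv.isSphConvexBody.2.2 h.pair.symm
        (by rw [real_inner_comm, h'.inner_pair hv hω]; linarith [cos_pos_of_lt h0 hω'])
        d234.1 d134 d124.1 d123 hpos
    · exact ⟨d234.2 (by linarith [d234.1, d124.1]), d124.2 (by linarith [d234.1, d124.1])⟩
  obtain ⟨hc1, hc2⟩ := hc
  have hj' : j' = i + n - 1 := by
    by_contra hne
    have := hv.inner_pole_pos (z := j') (w := i + n) (by omega) (by omega)
    rw [vtx_period, ← hc1, h.inner_vtx hv h0 hω' hω] at this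
    exact lt_irrefl _ this
  have hj : i' = j + 1 := by
    by_contra hne
    have := hv.inner_pole_pos (z := j) (w := i') (by omega) (by omega)
    rw [hc2, h'.inner_vtx hv h0 hω' hω] at this
    exact lt_irrefl _ this
  subst hj' hj
  have hw' := h'.vtx_eq
  rw [← hc1, ← hc2] at hw'
  refine h.pair.not_rotate' (e := -1) h0 hω' (h.inner_pair hv hω) h.vtx_eq hw'
    (hv.pole_mem (j + 1)) (hv.pole_mem i) (inner_pole_left v (j + 1)) (inner_pole_left v i)
    (y₁ := vtx v j) (y₂ := vtx v (i + n - 1)) (inner_pole_left v j)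
    (by rw [hc1]; exact inner_pole_left v _) ?_ ?_ ?_ ?_
  · rw [← vtx_period]
    exact hv.inner_pole_pos (by omega) (by omega)
  · exact hv.inner_pole_pos (by omega) (by omega)
  · have := hv.det3_vtx_pos (p := i) (q := j) (r := j + 1) (by omega) (by omega) (by omega)
    rw [det3_swap_right] at this
    linarith
  · have := hv.det3_vtx_pos (p := i) (q := j + 1) (r := i + n - 1) (by omega) (by omega) (by omega)
    linarith

end IsChord

/-- The vertex has positive distance from the opposite side, which therefore is neither of the two
sides meeting at it; this gives the bounds on the offset `k`. -/
lemma exists_isChord (hv : IsConvexPolygon v) (hr : IsReducedBody (polygon v)) {ω : ℝ}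
    (h0 : 0 < ω) (hω' : ω < Real.pi / 2) (hω : thickness (polygon v) = ω) (i : ℤ) :
    ∃ k : ℤ, ∃ b, 1 ≤ k ∧ k ≤ n - 2 ∧ IsChord v ω i (i + k) b := by
  obtain ⟨a, b, hab, he⟩ := exists_widthPair_center hv hr h0 hω' hω (cyc n i)
  obtain ⟨j, rfl⟩ := hab.exists_eq_pole hv h0 hω' hω (i := i) he
  have hch : IsChord v ω i j b := ⟨hab, he⟩
  obtain ⟨z, h1, h2, h3⟩ := exists_cyc_eq (cyc n j) i
  have hch' : IsChord v ω i z b := hch.congr rfl h3.symm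
  have hin := hch'.inner_pole hv h0 hω' hω
  have hs := sin_pos_of_lt h0 hω'
  refine ⟨z - i, b, ?_, ?_, by rwa [add_sub_cancel]⟩
  · by_contra hlt
    have : z = i := by omega
    rw [this, inner_pole_left] at hin
    linarith
  · by_contra hlt
    have : z = i - 1 + n := by omega
    rw [this, pole_period, inner_pole_right'] at hin
    linarith

/-- A reduced polygon of thickness less than `π / 2` has an odd number of vertices, and each vertex
lies at distance `ω` from the opposite side. -/
theorem exists_opposite_chords (hv : IsConvexPolygon v) (hr : IsReducedBody (polygon v)) {ω : ℝ}
    (h0 : 0 < ω) (hω' : ω < Real.pi / 2) (hω : thickness (polygon v) = ω) :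
    ∃ m : ℕ, n = 2 * m + 1 ∧ ∀ i : ℤ, ∃ b, IsChord v ω i (i + m) b := by
  choose K B hK1 hK2 hch using fun l : Fin n => exists_isChord hv hr h0 hω' hω ((l : ℕ) : ℤ)
  have hchord : ∀ z : ℤ, IsChord v ω z (z + K (cyc n z)) (B (cyc n z)) := by
    intro z
    refine (hch (cyc n z)).congr (cyc_coe _) ?_
    rw [cyc_eq_iff, Int.add_emod, coe_cyc, Int.emod_emod_of_dvd _ (dvd_refl _), ← Int.add_emod]
  -- If the offset dropped, the chords at `z` and `z + 1` would be nested or share a side.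
  have hmono : ∀ z : ℤ, K (cyc n z) ≤ K (cyc n (z + 1)) := by
    intro z
    by_contra hlt
    push Not at hlt
    have k1 := hK1 (cyc n (z + 1))
    have k2 := hK2 (cyc n z)
    have c1 := hchord z
    have c2 := hchord (z + 1)
    have h3 := hv.three_le
    rcases (show z + 1 + K (cyc n (z + 1)) ≤ z + K (cyc n z) by omega).eq_or_lt with h | h
    · rw [h] at c2
      exact c1.side_ne hv h0 hω' hω c2 (by omega) (by omega)
    · exact c1.not_nested hv h0 hω' hω c2 (by omega) (by omega) h (by omega)
  have hmono' : Monotone fun z : ℤ => K (cyc n z) := monotone_int_of_le_succ hmono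
  have hper : ∀ z : ℤ, ∀ d : ℕ, cyc n (z + d * n) = cyc n z := by
    intro z d
    rw [cyc_eq_iff]; simp
  have hn : (0 : ℤ) < n := by exact_mod_cast Nat.pos_of_ne_zero (NeZero.ne n)
  -- A monotone periodic function is constant.
  have hconst : ∀ z w : ℤ, K (cyc n z) ≤ K (cyc n w) := by
    intro z w
    rw [← hper w (z - w).toNat]
    apply hmono'
    have := Int.self_le_toNat (z - w)
    nlinarith [Int.natCast_nonneg (z - w).toNat]
  have heq : ∀ z : ℤ, K (cyc n z) = K (cyc n 0) := fun z => le_antisymm (hconst _ _) (hconst _ _)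
  set k := K (cyc n 0) with hk
  have k1 : 1 ≤ k := hK1 _
  have k2 : k ≤ n - 2 := hK2 _
  have hchk : ∀ z : ℤ, IsChord v ω z (z + k) (B (cyc n z)) := fun z => by
    have := hchord z
    rwa [heq] at this
  -- If `2 * k ≥ n`, the chords from `0` to `k` and from `k` to `2 * k - n` form a forbidden
  -- pattern. If `2 * k < n - 1`, those from `0` to `k` and from `k + 1` to `2 * k + 1` form its
  -- mirror image.
  have u1 : 2 * k ≤ n - 1 := by
    by_contra hlt
    have c1 := hchk 0
    have c2 := (hchk k).congr (j' := 2 * k - n) rfl (by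
      rw [← cyc_add_card (2 * k - (n : ℤ))]; congr 1; ring)
    exact c1.not_alternating hv h0 hω' hω c2 (by omega) (by omega) (by omega) (by omega)
  have u2 : (n : ℤ) - 1 ≤ 2 * k := by
    by_contra hlt
    exact (hchk 0).not_alternating' hv h0 hω' hω (hchk (k + 1)) (by omega) (by omega) (by omega)
      (by omega)
  refine ⟨k.toNat, by omega, fun i => ⟨B (cyc n i), ?_⟩⟩
  rw [Int.toNat_of_nonneg (by omega)]
  exact hchk i

end Structure

/-! ### Side lengths of a polygon with opposite chords -/

/-- The angle between the directions at two opposite feet, in terms of the half side `x`. -/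
def pairAngle (k x : ℝ) : ℝ :=
  Real.arccos (Real.cos x * (Real.cos x - k) / (1 - Real.cos x * k))

/-- The vectors `b` and `c` lie in the plane orthogonal to the unit vector `a`, where the
determinant is the signed area. The signs are settled separately by the position of the foot. -/
lemma sq_det3_eq {a b c : E3} (ha : ‖a‖ = 1) (hb : ‖b‖ = 1) (hc : ‖c‖ = 1)
    (hab : (inner ℝ a b : ℝ) = 0) (hac : (inner ℝ a c : ℝ) = 0) :
    det3 a b c ^ 2 = Real.sin (angle b c) ^ 2 := by
  have g := gram_expansion a b c c (inner_self_of_norm ha) (inner_self_of_norm hb)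
  rw [hab, inner_self_of_norm hc, real_inner_comm, hac, real_inner_comm] at g
  rw [Real.sin_sq, cos_angle, hb, hc]
  linarith

lemma sin_nonneg_of_angle (a b : E3) : 0 ≤ Real.sin (angle a b) :=
  Real.sin_nonneg_of_nonneg_of_le_pi (angle_nonneg _ _) (angle_le_pi _ _)

lemma det3_pole_vtx_nonneg {n : ℕ} [NeZero n] (v : Fin n → S2) (j : ℤ) :
    0 ≤ det3 (pole v j) (vtx v j) (vtx v (j + 1)) := by
  rw [det3_rotate, ← inner_cr, pole, real_inner_smul_right]
  exact mul_nonneg (inv_nonneg.2 (norm_nonneg _)) real_inner_self_nonneg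

section Metric

variable {n : ℕ} [NeZero n] {v : Fin n → S2} {ω : ℝ} {m : ℕ}

/-- The foot of the perpendicular from the vertex `i` to the opposite side. -/
def foot (v : Fin n → S2) (ω : ℝ) (m : ℕ) (i : ℤ) : E3 :=
  (Real.cos ω)⁻¹ • (vtx v i - Real.sin ω • pole v (i + m))

/-- The unit tangent vector at the foot `foot v ω m i` along the side opposite to the
vertex `i`. -/
def footDir (v : Fin n → S2) (ω : ℝ) (m : ℕ) (i : ℤ) : E3 := cr (pole v (i + m)) (foot v ω m i)

lemma foot_period (v : Fin n → S2) (ω : ℝ) (m : ℕ) (i : ℤ) : foot v ω m (i + n) = foot v ω m i := by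
  rw [foot, vtx_period, add_right_comm, pole_period]; rfl

lemma footDir_period (v : Fin n → S2) (ω : ℝ) (m : ℕ) (i : ℤ) :
    footDir v ω m (i + n) = footDir v ω m i := by
  rw [footDir, foot_period, add_right_comm, pole_period]; rfl

/-- The polygon has thickness `ω`, an odd number of vertices, and each vertex is at distance `ω`
from the opposite side. -/
structure HasOppositeChords (v : Fin n → S2) (ω : ℝ) (m : ℕ) : Prop where
  isConvex : IsConvexPolygon v
  pos : 0 < ω
  lt : ω < Real.pi / 2
  thickness_eq : thickness (polygon v) = ω
  card : n = 2 * m + 1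
  chord : ∀ i : ℤ, ∃ b, IsChord v ω i (i + m) b

namespace HasOppositeChords

lemma inner_pole (h : HasOppositeChords v ω m) (i : ℤ) :
    (inner ℝ (pole v (i + m)) (vtx v i) : ℝ) = Real.sin ω := by
  obtain ⟨b, hb⟩ := h.chord i
  exact hb.inner_pole h.isConvex h.pos h.lt h.thickness_eq

lemma cos_pos (h : HasOppositeChords v ω m) : 0 < Real.cos ω := cos_pos_of_lt h.pos h.lt

lemma vtx_eq (h : HasOppositeChords v ω m) (i : ℤ) :
    vtx v i = Real.cos ω • foot v ω m i + Real.sin ω • pole v (i + m) := by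
  rw [foot, smul_smul, mul_inv_cancel₀ h.cos_pos.ne', one_smul, sub_add_cancel]

lemma inner_pole_foot (h : HasOppositeChords v ω m) (i : ℤ) :
    (inner ℝ (pole v (i + m)) (foot v ω m i) : ℝ) = 0 := by
  rw [foot, real_inner_smul_right, inner_sub_right, real_inner_smul_right, h.inner_pole,
    inner_self_of_norm (h.isConvex.pole_norm _)]
  ring

lemma inner_foot_self (h : HasOppositeChords v ω m) (i : ℤ) :
    (inner ℝ (foot v ω m i) (foot v ω m i) : ℝ) = 1 := by
  have e1 : (inner ℝ (vtx v i) (foot v ω m i) : ℝ) = Real.cos ω := by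
    rw [foot, real_inner_smul_right, inner_sub_right, real_inner_smul_right,
      inner_self_of_norm (vtx_norm v i), real_inner_comm, h.inner_pole]
    have := h.cos_pos
    field_simp
    linarith [Real.sin_sq_add_cos_sq ω]
  have e2 := h.inner_pole_foot i
  have : Real.cos ω * (inner ℝ (foot v ω m i) (foot v ω m i) : ℝ) = Real.cos ω * 1 := by
    rw [h.vtx_eq i, inner_add_left, real_inner_smul_left, real_inner_smul_left, e2] at e1
    linarith
  exact mul_left_cancel₀ h.cos_pos.ne' this

lemma norm_foot (h : HasOppositeChords v ω m) (i : ℤ) : ‖foot v ω m i‖ = 1 :=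
  norm_of_inner_self (h.inner_foot_self i)

lemma norm_footDir (h : HasOppositeChords v ω m) (i : ℤ) : ‖footDir v ω m i‖ = 1 := by
  apply norm_of_inner_self
  rw [footDir, inner_cr_cr, inner_self_of_norm (h.isConvex.pole_norm _), h.inner_foot_self,
    h.inner_pole_foot]
  ring

/-- The foot is the centre of the second semicircle of a minimal lune, so it belongs to the polygon
by `IsWidthPair.exists_center` and hence to the side. -/
lemma exists_foot_eq (h : HasOppositeChords v ω m) (i : ℤ) :
    ∃ α β : ℝ, 0 ≤ α ∧ 0 ≤ β ∧
      foot v ω m i = α • vtx v (i + m) + β • vtx v (i + m + 1) := by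
  obtain ⟨b, hb⟩ := h.chord i
  have hs := sin_pos_of_lt h.pos h.lt
  have hp := hb.inner_pair h.isConvex h.thickness_eq
  have hp' : (inner ℝ b (pole v (i + m)) : ℝ) = -Real.cos ω := by rw [real_inner_comm]; exact hp
  obtain ⟨x, hx, he⟩ := hb.pair.symm.exists_center h.isConvex.isSphConvexBody
    (by rw [hp']; linarith [h.cos_pos])
  rw [hp', sqrt_one_sub_cos_sq h.pos h.lt] at he
  have hxf : (x : E3) = foot v ω m i := by
    have hc := h.cos_pos.ne'
    have hb' : b = (Real.cos ω)⁻¹ • (Real.sin ω • vtx v i - pole v (i + m)) := by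
      rw [← hb.vtx_eq, add_sub_cancel_left, smul_smul, inv_mul_cancel₀ hc, one_smul]
    apply smul_right_injective _ hs.ne'
    change Real.sin ω • (x : E3) = Real.sin ω • foot v ω m i
    rw [← he, hb', foot]
    have hsc := Real.sin_sq_add_cos_sq ω
    apply E3.ext <;>
    · simp only [PiLp.sub_apply, PiLp.smul_apply, smul_eq_mul]
      field_simp
      linear_combination (pole v (i + m)) _ * hsc
  rw [← hxf]
  exact h.isConvex.exists_eq_vtx_combination hx (by rw [hxf]; exact h.inner_pole_foot i)

/-- The part of the side opposite to the vertex `i` that lies after the foot of the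
perpendicular. -/
def halfSide (v : Fin n → S2) (ω : ℝ) (m : ℕ) (i : ℤ) : ℝ :=
  angle (foot v ω m i) (vtx v (i + m + 1))

lemma cos_halfSide (h : HasOppositeChords v ω m) (i : ℤ) :
    Real.cos (halfSide v ω m i) = inner ℝ (foot v ω m i) (vtx v (i + m + 1)) := by
  rw [halfSide, cos_angle, h.norm_foot, vtx_norm]; simp

lemma inner_footDir_after (h : HasOppositeChords v ω m) (i : ℤ) :
    (inner ℝ (footDir v ω m i) (vtx v (i + m + 1)) : ℝ) = Real.sin (halfSide v ω m i) := by
  have hsq := sq_det3_eq (h.isConvex.pole_norm (i + m)) (h.norm_foot i) (vtx_norm v (i + m + 1))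
    (h.inner_pole_foot i) (inner_pole_right v (i + m))
  have hnn : 0 ≤ det3 (pole v (i + m)) (foot v ω m i) (vtx v (i + m + 1)) := by
    obtain ⟨α, β, hα, -, he⟩ := h.exists_foot_eq i
    rw [he, det3_add_mid, det3_smul_mid, det3_smul_mid, det3_self_right, mul_zero, add_zero]
    exact mul_nonneg hα (det3_pole_vtx_nonneg v _)
  rw [footDir, inner_cr]
  exact (sq_eq_sq₀ hnn (sin_nonneg_of_angle _ _)).1 hsq

lemma index_add (h : HasOppositeChords v ω m) (i : ℤ) : i + m + 1 + m = i + n := by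
  have := h.card; push_cast [this]; ring

lemma pole_opposite (h : HasOppositeChords v ω m) (i : ℤ) : pole v (i + m + 1 + m) = pole v i := by
  rw [h.index_add, pole_period]

lemma inner_vtx_vtx (h : HasOppositeChords v ω m) (i : ℤ) :
    (inner ℝ (vtx v i) (vtx v (i + m + 1)) : ℝ) = Real.cos ω * Real.cos (halfSide v ω m i) := by
  rw [h.vtx_eq i, inner_add_left, real_inner_smul_left, real_inner_smul_left, inner_pole_right,
    h.cos_halfSide]
  ring

/-- The triangles vertex `i`, its foot, vertex `i + m + 1` and vertex `i + m + 1`, its foot, vertex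
`i` are right-angled with the same hypotenuse and a leg `ω` each. By the spherical Pythagorean
theorem (`inner_vtx_vtx`) their remaining legs agree. -/
lemma inner_foot_before (h : HasOppositeChords v ω m) (i : ℤ) :
    (inner ℝ (foot v ω m (i + m + 1)) (vtx v i) : ℝ) = Real.cos (halfSide v ω m i) := by
  have h1 := h.inner_vtx_vtx i
  rw [h.vtx_eq (i + m + 1), inner_add_right, real_inner_smul_right, real_inner_smul_right,
    h.pole_opposite, real_inner_comm (pole v i), inner_pole_left, real_inner_comm, mul_zero,
    add_zero] at h1
  exact mul_left_cancel₀ h.cos_pos.ne' h1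

lemma angle_foot_before (h : HasOppositeChords v ω m) (i : ℤ) :
    angle (vtx v i) (foot v ω m (i + m + 1)) = halfSide v ω m i := by
  rw [angle_comm, angle_unit (h.norm_foot _) (vtx_norm v i), h.inner_foot_before]
  exact Real.arccos_cos (angle_nonneg _ _) (angle_le_pi _ _)

lemma inner_footDir_before (h : HasOppositeChords v ω m) (i : ℤ) :
    (inner ℝ (footDir v ω m (i + m + 1)) (vtx v i) : ℝ) = -Real.sin (halfSide v ω m i) := by
  have hsq := sq_det3_eq (h.isConvex.pole_norm _) (h.norm_foot (i + m + 1)) (vtx_norm v i)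
    (h.inner_pole_foot (i + m + 1)) (by rw [h.pole_opposite, inner_pole_left])
  rw [angle_comm, h.angle_foot_before] at hsq
  have hnn : det3 (pole v (i + m + 1 + m)) (foot v ω m (i + m + 1)) (vtx v i) ≤ 0 := by
    obtain ⟨α, β, -, hβ, he⟩ := h.exists_foot_eq (i + m + 1)
    rw [h.index_add, vtx_period, add_right_comm i (n : ℤ) 1, vtx_period] at he
    rw [he, h.pole_opposite, det3_add_mid, det3_smul_mid, det3_smul_mid, det3_self_right, mul_zero,
      zero_add, det3_swap_right, mul_neg]
    exact neg_nonpos.2 (mul_nonneg hβ (det3_pole_vtx_nonneg v _))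
  rw [footDir, inner_cr]
  have := (sq_eq_sq₀ (neg_nonneg.2 hnn) (sin_nonneg_of_angle _ _)).1 ((neg_sq _).trans hsq)
  rw [halfSide, ← this, neg_neg]

lemma inner_footDir_vtx (h : HasOppositeChords v ω m) (i : ℤ) :
    (inner ℝ (footDir v ω m i) (vtx v i) : ℝ) = 0 := by
  rw [h.vtx_eq i, footDir, inner_add_right, real_inner_smul_right, real_inner_smul_right,
    inner_cr_left, inner_cr_right]
  ring

/-- Both directions are expanded in the frame of the vertices `i` and `i + m + 1`, the ends of the
common hypotenuse. All coefficients depend only on `ω` and the common leg. -/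
lemma angle_footDir (h : HasOppositeChords v ω m) (i : ℤ) :
    angle (footDir v ω m i) (-footDir v ω m (i + m + 1)) =
      pairAngle (Real.cos ω) (halfSide v ω m i) := by
  have hω := Real.sin_sq_add_cos_sq ω
  have hx := Real.sin_sq_add_cos_sq (halfSide v ω m i)
  have hk := h.cos_pos
  have hs := sin_pos_of_lt h.pos h.lt
  have h1 := h.inner_pole i
  have h1' := h.inner_pole (i + m + 1)
  rw [h.pole_opposite] at h1'
  have g := gram_expansion (vtx v i) (vtx v (i + m + 1)) (footDir v ω m i)
    (footDir v ω m (i + m + 1)) (inner_self_of_norm (vtx_norm v _))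
    (inner_self_of_norm (vtx_norm v _))
  have d1 : det3 (vtx v i) (vtx v (i + m + 1)) (footDir v ω m i) =
      Real.sin ω * Real.cos (halfSide v ω m i) := by
    rw [← inner_cr, footDir, inner_cr_cr, real_inner_comm (pole v (i + m)) (vtx v i), h1,
      real_inner_comm (foot v ω m i) (vtx v (i + m + 1)), ← h.cos_halfSide,
      real_inner_comm (pole v (i + m)) (vtx v (i + m + 1)), inner_pole_right]
    ring
  have d2 : det3 (vtx v i) (vtx v (i + m + 1)) (footDir v ω m (i + m + 1)) =
      -(Real.sin ω * Real.cos (halfSide v ω m i)) := by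
    rw [← inner_cr, footDir, inner_cr_cr, h.pole_opposite, real_inner_comm (pole v i) (vtx v i),
      inner_pole_left, real_inner_comm (foot v ω m (i + m + 1)) (vtx v i), h.inner_foot_before,
      real_inner_comm (pole v i) (vtx v (i + m + 1)), h1']
    ring
  rw [d1, d2, h.inner_footDir_vtx, h.inner_footDir_vtx, h.inner_footDir_after,
    h.inner_footDir_before, h.inner_vtx_vtx] at g
  rw [angle_unit (h.norm_footDir _) (by rw [norm_neg]; exact h.norm_footDir _), pairAngle,
    inner_neg_right]
  congr 1
  set c := Real.cos (halfSide v ω m i)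
  set k := Real.cos ω
  have hc1 : |c| ≤ 1 := Real.abs_cos_le_one _
  have hk1 : k < 1 := by nlinarith
  have hck : |c * k| < 1 := by
    rw [abs_mul, abs_of_pos hk]
    nlinarith [abs_nonneg c]
  have hck' := abs_lt.1 hck
  rw [eq_div_iff (by linarith)]
  -- The Gram factor `1 - (c * k) ^ 2` is the denominator `1 - c * k` times `1 + c * k`, which is
  -- cancelled.
  have hpos : 1 + c * k ≠ 0 := by linarith
  apply mul_right_cancel₀ hpos
  linear_combination -g + c ^ 2 * hω - (k * c) * hx

lemma sideLength_eq (h : HasOppositeChords v ω m) (i : ℤ) :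
    angle (vtx v (i + m)) (vtx v (i + m + 1)) =
      halfSide v ω m (i + m) + halfSide v ω m i := by
  obtain ⟨α, β, hα, hβ, he⟩ := h.exists_foot_eq i
  have hne : α • vtx v (i + m) + β • vtx v (i + m + 1) ≠ 0 := by
    rw [← he]; exact ne_zero_of_norm_one (h.norm_foot i)
  rw [angle_eq_add_of_combination hα hβ hne, ← he, ← h.angle_foot_before (i + m),
    show i + m + m + 1 = i + m + 1 + m by ring, h.index_add, foot_period, halfSide]

lemma halfSide_cyc (v : Fin n → S2) (ω : ℝ) (m : ℕ) (i : ℤ) :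
    halfSide v ω m ((cyc n i : Fin n) : ℕ) = halfSide v ω m i := by
  have h2 : cyc n ((cyc n i : Fin n) : ℕ) = cyc n i := cyc_coe _
  have h3 : ∀ d : ℕ, cyc n (((cyc n i : Fin n) : ℕ) + (d : ℤ)) = cyc n (i + d) := by
    intro d
    induction d with
    | zero => simpa using h2
    | succ d ih => push_cast; rw [← add_assoc, cyc_add_one, ih, ← add_assoc, cyc_add_one]
  have h4 := h3 m
  have h5 : cyc n (((cyc n i : Fin n) : ℕ) + (m : ℤ) + 1) = cyc n (i + m + 1) := by
    rw [cyc_add_one, h4, cyc_add_one]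
  rw [halfSide, halfSide, foot, foot, (vtx_congr h2 : vtx v _ = vtx v _),
    (vtx_congr h5 : vtx v _ = vtx v _), (pole_congr h4 : pole v _ = pole v _)]

lemma sum_halfSide_shift (v : Fin n → S2) (ω : ℝ) (m : ℕ) (d : ℤ) :
    ∑ j : Fin n, halfSide v ω m ((j : ℕ) + d) = ∑ j : Fin n, halfSide v ω m (j : ℕ) := by
  have hinj : Function.Injective fun j : Fin n => cyc n ((j : ℕ) + d) := by
    intro a b hab
    by_contra hne
    have hne' : (a : ℕ) ≠ b := fun h => hne (Fin.ext h)
    have ha := a.2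
    have hb := b.2
    rcases lt_or_gt_of_ne hne' with hlt | hlt
    · exact cyc_ne (by omega) (by omega) hab
    · exact cyc_ne (by omega) (by omega) hab.symm
  rw [← Function.Bijective.sum_comp (Finite.injective_iff_bijective.1 hinj)
    fun j : Fin n => halfSide v ω m (j : ℕ)]
  exact Finset.sum_congr rfl fun j _ => (halfSide_cyc v ω m _).symm

/-- Each half side occurs twice: once after the foot of vertex `i` and once before the foot of
vertex `i + m + 1`. -/
lemma perim_eq (h : HasOppositeChords v ω m) :
    perim v = 2 * ∑ j : Fin n, halfSide v ω m (j : ℕ) := by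
  have hside : ∀ j : Fin n, sideLength v j =
      halfSide v ω m (j : ℕ) + halfSide v ω m ((j : ℕ) + (-m : ℤ)) := by
    intro j
    have := h.sideLength_eq ((j : ℕ) + (-m : ℤ))
    rw [neg_add_cancel_right] at this
    rw [← this, sideLength, sphDist, vtx, vtx, cyc_add_one, cyc_coe]
  rw [perim, Finset.sum_congr rfl fun j _ => hside j, Finset.sum_add_distrib, sum_halfSide_shift]
  ring

/-- The total turning of the tangent directions at the feet is at least `π`. -/
lemma pi_le_sum_pairAngle (h : HasOppositeChords v ω m) :
    Real.pi ≤ ∑ j : Fin n, pairAngle (Real.cos ω) (halfSide v ω m (j : ℕ)) := by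
  set β : ℕ → ℝ := fun j => pairAngle (Real.cos ω) (halfSide v ω m j) with hβ
  -- Passing over `-footDir (j + m + 1)`, two chords lead from the direction at foot `j` to that at
  -- foot `j + 1`.
  have hstep : ∀ j : ℕ, angle (footDir v ω m j) (footDir v ω m (j + 1 : ℕ)) ≤
      β j + β (m + 1 + j) := by
    intro j
    have h1 := angle_le_angle_add_angle (footDir v ω m j) (-footDir v ω m (j + m + 1))
      (footDir v ω m (j + 1 : ℕ))
    have h2 := h.angle_footDir (j + m + 1)
    rw [show (j : ℤ) + m + 1 + m + 1 = (j + 1 : ℕ) + n by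
      have := h.index_add j; push_cast; linarith, footDir_period, ← angle_neg_neg, neg_neg] at h2
    rw [h.angle_footDir, h2] at h1
    refine h1.trans (le_of_eq ?_)
    simp only [hβ]
    congr 3
    push_cast; ring
  have hchain : ∀ j : ℕ, angle (footDir v ω m 0) (footDir v ω m j) ≤
      ∑ l ∈ Finset.range j, (β l + β (m + 1 + l)) := by
    intro j
    induction j with
    | zero =>
      simp [angle_self (ne_zero_of_norm_one (h.norm_footDir 0))]
    | succ j ih =>
      rw [Finset.sum_range_succ]
      exact (angle_le_angle_add_angle _ (footDir v ω m j) _).trans (add_le_add ih (hstep j))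
  -- After `m` double steps one further chord reaches the reversed initial direction, so each chord
  -- is used exactly once.
  have hm : angle (footDir v ω m m) (-footDir v ω m 0) = β m := by
    have := h.angle_footDir m
    rwa [show (m : ℤ) + m + 1 = 0 + n by have := h.index_add 0; linarith, footDir_period] at this
  have hpi := angle_le_angle_add_angle (footDir v ω m 0) (footDir v ω m m) (-footDir v ω m 0)
  rw [angle_self_neg_of_nonzero (ne_zero_of_norm_one (h.norm_footDir 0)), hm] at hpi
  have hsum : ∑ j : Fin n, pairAngle (Real.cos ω) (halfSide v ω m (j : ℕ)) =
      ∑ l ∈ Finset.range m, (β l + β (m + 1 + l)) + β m := by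
    rw [Fin.sum_univ_eq_sum_range β n, h.card, show 2 * m + 1 = m + 1 + m by ring,
      Finset.sum_range_add, Finset.sum_range_succ, Finset.sum_add_distrib]
    ring
  rw [hsum]
  linarith [hchain m]

end HasOppositeChords

end Metric

/-! ### Concavity -/

section Concavity

variable {k : ℝ}

lemma one_sub_mul_pos {c : ℝ} (hk : 0 < k) (hk1 : k < 1) (hc : c ≤ 1) : 0 < 1 - c * k := by
  nlinarith

lemma one_add_sq_sub_pos (hk : 0 < k) (hk1 : k < 1) (c : ℝ) : 0 < 1 + c ^ 2 - 2 * c * k := by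
  nlinarith [sq_nonneg (c - k)]

/-- The factor `sin x` of the inner derivative cancels against the root from `arccos`. What remains
is a function of `cos x` alone, so concavity reduces to monotonicity in one variable. -/
lemma hasDerivAt_pairAngle (hk : 0 < k) (hk1 : k < 1) {x : ℝ} (hx : x ∈ Set.Ioo 0 Real.pi) :
    HasDerivAt (pairAngle k) ((2 * Real.cos x - k - Real.cos x ^ 2 * k) /
      ((1 - Real.cos x * k) * √(1 + Real.cos x ^ 2 - 2 * Real.cos x * k))) x := by
  have hs : 0 < Real.sin x := Real.sin_pos_of_pos_of_lt_pi hx.1 hx.2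
  have hsc := Real.sin_sq_add_cos_sq x
  have h1 := one_sub_mul_pos hk hk1 (Real.cos_le_one x)
  have h2 := one_add_sq_sub_pos hk hk1 (Real.cos x)
  have hd : HasDerivAt (fun x => Real.cos x * (Real.cos x - k) / (1 - Real.cos x * k))
      (-Real.sin x * (2 * Real.cos x - k - Real.cos x ^ 2 * k) / (1 - Real.cos x * k) ^ 2) x := by
    have hc := Real.hasDerivAt_cos x
    refine ((hc.mul (hc.sub_const k)).div ((hc.mul_const k).const_sub 1) h1.ne').congr_deriv ?_
    simp only [Pi.mul_apply]
    congr 1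
    ring
  have e1 : 1 - Real.cos x * (Real.cos x - k) / (1 - Real.cos x * k) =
      Real.sin x ^ 2 / (1 - Real.cos x * k) := by
    field_simp
    linear_combination -hsc
  have e2 : 1 + Real.cos x * (Real.cos x - k) / (1 - Real.cos x * k) =
      (1 + Real.cos x ^ 2 - 2 * Real.cos x * k) / (1 - Real.cos x * k) := by
    field_simp
    ring
  have p1 : 0 < 1 - Real.cos x * (Real.cos x - k) / (1 - Real.cos x * k) := by
    rw [e1]; positivity
  have p2 : 0 < 1 + Real.cos x * (Real.cos x - k) / (1 - Real.cos x * k) := by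
    rw [e2]; positivity
  have hroot : √(1 - (Real.cos x * (Real.cos x - k) / (1 - Real.cos x * k)) ^ 2) =
      Real.sin x * √(1 + Real.cos x ^ 2 - 2 * Real.cos x * k) / (1 - Real.cos x * k) := by
    have : 1 - (Real.cos x * (Real.cos x - k) / (1 - Real.cos x * k)) ^ 2 =
        (Real.sin x / (1 - Real.cos x * k)) ^ 2 * (1 + Real.cos x ^ 2 - 2 * Real.cos x * k) := by
      rw [show ∀ y : ℝ, 1 - y ^ 2 = (1 - y) * (1 + y) by intro y; ring, e1, e2]
      field_simp
    rw [this, Real.sqrt_mul (sq_nonneg _), Real.sqrt_sq (by positivity)]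
    ring
  have := (Real.hasDerivAt_arccos (by linarith) (by linarith)).comp x hd
  refine this.congr_deriv ?_
  rw [hroot]
  have hr : 0 < √(1 + Real.cos x ^ 2 - 2 * Real.cos x * k) := Real.sqrt_pos.2 h2
  field_simp

lemma monotoneOn_pairAngle_deriv (hk : 0 < k) (hk1 : k < 1) :
    MonotoneOn (fun c => (2 * c - k - c ^ 2 * k) / ((1 - c * k) * √(1 + c ^ 2 - 2 * c * k)))
      (Set.Icc (-1) 1) := by
  have hd : ∀ c ∈ Set.Icc (-1 : ℝ) 1, HasDerivAt
      (fun c => (2 * c - k - c ^ 2 * k) / ((1 - c * k) * √(1 + c ^ 2 - 2 * c * k)))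
      ((1 - k ^ 2) * (2 - 3 * c * k + c ^ 3 * k) /
        ((1 - c * k) ^ 2 * √(1 + c ^ 2 - 2 * c * k) ^ 3)) c := by
    intro c hc
    have h1 := one_sub_mul_pos hk hk1 hc.2
    have h2 := one_add_sq_sub_pos hk hk1 c
    have hr := Real.sqrt_pos.2 h2
    have hrr := Real.sq_sqrt h2.le
    have hid := hasDerivAt_id' c
    have d1 : HasDerivAt (fun c : ℝ => 2 * c - k - c ^ 2 * k) (2 - 2 * c * k) c := by
      refine (((hid.const_mul 2).sub_const k).sub ((hid.pow 2).mul_const k)).congr_deriv ?_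
      norm_num
    have d2 : HasDerivAt (fun c : ℝ => 1 - c * k) (-k) c := by
      refine ((hid.mul_const k).const_sub 1).congr_deriv ?_
      norm_num
    have d3 : HasDerivAt (fun c : ℝ => 1 + c ^ 2 - 2 * c * k) (2 * c - 2 * k) c := by
      refine (((hid.pow 2).const_add 1).sub ((hid.const_mul 2).mul_const k)).congr_deriv ?_
      norm_num
    refine (d1.div (d2.mul (d3.sqrt h2.ne')) (mul_pos h1 hr).ne').congr_deriv ?_
    simp only [Pi.mul_apply]
    set r := √(1 + c ^ 2 - 2 * c * k)
    field_simp
    rw [hrr]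
    ring
  refine monotoneOn_of_deriv_nonneg (convex_Icc _ _)
    (fun c hc => (hd c hc).continuousAt.continuousWithinAt)
    (fun c hc => (hd c (interior_subset hc)).differentiableAt.differentiableWithinAt) ?_
  intro c hc
  have hc' := interior_subset hc
  rw [(hd c hc').deriv]
  have h1 := one_sub_mul_pos hk hk1 hc'.2
  -- The numerator equals `2 * (1 - k) + k * (1 - c) ^ 2 * (2 + c)`.
  have hnum : 0 ≤ 2 - 3 * c * k + c ^ 3 * k := by
    have h3 : 0 ≤ (1 - c) ^ 2 * (2 + c) * k :=
      mul_nonneg (mul_nonneg (sq_nonneg _) (by linarith [hc'.1])) hk.le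
    nlinarith
  have hk2 : 0 ≤ 1 - k ^ 2 := by nlinarith
  positivity

lemma concaveOn_pairAngle (hk : 0 < k) (hk1 : k < 1) :
    ConcaveOn ℝ (Set.Icc 0 Real.pi) (pairAngle k) := by
  refine AntitoneOn.concaveOn_of_deriv (convex_Icc _ _) ?_ ?_ ?_
  · apply Continuous.continuousOn
    unfold pairAngle
    refine Real.continuous_arccos.comp (Continuous.div (by fun_prop) (by fun_prop) fun x => ?_)
    exact (one_sub_mul_pos hk hk1 (Real.cos_le_one x)).ne'
  · rw [interior_Icc]
    exact fun x hx => (hasDerivAt_pairAngle hk hk1 hx).differentiableAt.differentiableWithinAt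
  · rw [interior_Icc]
    intro x hx y hy hxy
    rw [(hasDerivAt_pairAngle hk hk1 hx).deriv, (hasDerivAt_pairAngle hk hk1 hy).deriv]
    exact monotoneOn_pairAngle_deriv hk hk1 ⟨Real.neg_one_le_cos _, Real.cos_le_one _⟩
      ⟨Real.neg_one_le_cos _, Real.cos_le_one _⟩
      (Real.cos_le_cos_of_nonneg_of_le_pi hx.1.le hy.2.le hxy)

lemma cos_pairAngle (hk : 0 < k) (hk1 : k < 1) (x : ℝ) :
    Real.cos (pairAngle k x) = Real.cos x * (Real.cos x - k) / (1 - Real.cos x * k) := by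
  have h1 := one_sub_mul_pos hk hk1 (Real.cos_le_one x)
  have h2 := one_add_sq_sub_pos hk hk1 (Real.cos x)
  apply Real.cos_arccos
  · rw [le_div_iff₀ h1]; nlinarith
  · rw [div_le_one h1]; nlinarith [Real.sin_sq_add_cos_sq x, sq_nonneg (Real.sin x)]

/-- Jensen's inequality for `pairAngle`. -/
lemma card_mul_le_sum (hk : 0 < k) (hk1 : k < 1) {n : ℕ} (hn : 3 ≤ n) {x : Fin n → ℝ}
    (hx : ∀ i, x i ∈ Set.Icc 0 Real.pi) (hsum : Real.pi ≤ ∑ i, pairAngle k (x i)) {y : ℝ}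
    (hy0 : 0 < y) (hy : y < Real.pi / 2)
    (hyn : Real.cos y * (Real.cos y - k) / (1 - Real.cos y * k) = Real.cos (Real.pi / n)) :
    n * y ≤ ∑ i, x i := by
  have hn0 : (0 : ℝ) < n := by exact_mod_cast (by omega : 0 < n)
  have hn3 : (3 : ℝ) ≤ n := by exact_mod_cast hn
  have hpi := Real.pi_pos
  have hsw : ∑ _i : Fin n, (n : ℝ)⁻¹ = 1 := by
    simp [hn0.ne']
  have hJ := (concaveOn_pairAngle hk hk1).le_map_sum (t := Finset.univ)
    (w := fun _ => (n : ℝ)⁻¹) (p := x) (fun _ _ => by positivity) hsw (fun i _ => hx i)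
  have hmem := (convex_Icc (0 : ℝ) Real.pi).sum_mem (t := Finset.univ)
    (w := fun _ => (n : ℝ)⁻¹) (z := x) (fun _ _ => by positivity) hsw (fun i _ => hx i)
  simp only [smul_eq_mul, ← Finset.mul_sum] at hJ hmem
  set a := (n : ℝ)⁻¹ * ∑ i, x i with ha
  have hle : Real.pi / n ≤ pairAngle k a := by
    refine le_trans ?_ hJ
    rw [div_eq_inv_mul]
    exact mul_le_mul_of_nonneg_left hsum (by positivity)
  have hcos := Real.cos_le_cos_of_nonneg_of_le_pi (by positivity) (Real.arccos_le_pi _) hle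
  change Real.cos (pairAngle k a) ≤ _ at hcos
  rw [cos_pairAngle hk hk1, ← hyn] at hcos
  have hya : y ≤ a := by
    by_contra hlt
    push Not at hlt
    have hc0 : 0 < Real.cos y := Real.cos_pos_of_mem_Ioo ⟨by linarith, hy⟩
    have hcc : Real.cos y < Real.cos a :=
      Real.cos_lt_cos_of_nonneg_of_le_pi hmem.1 (by linarith) hlt
    have hn' : 0 < Real.cos (Real.pi / n) := by
      apply Real.cos_pos_of_mem_Ioo
      have h4 : 0 < Real.pi / n := by positivity
      refine ⟨by linarith, ?_⟩
      exact div_lt_div_of_pos_left hpi (by norm_num) (by linarith)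
    have q1 := one_sub_mul_pos hk hk1 (Real.cos_le_one y)
    have q2 := one_sub_mul_pos hk hk1 (Real.cos_le_one a)
    rw [← hyn] at hn'
    -- Since the value at `cos y` is positive, `cos y > k`; from there on `c * (c - k) / (1 - c *
    -- k)` is strictly increasing in `c`, which contradicts `hcos` if `a < y`.
    have hck : 0 < Real.cos y - k := by
      by_contra hneg
      push Not at hneg
      exact absurd hn' (not_lt.2 (div_nonpos_of_nonpos_of_nonneg
        (mul_nonpos_of_nonneg_of_nonpos hc0.le hneg) q1.le))
    rw [div_le_div_iff₀ q2 q1] at hcos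
    have h5 : 0 < Real.cos a * (1 - Real.cos y * k) := mul_pos (by linarith) q1
    have h6 : 0 < (Real.cos a - Real.cos y) *
        (Real.cos y - k + Real.cos a * (1 - Real.cos y * k)) :=
      mul_pos (by linarith) (by linarith)
    nlinarith
  calc n * y ≤ n * a := mul_le_mul_of_nonneg_left hya hn0.le
    _ = ∑ i, x i := by rw [ha, ← mul_assoc, mul_inv_cancel₀ hn0.ne', one_mul]

end Concavity

/-- Lower bound for the perimeter of a polygon with opposite chords. -/
theorem HasOppositeChords.le_perim {n : ℕ} [NeZero n] {v : Fin n → S2} {ω : ℝ} {m : ℕ}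
    (h : HasOppositeChords v ω m) {y : ℝ} (hy0 : 0 < y) (hy : y < Real.pi / 2)
    (hyn : Real.cos y * (Real.cos y - Real.cos ω) / (1 - Real.cos y * Real.cos ω) =
      Real.cos (Real.pi / n)) :
    2 * (n * y) ≤ perim v := by
  have hk1 : Real.cos ω < 1 := by
    have := sin_pos_of_lt h.pos h.lt
    nlinarith [Real.sin_sq_add_cos_sq ω, h.cos_pos]
  rw [h.perim_eq]
  exact mul_le_mul_of_nonneg_left (card_mul_le_sum h.cos_pos hk1 h.isConvex.three_le
    (fun i => ⟨angle_nonneg _ _, angle_le_pi _ _⟩) h.pi_le_sum_pairAngle hy0 hy hyn) (by norm_num)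

/-! ### Regular polygons are inscribed in circles -/

/-- The point with angular coordinate `φ` on the unit circle spanned by `e₁` and `e₂`. -/
def rad (e₁ e₂ : E3) (φ : ℝ) : E3 := Real.cos φ • e₁ + Real.sin φ • e₂

/-- `e₁`, `e₂` are orthonormal. -/
structure IsFrame (e₁ e₂ : E3) : Prop where
  inner_left : (inner ℝ e₁ e₁ : ℝ) = 1
  inner_right : (inner ℝ e₂ e₂ : ℝ) = 1
  inner_eq : (inner ℝ e₁ e₂ : ℝ) = 0

namespace IsFrame

variable {e₁ e₂ : E3}

lemma inner_rad (hf : IsFrame e₁ e₂) (φ ψ : ℝ) : (inner ℝ (rad e₁ e₂ φ) (rad e₁ e₂ ψ) : ℝ) = Real.cos (φ - ψ) := by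
  simp only [rad, inner_add_left, inner_add_right, real_inner_smul_left, real_inner_smul_right,
    hf.inner_left, hf.inner_right, hf.inner_eq, real_inner_comm e₁ e₂, Real.cos_sub]
  ring

lemma inner_cr_self (hf : IsFrame e₁ e₂) : (inner ℝ (cr e₁ e₂) (cr e₁ e₂) : ℝ) = 1 := by
  rw [inner_cr_cr, hf.inner_left, hf.inner_right, hf.inner_eq]; ring

lemma inner_cr_rad (φ : ℝ) : (inner ℝ (cr e₁ e₂) (rad e₁ e₂ φ) : ℝ) = 0 := by
  rw [rad, inner_add_right, real_inner_smul_right, real_inner_smul_right, inner_cr_left,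
    inner_cr_right]; ring

lemma inner_point (hf : IsFrame e₁ e₂) (a b c d φ ψ : ℝ) :
    (inner ℝ (a • cr e₁ e₂ + b • rad e₁ e₂ φ) (c • cr e₁ e₂ + d • rad e₁ e₂ ψ) : ℝ) =
      a * c + b * d * Real.cos (φ - ψ) := by
  simp only [inner_add_left, inner_add_right, real_inner_smul_left, real_inner_smul_right,
    hf.inner_cr_self, inner_cr_rad, hf.inner_rad, real_inner_comm (cr e₁ e₂) (rad e₁ e₂ φ)]
  ring

/-- With `2 * x = β - α` and `2 * y = γ - β`, this rests on `sin (2 * x) + sin (2 * y) - sin (2 * (x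
+ y)) = 4 * sin x * sin y * sin (x + y)`. The product form shows the orientation of points on a
circle. -/
lemma det3_point (hf : IsFrame e₁ e₂) (h ρ α β γ : ℝ) :
    det3 (h • cr e₁ e₂ + ρ • rad e₁ e₂ α) (h • cr e₁ e₂ + ρ • rad e₁ e₂ β)
      (h • cr e₁ e₂ + ρ • rad e₁ e₂ γ) =
      4 * h * ρ ^ 2 * (Real.sin ((β - α) / 2) * Real.sin ((γ - β) / 2) *
        Real.sin ((γ - α) / 2)) := by
  have d1 : det3 e₁ e₂ (cr e₁ e₂) = 1 := by rw [← inner_cr, hf.inner_cr_self]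
  have d2 : det3 e₂ (cr e₁ e₂) e₁ = 1 := by rw [← det3_rotate, d1]
  have d3 : det3 (cr e₁ e₂) e₁ e₂ = 1 := by rw [det3_rotate, d1]
  have d4 : det3 e₂ e₁ (cr e₁ e₂) = -1 := by rw [det3_swap, d1]
  have d5 : det3 (cr e₁ e₂) e₂ e₁ = -1 := by rw [det3_swap, d2]
  have d6 : det3 e₁ (cr e₁ e₂) e₂ = -1 := by rw [det3_swap, d3]
  simp only [rad, det3_add_left, det3_add_mid, det3_add_right, det3_smul_left, det3_smul_mid,
    det3_smul_right, det3_self_left, det3_self_right, det3_self_outer, d1, d2, d3, d4, d5, d6]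
  set x := (β - α) / 2 with hx
  set y := (γ - β) / 2 with hy
  have e1 := Real.sin_two_mul x
  have e2 := Real.sin_two_mul y
  have e3 := Real.sin_two_mul (x + y)
  have f1 := Real.sin_sq_add_cos_sq x
  have f2 := Real.sin_sq_add_cos_sq y
  have e4 : (γ - α) / 2 = x + y := by rw [hx, hy]; ring
  rw [show 2 * x = β - α by rw [hx]; ring, Real.sin_sub] at e1
  rw [show 2 * y = γ - β by rw [hy]; ring, Real.sin_sub] at e2
  rw [show 2 * (x + y) = γ - α by rw [hx, hy]; ring, Real.sin_sub, Real.sin_add, Real.cos_add] at e3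
  rw [e4, Real.sin_add]
  linear_combination h * ρ ^ 2 * (e1 + e2 - e3 - 2 * Real.sin x * Real.cos x * f2 -
    2 * Real.sin y * Real.cos y * f1)

end IsFrame

/-- The vertices of `v` are equally spaced on a circle with centre `cr e₁ e₂`. -/
structure IsInscribed {n : ℕ} [NeZero n] (v : Fin n → S2) (e₁ e₂ : E3) (h ρ : ℝ) : Prop where
  frame : IsFrame e₁ e₂
  height_pos : 0 < h
  radius_pos : 0 < ρ
  sq_add_sq : h ^ 2 + ρ ^ 2 = 1
  vtx_eq : ∀ j : ℤ, vtx v j = h • cr e₁ e₂ + ρ • rad e₁ e₂ (j * (2 * Real.pi / n))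

lemma eq_rad_of_recurrence {f : ℤ → E3} {θ : ℝ} {e₁ e₂ : E3}
    (hf : ∀ j, f (j + 2) = (2 * Real.cos θ) • f (j + 1) - f j) (h0 : f 0 = rad e₁ e₂ 0)
    (h1 : f 1 = rad e₁ e₂ θ) (j : ℤ) : f j = rad e₁ e₂ (j * θ) := by
  have hr : ∀ j : ℤ, rad e₁ e₂ ((j + 2 : ℤ) * θ) =
      (2 * Real.cos θ) • rad e₁ e₂ ((j + 1 : ℤ) * θ) - rad e₁ e₂ (j * θ) := by
    intro j
    have e1 : ((j + 2 : ℤ) : ℝ) * θ = (j + 1 : ℤ) * θ + θ := by push_cast; ring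
    have e2 : (j : ℝ) * θ = (j + 1 : ℤ) * θ - θ := by push_cast; ring
    rw [e1, e2]
    simp only [rad, Real.cos_add, Real.sin_add, Real.cos_sub, Real.sin_sub]
    module
  have key : ∀ j : ℤ, f j = rad e₁ e₂ (j * θ) ∧ f (j + 1) = rad e₁ e₂ ((j + 1 : ℤ) * θ) := by
    intro j
    induction j using Int.induction_on with
    | zero => simpa using ⟨h0, h1⟩
    | succ j ih =>
      refine ⟨ih.2, ?_⟩
      rw [show (j : ℤ) + 1 + 1 = j + 2 by ring, hf, hr, ih.1, ih.2]
    | pred j ih =>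
      have h2 := hf (-j - 1)
      have h3 := hr (-j - 1)
      rw [show -(j : ℤ) - 1 + 2 = -j + 1 by ring, sub_add_cancel] at h2 h3
      refine ⟨?_, by rw [sub_add_cancel]; exact ih.1⟩
      rw [ih.1, ih.2, h3] at h2
      exact (sub_right_injective h2).symm
  exact (key j).1

lemma exists_isFrame_of_recurrence {d : ℤ → E3} {r θ : ℝ} (hr : 0 < r) (hθ : 0 < Real.sin θ)
    (hdd : ∀ j, (inner ℝ (d j) (d j) : ℝ) = r ^ 2)
    (hdd' : (inner ℝ (d 0) (d 1) : ℝ) = Real.cos θ * r ^ 2)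
    (hrec : ∀ j, d (j + 2) = (2 * Real.cos θ) • d (j + 1) - d j) :
    ∃ p q : E3, IsFrame p q ∧ ∀ j : ℤ, d j = r • rad p q (j * θ) := by
  have hsc := Real.sin_sq_add_cos_sq θ
  refine ⟨r⁻¹ • d 0, (Real.sin θ)⁻¹ • r⁻¹ • (d 1 - Real.cos θ • d 0), ⟨?_, ?_, ?_⟩, fun j => ?_⟩
  · simp only [real_inner_smul_left, real_inner_smul_right, hdd]
    field_simp
  · simp only [real_inner_smul_left, real_inner_smul_right, inner_sub_left, inner_sub_right,
      hdd, hdd', real_inner_comm (d 0) (d 1)]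
    field_simp
    linarith
  · simp only [real_inner_smul_left, real_inner_smul_right, inner_sub_right, hdd, hdd']
    ring
  · have := eq_rad_of_recurrence (f := fun j => r⁻¹ • d j) (θ := θ) (e₁ := r⁻¹ • d 0)
      (e₂ := (Real.sin θ)⁻¹ • r⁻¹ • (d 1 - Real.cos θ • d 0)) (fun j => by
        simp only [hrec]; module) (by simp [rad]) (by
        simp only [rad, smul_smul, smul_sub]
        rw [mul_inv_cancel_left₀ hθ.ne', show Real.sin θ * ((Real.sin θ)⁻¹ * (r⁻¹ * Real.cos θ)) =
          Real.cos θ * r⁻¹ by field_simp]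
        module) j
    rw [← this, smul_smul, mul_inv_cancel₀ hr.ne', one_smul]

/-- A chord of the unit circle points in the direction of its midpoint advanced by `π / 2`. Turning
the frame back by `θ / 2 + π / 2` thus converts edge directions into positions on a circle. -/
lemma IsFrame.exists_rotate {p q : E3} (hpq : IsFrame p q) (θ : ℝ) :
    ∃ e₁ e₂ : E3, IsFrame e₁ e₂ ∧
      (∀ φ, rad e₁ e₂ (φ + θ) - rad e₁ e₂ φ = (2 * Real.sin (θ / 2)) • rad p q φ) ∧
      ∀ c : E3, (inner ℝ c p : ℝ) = 0 → (inner ℝ c q : ℝ) = 0 →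
        (inner ℝ c e₁ : ℝ) = 0 ∧ (inner ℝ c e₂ : ℝ) = 0 := by
  have hsc := Real.sin_sq_add_cos_sq (θ / 2)
  have hs : Real.sin θ = 2 * Real.sin (θ / 2) * Real.cos (θ / 2) := by
    rw [← Real.sin_two_mul]; congr 1; ring
  have hc : Real.cos θ = Real.cos (θ / 2) ^ 2 - Real.sin (θ / 2) ^ 2 := by
    rw [← Real.cos_two_mul']; congr 1; ring
  refine ⟨(-Real.sin (θ / 2)) • p - Real.cos (θ / 2) • q,
    Real.cos (θ / 2) • p - Real.sin (θ / 2) • q, ⟨?_, ?_, ?_⟩, fun φ => ?_, fun c h1 h2 => ?_⟩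
  · simp only [inner_sub_left, inner_sub_right, real_inner_smul_left, real_inner_smul_right,
      hpq.inner_left, hpq.inner_right, hpq.inner_eq, real_inner_comm p q]
    linarith
  · simp only [inner_sub_left, inner_sub_right, real_inner_smul_left, real_inner_smul_right,
      hpq.inner_left, hpq.inner_right, hpq.inner_eq, real_inner_comm p q]
    linarith
  · simp only [inner_sub_left, inner_sub_right, real_inner_smul_left, real_inner_smul_right,
      hpq.inner_left, hpq.inner_right, hpq.inner_eq, real_inner_comm p q]
    ring
  · simp only [rad, Real.cos_add, Real.sin_add, hs, hc]
    generalize Real.sin (θ / 2) = s at *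
    generalize Real.cos (θ / 2) = k at *
    have hk : k ^ 2 = 1 - s ^ 2 := by linarith
    rw [hk]
    have e1 : 2 * s * Real.cos φ = -s * (Real.cos φ * (1 - s ^ 2 - s ^ 2) -
        Real.sin φ * (2 * s * k)) + k * (Real.sin φ * (1 - s ^ 2 - s ^ 2) +
        Real.cos φ * (2 * s * k)) + s * Real.cos φ - k * Real.sin φ := by
      linear_combination (-2 * s * Real.cos φ) * hk
    have e2 : 2 * s * Real.sin φ = -k * (Real.cos φ * (1 - s ^ 2 - s ^ 2) -
        Real.sin φ * (2 * s * k)) - s * (Real.sin φ * (1 - s ^ 2 - s ^ 2) +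
        Real.cos φ * (2 * s * k)) + k * Real.cos φ + s * Real.sin φ := by
      linear_combination (-2 * s * Real.sin φ) * hk
    rw [smul_add, smul_smul, smul_smul, e1, e2]
    module
  · simp only [inner_sub_right, real_inner_smul_right, h1, h2]
    simp

/-- By induction the sines stay positive, so `j * θ / 2 < π` for `j < n`. Hence `n * θ`, a multiple
of `2 * π`, cannot reach `4 * π`: the polygon winds round its centre exactly once. -/
lemma eq_two_pi_div_of_sin_mul_pos {n : ℕ} (hn : 3 ≤ n) {θ : ℝ} (h0 : 0 < θ) (hpi : θ < Real.pi)
    (hper : Real.cos (n * θ) = 1)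
    (hsin : ∀ j : ℕ, 2 ≤ j → j < n →
      0 < Real.sin ((j - 1) * θ / 2) * Real.sin (j * θ / 2)) : θ = 2 * Real.pi / n := by
  have hlt : ∀ j : ℕ, 1 ≤ j → j < n → j * θ / 2 < Real.pi := by
    intro j h1
    induction j, h1 using Nat.le_induction with
    | base => intro _; push_cast; linarith
    | succ j hj ih =>
      intro hjn
      have ih := ih (by omega)
      have hs := hsin (j + 1) (by omega) hjn
      push_cast at hs ⊢
      rw [add_sub_cancel_right] at hs
      have hj0 : (1 : ℝ) ≤ j := by exact_mod_cast hj
      have hp : 0 < Real.sin (j * θ / 2) := Real.sin_pos_of_pos_of_lt_pi (by positivity) ih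
      have hp' := (pos_iff_pos_of_mul_pos hs).1 hp
      by_contra hge
      push Not at hge
      have h2 := Real.sin_nonneg_of_nonneg_of_le_pi (x := (j + 1) * θ / 2 - Real.pi) (by linarith)
        (by nlinarith)
      rw [Real.sin_sub_pi] at h2
      linarith
  have hn1 := hlt (n - 1) (by omega) (by omega)
  rw [Nat.cast_sub (by omega), Nat.cast_one] at hn1
  have hn0 : (0 : ℝ) < n := by exact_mod_cast (by omega : 0 < n)
  obtain ⟨K, hK⟩ := (Real.cos_eq_one_iff _).1 hper
  have hpi0 := Real.pi_pos
  have hK0 : 0 < K := by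
    have : (0 : ℝ) < K := by
      by_contra hneg
      push Not at hneg
      have : (K : ℝ) * (2 * Real.pi) ≤ 0 := mul_nonpos_of_nonpos_of_nonneg hneg (by positivity)
      have : 0 < n * θ := by positivity
      linarith
    exact_mod_cast this
  have hK2 : K < 2 := by
    have : (K : ℝ) < 2 := by
      by_contra hneg
      push Not at hneg
      nlinarith
    exact_mod_cast this
  have : K = 1 := by omega
  rw [this, Int.cast_one, one_mul] at hK
  rw [eq_div_iff hn0.ne']
  linarith

section Regular

variable {n : ℕ} [NeZero n] {v : Fin n → S2}

/-- By the spherical law of cosines, equal sides and equal angles give equal short diagonals. -/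
lemma IsRegularPolygon.exists_inner_eq (hv : IsRegularPolygon v) :
    ∃ s g : ℝ, s ^ 2 < 1 ∧ (∀ j : ℤ, (inner ℝ (vtx v j) (vtx v (j + 1)) : ℝ) = s) ∧
      ∀ j : ℤ, (inner ℝ (vtx v j) (vtx v (j + 2)) : ℝ) = g := by
  obtain ⟨hc, hs, ha⟩ := hv
  have h1 : ∀ j : ℤ, (inner ℝ (vtx v j) (vtx v (j + 1)) : ℝ) = Real.cos (sideLength v 0) := by
    intro j
    rw [hs 0 (cyc n j), sideLength, cos_sphDist, vtx, vtx, cyc_add_one]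
  set s := Real.cos (sideLength v 0)
  have hself : ∀ j : ℤ, (inner ℝ (vtx v j) (vtx v j) : ℝ) = 1 :=
    fun j => inner_self_of_norm (vtx_norm v j)
  have hs1 : s ^ 2 < 1 := by
    have := real_inner_self_pos.2 (hc.cr_ne_zero 0)
    rw [inner_cr_cr, hself, hself, real_inner_comm (vtx v 0) (vtx v (0 + 1)), h1] at this
    nlinarith
  refine ⟨s, s ^ 2 + Real.cos (interiorAngle v 0) * (1 - s ^ 2), hs1, h1, fun j => ?_⟩
  have h3 : interiorAngle v 0 = angle (vtx v j - s • vtx v (j + 1))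
      (vtx v (j + 2) - s • vtx v (j + 1)) := by
    rw [ha 0 (cyc n (j + 1)), interiorAngle, sphAngle, tangentTo, tangentTo, ← cyc_sub_one,
      ← cyc_add_one, add_sub_cancel_right, add_assoc, one_add_one_eq_two]
    have e1 := h1 j
    have e2 := h1 (j + 1)
    rw [add_assoc, one_add_one_eq_two] at e2
    rw [real_inner_comm] at e1
    simp only [vtx] at e1 e2 ⊢
    rw [e1, e2]
  have n1 : ‖vtx v j - s • vtx v (j + 1)‖ ^ 2 = 1 - s ^ 2 := by
    rw [← h1 j]; exact norm_sq_sub_smul (vtx_norm v _) (vtx_norm v _)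
  have n2 : ‖vtx v (j + 2) - s • vtx v (j + 1)‖ ^ 2 = 1 - s ^ 2 := by
    have := h1 (j + 1)
    rw [add_assoc, one_add_one_eq_two, real_inner_comm] at this
    rw [← this]; exact norm_sq_sub_smul (vtx_norm v _) (vtx_norm v _)
  have n3 : ‖vtx v j - s • vtx v (j + 1)‖ = ‖vtx v (j + 2) - s • vtx v (j + 1)‖ :=
    (sq_eq_sq₀ (norm_nonneg _) (norm_nonneg _)).1 (n1.trans n2.symm)
  have hin := cos_angle_mul_norm_mul_norm (vtx v j - s • vtx v (j + 1))
    (vtx v (j + 2) - s • vtx v (j + 1))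
  rw [← h3, n3, ← pow_two, n2] at hin
  have e2 := h1 (j + 1)
  rw [add_assoc, one_add_one_eq_two] at e2
  simp only [inner_sub_left, inner_sub_right, real_inner_smul_left, real_inner_smul_right, h1,
    hself, e2] at hin
  linarith

/-- Vertices `j` and `j + 3` are mirror images in the plane bisecting the edge between `j + 1` and
`j + 2`: their products with its ends are exchanged, and their determinants have equal squares and,
by convexity, equal signs. So their difference is parallel to that edge. -/
lemma IsConvexPolygon.vtx_add_three (hv : IsConvexPolygon v) {s g : ℝ} (hs1 : s ^ 2 < 1)
    (hs : ∀ j : ℤ, (inner ℝ (vtx v j) (vtx v (j + 1)) : ℝ) = s)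
    (hg : ∀ j : ℤ, (inner ℝ (vtx v j) (vtx v (j + 2)) : ℝ) = g) (j : ℤ) :
    vtx v (j + 3) = vtx v j + ((s - g) / (1 - s)) • (vtx v (j + 2) - vtx v (j + 1)) := by
  have h3 := hv.three_le
  have h1s : 1 - s ≠ 0 := by intro h; have : s = 1 := by linarith
                             rw [this] at hs1; norm_num at hs1
  have p1 : 0 < det3 (vtx v (j + 1)) (vtx v (j + 2)) (vtx v j) := by
    rw [← det3_rotate]; exact hv.det3_vtx_pos (by omega) (by omega) (by omega)
  have p2 : 0 < det3 (vtx v (j + 1)) (vtx v (j + 2)) (vtx v (j + 3)) :=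
    hv.det3_vtx_pos (by omega) (by omega) (by omega)
  have hself : ∀ j : ℤ, (inner ℝ (vtx v j) (vtx v j) : ℝ) = 1 :=
    fun j => inner_self_of_norm (vtx_norm v j)
  have i1 := hs j
  have i2 := hs (j + 1)
  have i3 := hs (j + 2)
  have j1 := hg j
  have j2 := hg (j + 1)
  rw [show j + 1 + 1 = j + 2 by ring] at i2
  rw [show j + 2 + 1 = j + 3 by ring] at i3
  rw [show j + 1 + 2 = j + 3 by ring] at j2
  have na := hself j
  have nb := hself (j + 1)
  have nc := hself (j + 2)
  have nd := hself (j + 3)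
  have ma := vtx_norm v (j + 1)
  have mb := vtx_norm v (j + 2)
  generalize vtx v j = a at *
  generalize vtx v (j + 1) = b at *
  generalize vtx v (j + 2) = c at *
  generalize vtx v (j + 3) = d at *
  have i1' : (inner ℝ b a : ℝ) = s := by rw [real_inner_comm]; exact i1
  have j1' : (inner ℝ c a : ℝ) = g := by rw [real_inner_comm]; exact j1
  have i2' : (inner ℝ c b : ℝ) = s := by rw [real_inner_comm]; exact i2
  have i3' : (inner ℝ d c : ℝ) = s := by rw [real_inner_comm]; exact i3
  have j2' : (inner ℝ d b : ℝ) = g := by rw [real_inner_comm]; exact j2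
  have ga := gram_expansion b c a a nb nc
  have gd := gram_expansion b c d d nb nc
  rw [na, i1, j1, i2] at ga
  rw [nd, i3', j2', i2] at gd
  have hdet : det3 b c d = det3 b c a :=
    (sq_eq_sq₀ p2.le p1.le).1 (by rw [pow_two, pow_two]; linarith)
  rw [← sub_eq_zero]
  apply eq_zero_of_orthogonal ma mb (by rw [i2]; exact hs1)
  · simp only [inner_sub_left, inner_add_left, real_inner_smul_left, j2', i1, i2', nb]
    field_simp
    ring
  · simp only [inner_sub_left, inner_add_left, real_inner_smul_left, i3', j1, i2, nc]
    field_simp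
    ring
  · rw [← inner_cr]
    simp only [inner_sub_right, inner_add_right, real_inner_smul_right, inner_cr, hdet,
      det3_self_outer, det3_self_right]
    ring

/-- The vertices of a regular polygon are equally spaced on a circle. -/
theorem IsRegularPolygon.exists_isInscribed (hv : IsRegularPolygon v) :
    ∃ e₁ e₂ : E3, ∃ h ρ : ℝ, IsInscribed v e₁ e₂ h ρ := by
  obtain ⟨s, g, hs1, hs, hg⟩ := hv.exists_inner_eq
  have h3 := hv.1.three_le
  have hself : ∀ j : ℤ, (inner ℝ (vtx v j) (vtx v j) : ℝ) = 1 :=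
    fun j => inner_self_of_norm (vtx_norm v j)
  have hs' : ∀ j : ℤ, (inner ℝ (vtx v (j + 1)) (vtx v j) : ℝ) = s := fun j => by
    rw [real_inner_comm]; exact hs j
  have hg' : ∀ j : ℤ, (inner ℝ (vtx v (j + 2)) (vtx v j) : ℝ) = g := fun j => by
    rw [real_inner_comm]; exact hg j
  have hr := hv.1.vtx_add_three hs1 hs hg
  have hs1' : 0 < 1 - s := by nlinarith
  -- the edge vectors
  set d : ℤ → E3 := fun j => vtx v (j + 1) - vtx v j with hd
  have hdd : ∀ j, (inner ℝ (d j) (d j) : ℝ) = 2 * (1 - s) := by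
    intro j
    simp only [hd, inner_sub_left, inner_sub_right, hself, hs, hs']
    ring
  have hdd' : ∀ j, (inner ℝ (d j) (d (j + 1)) : ℝ) = 2 * s - 1 - g := by
    intro j
    simp only [hd, inner_sub_left, inner_sub_right, hself, hs]
    rw [show j + 1 + 1 = j + 2 by ring, hg]
    ring
  -- Consecutive edge vectors are not parallel, because three consecutive vertices have nonzero
  -- determinant; this makes `0 < θ < π`.
  have hlt : (2 * s - 1 - g) ^ 2 < (2 * (1 - s)) ^ 2 := by
    have hne : cr (d 0) (d 1) ≠ 0 := by
      intro h0
      have h1 : det3 (d 0) (d 1) (vtx v 0) = 0 := by rw [← inner_cr, h0, inner_zero_left]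
      have h2 := hv.1.det3_vtx_pos (p := 0) (q := 1) (r := 2) (by norm_num) (by norm_num) (by omega)
      have h4 : det3 (d 0) (d 1) (vtx v 0) = det3 (vtx v 0) (vtx v 1) (vtx v 2) := by
        simp only [hd, det3, PiLp.sub_apply, zero_add, one_add_one_eq_two]
        ring
      linarith
    have := real_inner_self_pos.2 hne
    have e := hdd' 0
    rw [zero_add] at e
    rw [inner_cr_cr, hdd, hdd, real_inner_comm (d 0) (d 1), e] at this
    linarith
  set τ := (2 * s - 1 - g) / (2 * (1 - s)) with hτ
  have hτ1 : τ ^ 2 < 1 := by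
    rw [hτ, div_pow, div_lt_one (by positivity)]; exact hlt
  set θ := Real.arccos τ with hθ
  have hcos : Real.cos θ = τ := Real.cos_arccos (by nlinarith) (by nlinarith)
  have hθ0 : 0 < θ := Real.arccos_pos.2 (by nlinarith)
  have hθpi : θ < Real.pi := by
    refine lt_of_le_of_ne (Real.arccos_le_pi _) fun h => ?_
    rw [h, Real.cos_pi] at hcos
    rw [← hcos] at hτ1
    norm_num at hτ1
  have hrec : ∀ j, d (j + 2) = (2 * Real.cos θ) • d (j + 1) - d j := by
    intro j
    have e := hr j
    have : 2 * Real.cos θ = (s - g) / (1 - s) - 1 := by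
      rw [hcos, hτ]; field_simp; ring
    rw [this]
    simp only [hd, show j + 2 + 1 = j + 3 by ring, show j + 1 + 1 = j + 2 by ring, e]
    module
  have hsin : 0 < Real.sin θ := Real.sin_pos_of_pos_of_lt_pi hθ0 hθpi
  have hhalf : 0 < Real.sin (θ / 2) :=
    Real.sin_pos_of_pos_of_lt_pi (by linarith) (by linarith)
  obtain ⟨r, hr0, hrr⟩ : ∃ r : ℝ, 0 < r ∧ r ^ 2 = 2 * (1 - s) :=
    ⟨√(2 * (1 - s)), Real.sqrt_pos.2 (by linarith), Real.sq_sqrt (by linarith)⟩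
  have hτ' : 2 * s - 1 - g = Real.cos θ * r ^ 2 := by
    rw [hcos, hrr, hτ]; field_simp
  obtain ⟨p, q, hpq, hdr⟩ := exists_isFrame_of_recurrence hr0 hsin (fun j => (hdd j).trans hrr.symm)
    (by have := hdd' 0; rw [zero_add, hτ'] at this; exact this) hrec
  obtain ⟨e₁, e₂, hf, hsub, hsup⟩ := hpq.exists_rotate θ
  -- A chord of length `r` subtending the angle `θ` belongs to a circle of this radius; `c` will be
  -- its Euclidean centre.
  set ρ := r / (2 * Real.sin (θ / 2)) with hρ
  have hρ0 : 0 < ρ := by positivity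
  set c := vtx v 0 - ρ • rad e₁ e₂ 0 with hc
  have hstep : ∀ j : ℤ, vtx v (j + 1) - vtx v j =
      ρ • rad e₁ e₂ ((j + 1 : ℤ) * θ) - ρ • rad e₁ e₂ (j * θ) := by
    intro j
    rw [← smul_sub, show ((j + 1 : ℤ) : ℝ) * θ = j * θ + θ by push_cast; ring, hsub, smul_smul, hρ,
      div_mul_cancel₀ _ (by positivity)]
    exact hdr j
  have hvc : ∀ j : ℤ, vtx v j = c + ρ • rad e₁ e₂ (j * θ) := by
    intro j
    induction j using Int.induction_on with
    | zero => simp [hc]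
    | succ j ih =>
      have := hstep j
      rw [ih] at this
      rw [sub_eq_iff_eq_add.1 this]; abel
    | pred j ih =>
      have := hstep (-j - 1)
      rw [sub_add_cancel, ih] at this
      have h1 := congrArg (fun z => c + ρ • rad e₁ e₂ ((-j : ℤ) * θ) - z) this
      simp only [sub_sub_cancel] at h1
      rw [h1]; abel
  -- Both ends of an edge have norm one and the same distance `ρ` from `c`, so `c` is orthogonal to
  -- the edge.
  have hcd : ∀ j : ℤ, (inner ℝ c (rad p q (j * θ)) : ℝ) = 0 := by
    intro j
    have h1 := hself j
    have h2 := hself (j + 1)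
    have h5 := hsub (j * θ)
    rw [hvc] at h1 h2
    simp only [inner_add_left, inner_add_right, real_inner_smul_left, real_inner_smul_right,
      hf.inner_rad, sub_self, Real.cos_zero, real_inner_comm c (rad e₁ e₂ _)] at h1 h2
    have h6 : (inner ℝ c (rad e₁ e₂ (j * θ + θ) - rad e₁ e₂ (j * θ)) : ℝ) = 0 := by
      rw [inner_sub_right, show (j : ℝ) * θ + θ = (j + 1 : ℤ) * θ by push_cast; ring]
      apply mul_left_cancel₀ hρ0.ne'
      linarith
    rw [h5, real_inner_smul_right] at h6
    exact (mul_eq_zero.1 h6).resolve_left (by positivity)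
  have hcp : (inner ℝ c p : ℝ) = 0 := by simpa [rad] using hcd 0
  have hcq : (inner ℝ c q : ℝ) = 0 := by
    have := hcd 1
    simp only [Int.cast_one, one_mul, rad, inner_add_right, real_inner_smul_right, hcp, mul_zero,
      zero_add] at this
    exact (mul_eq_zero.1 this).resolve_left hsin.ne'
  obtain ⟨hc1, hc2⟩ := hsup c hcp hcq
  set h := (inner ℝ (cr e₁ e₂) c : ℝ) with hh
  have hch : c = h • cr e₁ e₂ := by
    rw [← sub_eq_zero]
    apply eq_zero_of_orthogonal (norm_of_inner_self hf.inner_left)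
      (norm_of_inner_self hf.inner_right) (by rw [hf.inner_eq]; norm_num)
    · rw [inner_sub_left, real_inner_smul_left, hc1, inner_cr_left]; ring
    · rw [inner_sub_left, real_inner_smul_left, hc2, inner_cr_right]; ring
    · rw [← inner_cr, inner_sub_right, real_inner_smul_right, hf.inner_cr_self]; ring
  have hv' : ∀ j : ℤ, vtx v j = h • cr e₁ e₂ + ρ • rad e₁ e₂ (j * θ) := fun j => by
    rw [hvc, hch]
  have hdet : ∀ j : ℤ, det3 (vtx v 0) (vtx v 1) (vtx v j) =
      4 * h * ρ ^ 2 * (Real.sin (θ / 2) * Real.sin ((j - 1) * θ / 2) * Real.sin (j * θ / 2)) := by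
    intro j
    rw [hv' 0, hv' 1, hv' j, hf.det3_point]
    congr 4 <;> push_cast <;> ring
  have hh0 : 0 < h := by
    have h1 := hv.1.det3_vtx_pos (p := 0) (q := 1) (r := 2) (by norm_num) (by norm_num) (by omega)
    rw [hdet] at h1
    norm_num at h1
    by_contra hneg
    push Not at hneg
    have : 0 ≤ -h * (ρ ^ 2 * (Real.sin (θ / 2) * Real.sin (θ / 2) * Real.sin θ)) :=
      mul_nonneg (by linarith) (by positivity)
    nlinarith
  have hθn : θ = 2 * Real.pi / n := by
    apply eq_two_pi_div_of_sin_mul_pos h3 hθ0 hθpi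
    · have h1 := hf.inner_rad (n * θ) 0
      have h2 : rad e₁ e₂ (n * θ) = rad e₁ e₂ 0 := by
        have e1 := hv' 0
        have e2 := hv' (0 + n)
        rw [vtx_period, e1, Int.cast_zero, zero_mul] at e2
        have := smul_right_injective _ hρ0.ne' (add_left_cancel e2)
        simpa using this.symm
      rw [h2, hf.inner_rad] at h1
      simpa using h1.symm
    · intro j hj hjn
      have h1 := hv.1.det3_vtx_pos (p := 0) (q := 1) (r := j) (by norm_num) (by omega) (by omega)
      rw [hdet] at h1
      have h2 : 0 < 4 * h * ρ ^ 2 * Real.sin (θ / 2) := by positivity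
      have : 0 < (4 * h * ρ ^ 2 * Real.sin (θ / 2)) *
          (Real.sin ((j - 1) * θ / 2) * Real.sin (j * θ / 2)) := by
        push_cast at h1; linarith
      exact (pos_iff_pos_of_mul_pos this).1 h2
  refine ⟨e₁, e₂, h, ρ, hf, hh0, hρ0, ?_, fun j => by rw [hv', hθn]⟩
  have := hself 0
  rw [hv', hf.inner_point, sub_self, Real.cos_zero] at this
  linarith

end Regular

/-! ### Polygons inscribed in circles -/

/-- The normal of the great circle touching, at the vertex `i`, the circle through the vertices of
an inscribed polygon. -/
def tangentNormal (n : ℕ) (e₁ e₂ : E3) (h ρ : ℝ) (i : ℤ) : E3 :=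
  ρ • cr e₁ e₂ + (-h) • rad e₁ e₂ (i * (2 * Real.pi / n))

section Inscribed

variable {n : ℕ} [NeZero n] {v : Fin n → S2}

lemma vtx_coe (v : Fin n → S2) (i : Fin n) : vtx v (i : ℕ) = v i := by rw [vtx, cyc_coe]

lemma isSphConvex_openHemisphere (k : E3) : IsSphConvex {x : S2 | 0 < (inner ℝ k (x : E3) : ℝ)} := by
  intro a ha b hb
  rw [Set.mem_ofPred_eq] at ha hb
  constructor
  · rw [sphDist_eq]
    refine lt_of_le_of_ne (Real.arccos_le_pi _) fun h => ?_
    rw [Real.arccos_eq_pi] at h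
    have h3 := neg_one_lt_inner_of_ne a.norm b.norm (fun h' => by
      rw [h', inner_neg_right] at ha; linarith)
    linarith
  · rintro x ⟨s, t, hs, ht, hx⟩
    rw [Set.mem_ofPred_eq, hx, inner_add_right, real_inner_smul_right, real_inner_smul_right]
    rcases hs.eq_or_lt with rfl | hs
    · rcases ht.eq_or_lt with rfl | ht
      · rw [zero_smul, zero_smul, add_zero] at hx
        exact absurd hx (ne_zero_of_norm_one x.norm)
      · positivity
    · positivity

/-- The normal of a side is determined by its inner products with three vertices. -/
lemma IsConvexPolygon.eq_pole (hv : IsConvexPolygon v) {a : E3} {j : ℤ} (ha : ‖a‖ = 1)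
    (h1 : (inner ℝ a (vtx v j) : ℝ) = 0) (h2 : (inner ℝ a (vtx v (j + 1)) : ℝ) = 0)
    (h3 : 0 < (inner ℝ a (vtx v (j + 2)) : ℝ)) : a = pole v j := by
  have hn := hv.three_le
  have hpp := inner_self_of_norm (hv.pole_norm j)
  have haa := inner_self_of_norm ha
  have hsq : (inner ℝ (vtx v j) (vtx v (j + 1)) : ℝ) ^ 2 < 1 := by
    have := real_inner_self_pos.2 (hv.cr_ne_zero j)
    rw [inner_cr_cr, inner_self_of_norm (vtx_norm v _), inner_self_of_norm (vtx_norm v _),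
      real_inner_comm (vtx v j) (vtx v (j + 1))] at this
    linarith
  have he : a = (inner ℝ (pole v j) a : ℝ) • pole v j := by
    rw [← sub_eq_zero]
    apply eq_zero_of_orthogonal (vtx_norm v j) (vtx_norm v (j + 1)) hsq
    · rw [inner_sub_left, real_inner_smul_left, h1, inner_pole_left]; ring
    · rw [inner_sub_left, real_inner_smul_left, h2, inner_pole_right]; ring
    · have hp : (inner ℝ (pole v j) (a - (inner ℝ (pole v j) a : ℝ) • pole v j) : ℝ) = 0 := by
        rw [inner_sub_right, real_inner_smul_right, hpp]; ring
      have := norm_pos_iff.2 (hv.cr_ne_zero j)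
      rw [← inner_cr]
      nth_rw 1 [pole, real_inner_smul_left] at hp
      exact (mul_eq_zero.1 hp).resolve_left (by positivity)
  set t := (inner ℝ (pole v j) a : ℝ)
  have hpos := hv.inner_pole_pos (z := j) (w := j + 2) (by omega) (by omega)
  rw [he, real_inner_smul_left] at h3
  have ht : 0 < t := (pos_iff_pos_of_mul_pos h3).2 hpos
  rw [he, norm_smul, hv.pole_norm, mul_one, Real.norm_of_nonneg ht.le] at ha
  rw [he, ha, one_smul]

namespace IsInscribed

variable {e₁ e₂ : E3} {h ρ : ℝ}

lemma inner_vtx_vtx (hv : IsInscribed v e₁ e₂ h ρ) (i j : ℤ) :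
    (inner ℝ (vtx v i) (vtx v j) : ℝ) = h ^ 2 + ρ ^ 2 * Real.cos ((i - j) * (2 * Real.pi / n)) := by
  rw [hv.vtx_eq, hv.vtx_eq, hv.frame.inner_point, sub_mul]; ring

lemma inner_tangentNormal (hv : IsInscribed v e₁ e₂ h ρ) (i j : ℤ) :
    (inner ℝ (tangentNormal n e₁ e₂ h ρ i) (vtx v j) : ℝ) =
      ρ * h * (1 - Real.cos ((i - j) * (2 * Real.pi / n))) := by
  rw [hv.vtx_eq, tangentNormal, hv.frame.inner_point, sub_mul]; ring

lemma norm_tangentNormal (hv : IsInscribed v e₁ e₂ h ρ) (i : ℤ) :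
    ‖tangentNormal n e₁ e₂ h ρ i‖ = 1 := by
  apply norm_of_inner_self
  rw [tangentNormal, hv.frame.inner_point, sub_self, Real.cos_zero]
  linarith [hv.sq_add_sq]

lemma inner_tangentNormal_nonneg (hv : IsInscribed v e₁ e₂ h ρ) (i j : ℤ) :
    0 ≤ (inner ℝ (tangentNormal n e₁ e₂ h ρ i) (vtx v j) : ℝ) := by
  rw [hv.inner_tangentNormal]
  exact mul_nonneg (mul_nonneg hv.radius_pos.le hv.height_pos.le)
    (by linarith [Real.cos_le_one ((i - j) * (2 * Real.pi / n))])

lemma inner_tangentNormal_pos (hv : IsInscribed v e₁ e₂ h ρ) {i j : ℤ} (h1 : i < j)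
    (h2 : j < i + n) : 0 < (inner ℝ (tangentNormal n e₁ e₂ h ρ i) (vtx v j) : ℝ) := by
  refine lt_of_le_of_ne (hv.inner_tangentNormal_nonneg i j) fun h0 => ?_
  rw [hv.inner_tangentNormal] at h0
  have hcos : Real.cos ((i - j) * (2 * Real.pi / n)) = 1 := by
    have := (mul_eq_zero.1 h0.symm).resolve_left (mul_pos hv.radius_pos hv.height_pos).ne'
    linarith
  obtain ⟨K, hK⟩ := (Real.cos_eq_one_iff _).1 hcos
  have hn0 : (0 : ℝ) < n := by
    exact_mod_cast (Nat.pos_of_ne_zero (NeZero.ne n))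
  have hpi := Real.pi_pos
  have : (K * n : ℝ) = i - j := by
    field_simp at hK
    linarith
  have hKn : K * n = i - j := by exact_mod_cast this
  have hK1 : K < 0 := by
    by_contra hneg
    push Not at hneg
    have : 0 ≤ K * n := by positivity
    omega
  have : K * n ≤ -1 * n := mul_le_mul_of_nonneg_right (by omega) (by positivity)
  omega

lemma inner_center (hv : IsInscribed v e₁ e₂ h ρ) (j : ℤ) :
    (inner ℝ (cr e₁ e₂) (vtx v j) : ℝ) = h := by
  rw [hv.vtx_eq, inner_add_right, real_inner_smul_right, real_inner_smul_right,
    hv.frame.inner_cr_self, IsFrame.inner_cr_rad]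
  ring

/-- The open hemisphere of the tangent normal at a vertex contains all other vertices but not this
one, which keeps it out of their hull. The orientation follows from `det3_point`, whose half angles
lie in `(0, π)`. -/
theorem isConvexPolygon (hv : IsInscribed v e₁ e₂ h ρ) (hn : 3 ≤ n) : IsConvexPolygon v := by
  have hn0 : (0 : ℝ) < n := by exact_mod_cast (Nat.pos_of_ne_zero (NeZero.ne n))
  have hpi := Real.pi_pos
  refine ⟨hn, ⟨coneSet v, isSphConvex_coneSet (k := cr e₁ e₂) fun i => ?_, ?_⟩, fun i hi => ?_,
    fun i j h1 h2 => ?_⟩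
  · rw [← vtx_coe v i, hv.inner_center]; exact hv.height_pos
  · rintro _ ⟨i, rfl⟩
    exact vertex_mem_coneSet v i
  · have := hi {x : S2 | 0 < (inner ℝ (tangentNormal n e₁ e₂ h ρ (i : ℕ)) (x : E3) : ℝ)}
      ⟨isSphConvex_openHemisphere _, by
        rintro _ ⟨j, hj, rfl⟩
        obtain ⟨z, h1, h2, h3⟩ := exists_cyc_eq j ((i : ℕ) : ℤ)
        have hz : ((i : ℕ) : ℤ) ≠ z := by
          rintro h4
          rw [← h4, cyc_coe] at h3
          exact hj h3.symm
        have := hv.inner_tangentNormal_pos (lt_of_le_of_ne h1 hz) h2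
        rw [vtx, h3] at this
        exact this⟩
    rw [Set.mem_ofPred_eq, ← vtx_coe v i, hv.inner_tangentNormal] at this
    simp at this
  · obtain ⟨z, h3, h4, h5⟩ := exists_cyc_eq j ((i : ℕ) : ℤ)
    have hz1 : z ≠ (i : ℕ) := by
      rintro rfl; rw [cyc_coe] at h5; exact h1 h5.symm
    have hz2 : z ≠ (i : ℕ) + 1 := by
      rintro rfl; rw [cyc_add_one, cyc_coe] at h5; exact h2 h5.symm
    have e1 : ((v (i + 1) : S2) : E3) = vtx v ((i : ℕ) + 1) := by rw [vtx, cyc_add_one, cyc_coe]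
    have e2 : ((v j : S2) : E3) = vtx v z := by rw [vtx, h5]
    rw [orient_eq, ← vtx_coe v i, e1, e2, hv.vtx_eq, hv.vtx_eq, hv.vtx_eq, hv.frame.det3_point]
    obtain ⟨d, hd⟩ : ∃ d : ℕ, z = (i : ℕ) + 2 + (d : ℤ) := ⟨(z - (i : ℕ) - 2).toNat, by omega⟩
    have hdn : (d : ℝ) + 2 < n := by
      have : d + 2 < n := by omega
      exact_mod_cast this
    have hsin : ∀ t : ℝ, 0 < t → t < n → 0 < Real.sin (t * (2 * Real.pi / n) / 2) := by
      intro t ht0 htn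
      apply Real.sin_pos_of_pos_of_lt_pi
      · positivity
      · rw [show t * (2 * Real.pi / n) / 2 = t / n * Real.pi by ring]
        have : t / n < 1 := by rwa [div_lt_one hn0]
        nlinarith
    have s1 := hsin 1 one_pos (by linarith)
    have s2 := hsin (d + 1) (by positivity) (by linarith)
    have s3 := hsin (d + 2) (by positivity) hdn
    have hh := hv.height_pos
    have hρ := hv.radius_pos
    rw [hd]
    push_cast
    rw [← sub_mul, ← sub_mul, ← sub_mul, show ((i : ℕ) : ℝ) + 1 - (i : ℕ) = 1 by ring,
      show ((i : ℕ) : ℝ) + 2 + d - ((i : ℕ) + 1) = d + 1 by ring,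
      show ((i : ℕ) : ℝ) + 2 + d - (i : ℕ) = d + 2 by ring]
    positivity

lemma cos_sideLength (hv : IsInscribed v e₁ e₂ h ρ) (i : Fin n) :
    Real.cos (sideLength v i) = h ^ 2 + ρ ^ 2 * Real.cos (2 * Real.pi / n) := by
  have := hv.inner_vtx_vtx (i : ℕ) ((i : ℕ) + 1)
  rw [sideLength, cos_sphDist]
  rw [vtx, vtx, cyc_add_one, cyc_coe] at this
  rw [this, ← Real.cos_neg (2 * Real.pi / n)]
  congr 3
  push_cast; ring

lemma sideLength_eq (hv : IsInscribed v e₁ e₂ h ρ) (i : Fin n) :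
    sideLength v i = Real.arccos (h ^ 2 + ρ ^ 2 * Real.cos (2 * Real.pi / n)) := by
  rw [← hv.cos_sideLength i]
  exact (Real.arccos_cos (angle_nonneg _ _) (angle_le_pi _ _)).symm

theorem isRegularPolygon (hv : IsInscribed v e₁ e₂ h ρ) (hn : 3 ≤ n) : IsRegularPolygon v := by
  refine ⟨hv.isConvexPolygon hn, fun i j => by rw [hv.sideLength_eq, hv.sideLength_eq], ?_⟩
  set s := h ^ 2 + ρ ^ 2 * Real.cos (2 * Real.pi / n) with hs
  set g := h ^ 2 + ρ ^ 2 * Real.cos (2 * (2 * Real.pi / n)) with hg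
  have h1 : ∀ j : ℤ, (inner ℝ (vtx v j) (vtx v (j + 1)) : ℝ) = s := by
    intro j
    rw [hv.inner_vtx_vtx, hs, ← Real.cos_neg (2 * Real.pi / n)]
    congr 3
    push_cast; ring
  have h2 : ∀ j : ℤ, (inner ℝ (vtx v (j - 1)) (vtx v (j + 1)) : ℝ) = g := by
    intro j
    rw [hv.inner_vtx_vtx, hg, ← Real.cos_neg (2 * (2 * Real.pi / n))]
    congr 3
    push_cast; ring
  have key : ∀ i : Fin n, interiorAngle v i =
      Real.arccos ((g - s ^ 2) / (√(1 - s ^ 2) * √(1 - s ^ 2))) := by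
    intro i
    have e0 := h1 ((i : ℕ) - 1)
    have e1 := h1 (i : ℕ)
    have e2 := h2 (i : ℕ)
    rw [sub_add_cancel] at e0
    rw [vtx, vtx, cyc_sub_one, cyc_coe] at e0
    rw [vtx, vtx, cyc_add_one, cyc_coe] at e1
    rw [vtx, vtx, cyc_add_one, cyc_sub_one, cyc_coe] at e2
    have e0' : (inner ℝ (v i : E3) (v (i - 1) : E3) : ℝ) = s := by rw [real_inner_comm]; exact e0
    have e1' : (inner ℝ (v (i + 1) : E3) (v i : E3) : ℝ) = s := by rw [real_inner_comm]; exact e1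
    have n1 : ‖(v (i - 1) : E3) - s • (v i : E3)‖ = √(1 - s ^ 2) := by
      rw [← Real.sqrt_sq (norm_nonneg _), ← e0]
      exact congrArg _ (norm_sq_sub_smul (S2.norm _) (S2.norm _))
    have n2 : ‖(v (i + 1) : E3) - s • (v i : E3)‖ = √(1 - s ^ 2) := by
      rw [← Real.sqrt_sq (norm_nonneg _), ← e1']
      exact congrArg _ (norm_sq_sub_smul (S2.norm _) (S2.norm _))
    rw [interiorAngle, sphAngle, tangentTo, tangentTo, e0', e1, InnerProductGeometry.angle, n1, n2]
    congr 2
    simp only [inner_sub_left, inner_sub_right, real_inner_smul_left, real_inner_smul_right,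
      e0, e1, e2, S2.inner_self]
    ring
  intro i j
  rw [key, key]

end IsInscribed

end Inscribed

/-! ### Thickness of inscribed polygons -/

lemma cos_pi_div_pos {n : ℕ} (hn : 3 ≤ n) : 0 < Real.cos (Real.pi / n) := by
  have hpi := Real.pi_pos
  have hn3 : (3 : ℝ) ≤ n := by exact_mod_cast hn
  apply Real.cos_pos_of_mem_Ioo
  have h4 : 0 < Real.pi / n := by positivity
  exact ⟨by linarith, div_lt_div_of_pos_left hpi (by norm_num) (by linarith)⟩

section Thickness

variable {n : ℕ} [NeZero n] {v : Fin n → S2}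

/-- Only vertices on the great circle of `b` can carry weight in `x`. Two of them make `b` a side
normal; a single one is `x` itself. -/
lemma IsConvexPolygon.eq_pole_or_eq_vtx (hv : IsConvexPolygon v) {b : E3} (hb : ‖b‖ = 1)
    (hbC : b ∈ dualCone (polygon v)) {x : S2} (hx : x ∈ polygon v)
    (hbx : (inner ℝ b (x : E3) : ℝ) = 0) :
    (∃ j, b = pole v j) ∨ ∃ i : ℤ, (x : E3) = vtx v i := by
  have hpos := hv.mem_dualCone_iff.1 hbC
  rw [hv.polygon_eq] at hx
  obtain ⟨lam, hlam, hx⟩ := hx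
  have hterm : ∀ i, lam i * (inner ℝ b (v i : E3) : ℝ) = 0 := by
    rw [hx, inner_sum] at hbx
    simp only [real_inner_smul_right] at hbx
    have := (Finset.sum_eq_zero_iff_of_nonneg fun i _ => mul_nonneg (hlam i) (hpos i)).1 hbx
    exact fun i => this i (Finset.mem_univ i)
  obtain ⟨i, hi⟩ : ∃ i, lam i ≠ 0 := by
    by_contra hall
    push Not at hall
    rw [Finset.sum_eq_zero fun i _ => by rw [hall i, zero_smul]] at hx
    exact ne_zero_of_norm_one x.norm hx
  have hbi := (mul_eq_zero.1 (hterm i)).resolve_left hi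
  by_cases hl : ∃ l, l ≠ i ∧ lam l ≠ 0
  · left
    obtain ⟨l, hli, hl⟩ := hl
    have hbl := (mul_eq_zero.1 (hterm l)).resolve_left hl
    obtain ⟨z, h1, h2, h3⟩ := exists_cyc_eq l ((i : ℕ) : ℤ)
    have hz : ((i : ℕ) : ℤ) ≠ z := by
      rintro h4
      rw [← h4, cyc_coe] at h3
      exact hli h3.symm
    exact hv.exists_eq_pole hb hbC (lt_of_le_of_ne h1 hz) h2 (by rw [vtx_coe]; exact hbi)
      (by rw [vtx, h3]; exact hbl)
  · right
    push Not at hl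
    rw [Finset.sum_eq_single i (fun l _ hli => by rw [hl l hli, zero_smul]) (by simp)] at hx
    have h1 := x.norm
    rw [hx, norm_smul, S2.norm, mul_one, Real.norm_of_nonneg (hlam i)] at h1
    exact ⟨(i : ℕ), by rw [hx, h1, one_smul, vtx_coe]⟩

/-- One end of a width pair is the normal of a side. -/
lemma IsConvexPolygon.exists_widthPair_pole (hv : IsConvexPolygon v)
    (h0 : 0 < thickness (polygon v)) (h1 : thickness (polygon v) < Real.pi / 2) :
    ∃ j b, IsWidthPair (polygon v) (pole v j) b := by
  obtain ⟨a, b, hab⟩ := hv.exists_widthPair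
  have hp := hv.inner_widthPair hab
  have hc := cos_pos_of_lt h0 h1
  obtain ⟨x, hx, he⟩ := hab.exists_center hv.isSphConvexBody (by linarith)
  rw [hp, sqrt_one_sub_cos_sq h0 h1, neg_smul, sub_neg_eq_add] at he
  have hbx : (inner ℝ b (x : E3) : ℝ) = 0 := by
    have e : (inner ℝ b (Real.sin (thickness (polygon v)) • (x : E3)) : ℝ) = 0 := by
      rw [← he, inner_add_right, real_inner_smul_right, inner_self_of_norm hab.norm_right,
        real_inner_comm, hp]
      ring
    rw [real_inner_smul_right] at e
    exact (mul_eq_zero.1 e).resolve_left (sin_pos_of_lt h0 h1).ne'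
  rcases hv.eq_pole_or_eq_vtx hab.norm_right hab.right_mem hx hbx with ⟨j, rfl⟩ | ⟨i, hi⟩
  · exact ⟨j, a, hab.symm⟩
  · rw [hi] at he
    obtain ⟨j, rfl⟩ := hab.exists_eq_pole hv h0 h1 rfl he
    exact ⟨j, b, hab⟩

namespace IsInscribed

variable {e₁ e₂ : E3} {h ρ A B : ℝ} {m : ℕ}

/-- `A` and `B` are the sine and cosine of the inradius; the last equation is `tan inradius = tan
circumradius * cos (π / n)`. -/
lemma exists_apothem (hv : IsInscribed v e₁ e₂ h ρ) (hn : 3 ≤ n) :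
    ∃ A B : ℝ, 0 < A ∧ 0 < B ∧ A ^ 2 + B ^ 2 = 1 ∧ A * h = B * (ρ * Real.cos (Real.pi / n)) := by
  have hg := cos_pi_div_pos hn
  have hh := hv.height_pos
  have hρ := hv.radius_pos
  set g := ρ * Real.cos (Real.pi / n)
  have hg0 : 0 < g := by positivity
  have hsq : √(h ^ 2 + g ^ 2) ^ 2 = h ^ 2 + g ^ 2 := Real.sq_sqrt (by positivity)
  have hs0 : 0 < √(h ^ 2 + g ^ 2) := Real.sqrt_pos.2 (by positivity)
  refine ⟨g / √(h ^ 2 + g ^ 2), h / √(h ^ 2 + g ^ 2), by positivity, by positivity, ?_, by ring⟩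
  rw [div_pow, div_pow, hsq]
  field_simp
  ring

/-- The normal of the side opposite to the vertex `i`. -/
lemma pole_eq (hv : IsInscribed v e₁ e₂ h ρ) (hn : n = 2 * m + 1) (hn3 : 3 ≤ n) (hB : 0 < B)
    (hAB : A ^ 2 + B ^ 2 = 1) (hAh : A * h = B * (ρ * Real.cos (Real.pi / n)))
    (i : ℤ) :
    pole v (i + m) = A • cr e₁ e₂ + B • rad e₁ e₂ (i * (2 * Real.pi / n)) := by
  have hn0 : (0 : ℝ) < n := by exact_mod_cast (Nat.pos_of_ne_zero (NeZero.ne n))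
  have hpi := Real.pi_pos
  have hnm : (n : ℝ) = 2 * m + 1 := by rw [hn]; push_cast; ring
  symm
  apply (hv.isConvexPolygon hn3).eq_pole
  · apply norm_of_inner_self
    rw [hv.frame.inner_point, sub_self, Real.cos_zero]
    linarith
  · rw [hv.vtx_eq, hv.frame.inner_point, hAh, ← sub_mul,
      show ((i : ℝ) - (i + m : ℤ)) * (2 * Real.pi / n) = Real.pi / n - Real.pi by
        push_cast; field_simp; rw [hnm]; ring, Real.cos_sub_pi]
    ring
  · rw [hv.vtx_eq, hv.frame.inner_point, hAh, ← sub_mul,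
      show ((i : ℝ) - (i + m + 1 : ℤ)) * (2 * Real.pi / n) = -(Real.pi / n + Real.pi) by
        push_cast; field_simp; rw [hnm]; ring, Real.cos_neg, Real.cos_add_pi]
    ring
  · have hρ := hv.radius_pos
    rw [hv.vtx_eq, hv.frame.inner_point, hAh, ← sub_mul,
      show ((i : ℝ) - (i + m + 2 : ℤ)) * (2 * Real.pi / n) = -(3 * (Real.pi / n) + Real.pi) by
        push_cast; field_simp; rw [hnm]; ring, Real.cos_neg, Real.cos_add_pi]
    have hn3' : (3 : ℝ) ≤ n := by exact_mod_cast hn3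
    have h4 : 0 < Real.pi / n := by positivity
    -- This fixes the sign of the normal at a third vertex; `3 * (π / n) ≤ π` because `n ≥ 3`.
    have := Real.cos_lt_cos_of_nonneg_of_le_pi h4.le (y := 3 * (Real.pi / n)) (by
      rw [← mul_div_assoc, div_le_iff₀ hn0]; nlinarith) (by linarith)
    have : 0 < B * ρ * (Real.cos (Real.pi / n) - Real.cos (3 * (Real.pi / n))) :=
      mul_pos (by positivity) (by linarith)
    linarith

lemma tangentNormal_mem (hv : IsInscribed v e₁ e₂ h ρ) (hn3 : 3 ≤ n) (i : ℤ) :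
    tangentNormal n e₁ e₂ h ρ i ∈ dualCone (polygon v) :=
  (hv.isConvexPolygon hn3).mem_dualCone_iff.2 fun l => by
    rw [← vtx_coe v l]; exact hv.inner_tangentNormal_nonneg i _

lemma inner_pole_tangentNormal (hv : IsInscribed v e₁ e₂ h ρ) (hn : n = 2 * m + 1) (hn3 : 3 ≤ n)
    (hB : 0 < B) (hAB : A ^ 2 + B ^ 2 = 1)
    (hAh : A * h = B * (ρ * Real.cos (Real.pi / n))) (i : ℤ) :
    (inner ℝ (pole v (i + m)) (tangentNormal n e₁ e₂ h ρ i) : ℝ) = -(B * h - A * ρ) := by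
  rw [hv.pole_eq hn hn3 hB hAB hAh, tangentNormal, hv.frame.inner_point, sub_self, Real.cos_zero]
  ring

/-- The centre of the circle is a positive combination of the vertices `0`, `m`, `m + 1`, hence a
point of the polygon up to scaling. -/
lemma inner_center_nonneg (hv : IsInscribed v e₁ e₂ h ρ) (hn : n = 2 * m + 1) (hn3 : 3 ≤ n)
    {b : E3} (hb : b ∈ dualCone (polygon v)) : 0 ≤ (inner ℝ b (cr e₁ e₂) : ℝ) := by
  have hn0 : (0 : ℝ) < n := by exact_mod_cast (Nat.pos_of_ne_zero (NeZero.ne n))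
  have hnm : (n : ℝ) = 2 * m + 1 := by rw [hn]; push_cast; ring
  have hg := cos_pi_div_pos hn3
  have hh := hv.height_pos
  have hmem := fun z => (hv.isConvexPolygon hn3).inner_vtx_nonneg hb z
  have r0 : rad e₁ e₂ (m * (2 * Real.pi / n)) + rad e₁ e₂ ((m + 1 : ℤ) * (2 * Real.pi / n)) =
      (-2 * Real.cos (Real.pi / n)) • rad e₁ e₂ 0 := by
    rw [show (m : ℝ) * (2 * Real.pi / n) = -(Real.pi / n) + Real.pi by
        field_simp; rw [hnm]; ring,
      show ((m + 1 : ℤ) : ℝ) * (2 * Real.pi / n) = Real.pi / n + Real.pi by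
        push_cast; field_simp; rw [hnm]; ring]
    simp only [rad, Real.cos_add_pi, Real.sin_add_pi, Real.cos_neg, Real.sin_neg, Real.cos_zero,
      Real.sin_zero]
    module
  have hsum : vtx v m + vtx v (m + 1) + (2 * Real.cos (Real.pi / n)) • vtx v 0 =
      (2 * h * (1 + Real.cos (Real.pi / n))) • cr e₁ e₂ := by
    rw [hv.vtx_eq, hv.vtx_eq, hv.vtx_eq, Int.cast_zero, zero_mul]
    have r1 : rad e₁ e₂ ((m + 1 : ℤ) * (2 * Real.pi / n)) =
        (-2 * Real.cos (Real.pi / n)) • rad e₁ e₂ 0 - rad e₁ e₂ (m * (2 * Real.pi / n)) :=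
      eq_sub_of_add_eq' r0
    rw [r1, Int.cast_natCast]
    module
  have hin := congrArg (fun z => (inner ℝ b z : ℝ)) hsum
  simp only [inner_add_right, real_inner_smul_right] at hin
  have hpos : 0 ≤ (2 * h * (1 + Real.cos (Real.pi / n))) * (inner ℝ b (cr e₁ e₂) : ℝ) := by
    rw [← hin]
    have := hmem m
    have := hmem (m + 1)
    have := hmem 0
    positivity
  exact nonneg_of_mul_nonneg_right hpos (by positivity)

/-- The right side is the cosine of inradius plus circumradius. A side and the tangent at the
opposite vertex give a lune of this thickness; conversely, some width pair contains a side normal,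
and its partner is nonnegative at the opposite vertex and at the centre. -/
theorem cos_thickness (hv : IsInscribed v e₁ e₂ h ρ) (hn : n = 2 * m + 1) (hn3 : 3 ≤ n)
    (hB : 0 < B) (hAB : A ^ 2 + B ^ 2 = 1)
    (hAh : A * h = B * (ρ * Real.cos (Real.pi / n))) (h0 : 0 < thickness (polygon v))
    (h1 : thickness (polygon v) < Real.pi / 2) :
    Real.cos (thickness (polygon v)) = B * h - A * ρ := by
  have hc := hv.isConvexPolygon hn3
  obtain ⟨j, b, hp⟩ := hc.exists_widthPair_pole h0 h1
  have hpi := hc.inner_widthPair hp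
  have hcos := cos_pos_of_lt h0 h1
  have hhρ := hv.sq_add_sq
  have hh := hv.height_pos
  have hρ := hv.radius_pos
  obtain ⟨i, rfl⟩ : ∃ i : ℤ, j = i + m := ⟨j - m, by ring⟩
  have hle := hp.inner_le (hc.pole_norm (i + m)) (hv.norm_tangentNormal i) (hc.pole_mem _)
    (hv.tangentNormal_mem hn3 i)
  rw [hv.inner_pole_tangentNormal hn hn3 hB hAB hAh, hpi] at hle
  apply le_antisymm _ (by linarith)
  have hvb := hc.inner_vtx_nonneg hp.right_mem i
  have ho := hv.inner_center_nonneg hn hn3 hp.right_mem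
  have htb := (abs_le.1 (abs_inner_le_one hp.norm_right (hv.norm_tangentNormal i))).2
  have hpe := hv.pole_eq hn hn3 hB hAB hAh i
  have hve := hv.vtx_eq i
  rw [tangentNormal] at htb
  rw [hpe, real_inner_comm] at hpi
  rw [hve] at hvb
  simp only [inner_add_right, real_inner_smul_right] at hvb htb hpi
  set p := (inner ℝ b (cr e₁ e₂) : ℝ)
  set q := (inner ℝ b (rad e₁ e₂ (i * (2 * Real.pi / n))) : ℝ)
  -- In the first case the side normal is `(A * h + B * ρ)` times the vertex minus `(B * h - A * ρ)`
  -- times the tangent normal, whose product with `b` is at most `1`. In the second, `ρ` times the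
  -- side normal is a nonnegative combination of vertex and centre, contradicting the negative
  -- product `hpi`.
  rcases le_or_gt 0 (B * h - A * ρ) with hk | hk
  · have hAh0 : 0 ≤ A * h := by
      rw [hAh]; have := cos_pi_div_pos hn3; positivity
    have e1 := mul_nonneg (by positivity : 0 ≤ A * h + B * ρ) hvb
    have e2 := mul_nonneg hk (by linarith : 0 ≤ 1 - (ρ * p + -h * q))
    have : (A * h + B * ρ) * (h * p + ρ * q) - (B * h - A * ρ) * (ρ * p + -h * q) =
        A * p + B * q := by
      linear_combination (A * p + B * q) * hhρ
    linarith
  · exfalso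
    have e1 := mul_nonneg hB.le hvb
    have e2 := mul_nonneg (by linarith : 0 ≤ -(B * h - A * ρ)) ho
    have : ρ * (A * p + B * q) = B * (h * p + ρ * q) + -(B * h - A * ρ) * p := by ring
    rw [hpi] at this
    nlinarith

end IsInscribed

end Thickness

/-! ### Regular polygons with an odd number of vertices -/

section Reduced

variable {n : ℕ} [NeZero n] {v : Fin n → S2}

lemma IsConvexPolygon.thickness_pos (hv : IsConvexPolygon v) : 0 < thickness (polygon v) := by
  obtain ⟨a, b, hab⟩ := hv.exists_widthPair
  have hne := hab.ne (hv.pole_norm 0) (hv.pole_norm (0 + 1)) (hv.pole_mem 0) (hv.pole_mem (0 + 1))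
    (hv.pole_ne 0)
  have hneg := ne_neg_of_mem_dualCone hv.isSphConvexBody.2.2 (ne_zero_of_norm_one hab.norm_left)
    hab.left_mem hab.right_mem
  rw [hab.thickness_eq hv.isSphConvexBody.2.2 hne, Real.arccos_pos]
  linarith [neg_one_lt_inner_of_ne hab.norm_left hab.norm_right hneg]

namespace IsInscribed

variable {e₁ e₂ : E3} {h ρ : ℝ} {m : ℕ}

lemma eq_vtx_of_inner_tangentNormal (hv : IsInscribed v e₁ e₂ h ρ) (hn3 : 3 ≤ n) (i : Fin n)
    {x : S2} (hx : x ∈ polygon v)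
    (h0 : (inner ℝ (tangentNormal n e₁ e₂ h ρ (i : ℕ)) (x : E3) : ℝ) = 0) : x = v i := by
  have hc := hv.isConvexPolygon hn3
  rw [hc.polygon_eq] at hx
  obtain ⟨lam, hlam, hx⟩ := hx
  have hpos := hc.mem_dualCone_iff.1 (hv.tangentNormal_mem hn3 (i : ℕ))
  rw [hx, inner_sum] at h0
  simp only [real_inner_smul_right] at h0
  have hterm := (Finset.sum_eq_zero_iff_of_nonneg fun l _ => mul_nonneg (hlam l) (hpos l)).1 h0
  have hl : ∀ l, l ≠ i → lam l = 0 := by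
    intro l hli
    obtain ⟨z, h1, h2, h3⟩ := exists_cyc_eq l ((i : ℕ) : ℤ)
    have hz : ((i : ℕ) : ℤ) ≠ z := by
      rintro h4
      rw [← h4, cyc_coe] at h3
      exact hli h3.symm
    have := hv.inner_tangentNormal_pos (lt_of_le_of_ne h1 hz) h2
    rw [vtx, h3] at this
    exact (mul_eq_zero.1 (hterm l (Finset.mem_univ l))).resolve_right this.ne'
  rw [Finset.sum_eq_single i (fun l _ hli => by rw [hl l hli, zero_smul]) (by simp)] at hx
  have h1 := x.norm
  rw [hx, norm_smul, S2.norm, mul_one, Real.norm_of_nonneg (hlam i)] at h1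
  rw [h1, one_smul] at hx
  exact S2.ext' hx

/-- A smaller body misses some vertex, so the tangent normal `t` there is bounded below on it by
some `δ > 0`. Then `t - δ • u` still supports the body and, normalised, lies farther than `t` from
the opposite side normal `u`. -/
theorem isReducedBody (hv : IsInscribed v e₁ e₂ h ρ) (hn : n = 2 * m + 1) (hn3 : 3 ≤ n)
    (hlt : thickness (polygon v) < Real.pi / 2) : IsReducedBody (polygon v) := by
  have hc := hv.isConvexPolygon hn3
  refine ⟨hc.isSphConvexBody, fun R hR hRv => ?_⟩
  obtain ⟨A, B, -, hB, hAB, hAh⟩ := hv.exists_apothem hn3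
  have hpos := hc.thickness_pos
  have hcos := hv.cos_thickness hn hn3 hB hAB hAh hpos hlt
  have hk0 := cos_pos_of_lt hpos hlt
  obtain ⟨i, hi⟩ : ∃ i, v i ∉ R := by
    by_contra hall
    push Not at hall
    refine hRv.2 (Set.sInter_subset_of_mem ⟨hR.2.1, ?_⟩)
    rintro _ ⟨i, rfl⟩
    exact hall i
  set u := pole v ((i : ℕ) + m) with hu
  set t := tangentNormal n e₁ e₂ h ρ (i : ℕ) with ht
  have hut : (inner ℝ u t : ℝ) = -Real.cos (thickness (polygon v)) := by
    rw [hcos]; exact hv.inner_pole_tangentNormal hn hn3 hB hAB hAh _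
  have hu1 : ‖u‖ = 1 := hc.pole_norm _
  have ht1 : ‖t‖ = 1 := hv.norm_tangentNormal _
  have huR : u ∈ dualCone R := dualCone_anti hRv.1 (hc.pole_mem _)
  obtain ⟨x₀, hx₀, hmin⟩ := hR.1.isCompact.exists_isMinOn (hR.2.2.mono interior_subset)
    (f := fun x : S2 => (inner ℝ t (x : E3) : ℝ)) (by fun_prop)
  set δ := (inner ℝ t (x₀ : E3) : ℝ) with hδ
  have hδ0 : 0 < δ := by
    refine lt_of_le_of_ne (hv.tangentNormal_mem hn3 _ _ (hRv.1 hx₀)) fun h0 => hi ?_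
    rw [← hv.eq_vtx_of_inner_tangentNormal hn3 i (hRv.1 hx₀) h0.symm]
    exact hx₀
  set w := t - δ • u with hw
  set k := Real.cos (thickness (polygon v)) with hk
  have hwR : w ∈ dualCone R := by
    intro x hx
    have h1 : δ ≤ (inner ℝ t (x : E3) : ℝ) := hmin hx
    have h2 := (abs_le.1 (abs_inner_le_one hu1 x.norm)).2
    rw [hw, inner_sub_left, real_inner_smul_left]
    nlinarith
  have hk1 : k < 1 := by
    have := sin_pos_of_lt hpos hlt
    nlinarith [Real.sin_sq_add_cos_sq (thickness (polygon v))]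
  have huw : (inner ℝ u w : ℝ) = -(k + δ) := by
    rw [hw, inner_sub_right, real_inner_smul_right, hut, inner_self_of_norm hu1]; ring
  have hww : ‖w‖ ^ 2 = 1 + 2 * δ * k + δ ^ 2 := by
    rw [← real_inner_self_eq_norm_sq]
    nth_rw 1 [hw]
    rw [inner_sub_left, real_inner_smul_left, huw, hw, inner_sub_right, real_inner_smul_right,
      real_inner_comm u t, hut, inner_self_of_norm ht1]
    ring
  have hw0 : w ≠ 0 := by
    intro h0
    rw [h0, inner_zero_right] at huw
    linarith
  have hwn : 0 < ‖w‖ := norm_pos_iff.2 hw0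
  have hb1 : ‖‖w‖⁻¹ • w‖ = 1 := by
    rw [norm_smul, norm_inv, norm_norm, inv_mul_cancel₀ hwn.ne']
  have hub : -(inner ℝ u (‖w‖⁻¹ • w) : ℝ) = (k + δ) / ‖w‖ := by
    rw [real_inner_smul_right, huw]; ring
  -- After squaring, the difference is `(1 - k ^ 2) * (2 * k * δ + δ ^ 2)`.
  have hklt : k < (k + δ) / ‖w‖ := by
    rw [lt_div_iff₀ hwn]
    refine lt_of_pow_lt_pow_left₀ 2 (by linarith) ?_
    rw [mul_pow, hww]
    have h2 : 0 < (1 - k ^ 2) * (2 * k * δ + δ ^ 2) := mul_pos (by nlinarith) (by positivity)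
    nlinarith
  have hne : u ≠ ‖w‖⁻¹ • w := by
    intro he
    rw [← he, inner_self_of_norm hu1] at hub
    linarith
  calc thickness R ≤ Real.arccos (-(inner ℝ u (‖w‖⁻¹ • w) : ℝ)) :=
        thickness_le hR.2.2 hu1 hb1 huR (dualCone_smul hwR (by positivity)) hne
    _ < Real.arccos k := by
        apply Real.arccos_lt_arccos (by linarith) (by rw [hub]; exact hklt)
        linarith [(abs_le.1 (abs_inner_le_one hu1 hb1)).1]
    _ = thickness (polygon v) := by
        rw [hk, Real.arccos_cos hpos.le (by linarith [Real.pi_pos])]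

/-- The half side `y` of a regular polygon with an odd number of vertices, in terms of the
thickness. -/
theorem exists_perim_eq (hv : IsInscribed v e₁ e₂ h ρ) (hn : n = 2 * m + 1) (hn3 : 3 ≤ n)
    (hlt : thickness (polygon v) < Real.pi / 2) :
    ∃ y : ℝ, 0 < y ∧ y < Real.pi / 2 ∧ perim v = 2 * (n * y) ∧
      Real.cos y * (Real.cos y - Real.cos (thickness (polygon v))) /
        (1 - Real.cos y * Real.cos (thickness (polygon v))) = Real.cos (Real.pi / n) := by
  obtain ⟨A, B, hA, hB, hAB, hAh⟩ := hv.exists_apothem hn3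
  have hpos := (hv.isConvexPolygon hn3).thickness_pos
  have hcos := hv.cos_thickness hn hn3 hB hAB hAh hpos hlt
  have hk0 := cos_pos_of_lt hpos hlt
  have hk1 : Real.cos (thickness (polygon v)) < 1 := by
    have := sin_pos_of_lt hpos hlt
    nlinarith [Real.sin_sq_add_cos_sq (thickness (polygon v))]
  have hg := cos_pi_div_pos hn3
  have hh := hv.height_pos
  have hρ := hv.radius_pos
  have hhρ := hv.sq_add_sq
  have hn3' : (3 : ℝ) ≤ n := by exact_mod_cast hn3
  have hpi := Real.pi_pos
  have hsg : 0 < Real.sin (Real.pi / n) := by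
    apply Real.sin_pos_of_pos_of_lt_pi (by positivity)
    rw [div_lt_iff₀ (by linarith)]
    nlinarith
  have hsc := Real.sin_sq_add_cos_sq (Real.pi / n)
  have hside := hv.sideLength_eq
  rw [show 2 * Real.pi / n = 2 * (Real.pi / n) by ring, Real.cos_two_mul] at hside
  set γ := Real.cos (Real.pi / n)
  set s := h ^ 2 + ρ ^ 2 * (2 * γ ^ 2 - 1) with hs
  have hs1 : s < 1 := by
    have : 0 < ρ ^ 2 * (1 - γ ^ 2) := mul_pos (by positivity) (by nlinarith)
    nlinarith
  have hs2 : -1 < s := by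
    have : 0 < ρ ^ 2 * γ ^ 2 := by positivity
    nlinarith
  have hap : 0 < Real.arccos s := Real.arccos_pos.2 hs1
  have hal : Real.arccos s < Real.pi := by
    refine lt_of_le_of_ne (Real.arccos_le_pi _) fun he => ?_
    rw [Real.arccos_eq_pi] at he
    linarith
  refine ⟨Real.arccos s / 2, by linarith, by linarith, ?_, ?_⟩
  · rw [perim, Finset.sum_congr rfl fun i _ => hside i]
    simp
    ring
  · have hc0 : 0 < Real.cos (Real.arccos s / 2) :=
      Real.cos_pos_of_mem_Ioo ⟨by linarith, by linarith⟩
    have hc2 : Real.cos (Real.arccos s / 2) ^ 2 = h ^ 2 + (ρ * γ) ^ 2 := by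
      rw [Real.cos_sq, mul_div_cancel₀ _ (two_ne_zero' ℝ), Real.cos_arccos hs2.le hs1.le, hs]
      linear_combination -hhρ / 2
    set c := Real.cos (Real.arccos s / 2)
    -- This and `hAc` are relations in the right triangle formed by the centre, a vertex and the
    -- midpoint of a side: `cos circumradius = cos inradius * cos y`, and its companion for the
    -- sines.
    have hBc : B * c = h := by
      rw [← sq_eq_sq₀ (by positivity) hh.le, mul_pow, hc2]
      linear_combination h ^ 2 * hAB - (A * h + B * (ρ * γ)) * hAh
    have hAc : A * c = ρ * γ := by
      apply mul_left_cancel₀ hB.ne'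
      rw [← hAh, ← hBc]; ring
    have hden : 0 < 1 - c * Real.cos (thickness (polygon v)) :=
      one_sub_mul_pos hk0 hk1 (Real.cos_le_one _)
    rw [div_eq_iff hden.ne', hcos, ← hBc]
    rw [← hBc] at hhρ
    linear_combination γ * hhρ - c ^ 2 * hAB + (ρ + A * c) * hAc

end IsInscribed

end Reduced

/-! ### Existence -/

lemma exists_isFrame : ∃ e₁ e₂ : E3, IsFrame e₁ e₂ :=
  ⟨EuclideanSpace.single 0 1, EuclideanSpace.single 1 1, by simp, by simp,
    by simp [inner_coord]⟩

lemma rad_add_int_mul (e₁ e₂ : E3) (φ : ℝ) (K : ℤ) :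
    rad e₁ e₂ (φ + K * (2 * Real.pi)) = rad e₁ e₂ φ := by
  rw [rad, rad, Real.cos_add_int_mul_two_pi, Real.sin_add_int_mul_two_pi]

lemma exists_isInscribed (n : ℕ) [NeZero n] {h ρ : ℝ} (hh : 0 < h) (hρ : 0 < ρ)
    (hhρ : h ^ 2 + ρ ^ 2 = 1) : ∃ v : Fin n → S2, ∃ e₁ e₂ : E3, IsInscribed v e₁ e₂ h ρ := by
  obtain ⟨e₁, e₂, hf⟩ := exists_isFrame
  have hn0 : (n : ℝ) ≠ 0 := by exact_mod_cast NeZero.ne n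
  refine ⟨fun i => S2.mk (h • cr e₁ e₂ + ρ • rad e₁ e₂ ((i : ℕ) * (2 * Real.pi / n)))
    (norm_of_inner_self (by
      rw [hf.inner_point, sub_self, Real.cos_zero]; linarith)), e₁, e₂, hf, hh, hρ, hhρ,
    fun j => ?_⟩
  rw [vtx, S2.coe_mk]
  have h1 : (((cyc n j : Fin n) : ℕ) : ℤ) + n * (j / n) = j := by
    rw [coe_cyc]; exact Int.emod_add_mul_ediv j n
  have h2 : (((cyc n j : Fin n) : ℕ) : ℝ) + n * (j / n : ℤ) = j := by exact_mod_cast h1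
  rw [← rad_add_int_mul e₁ e₂ _ (j / n), ← h2]
  congr 3
  field_simp

/-- Here `r` is the circumradius and `ω - r` the inradius. The difference of the two sides changes
sign between `r = 0` and `r = ω`. -/
lemma exists_radius {ω γ : ℝ} (h0 : 0 < ω) (hω : ω < Real.pi / 2) (hγ : 0 < γ) :
    ∃ r, 0 < r ∧ r < ω ∧
      Real.sin (ω - r) * Real.cos r = Real.cos (ω - r) * (Real.sin r * γ) := by
  have hs := sin_pos_of_lt h0 hω
  have hcont : ContinuousOn (fun r => Real.sin (ω - r) * Real.cos r -
      Real.cos (ω - r) * (Real.sin r * γ)) (Set.Icc 0 ω) := by fun_prop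
  have hpos : 0 < Real.sin ω * γ := mul_pos hs hγ
  obtain ⟨r, hr, he⟩ := intermediate_value_Icc' h0.le hcont
    (show (0 : ℝ) ∈ Set.Icc _ _ by simpa using ⟨hpos.le, hs.le⟩)
  simp only at he
  refine ⟨r, lt_of_le_of_ne hr.1 ?_, lt_of_le_of_ne hr.2 ?_, by linarith⟩
  · rintro rfl
    simp at he
    linarith
  · rintro rfl
    simp at he
    rcases he with he | he <;> linarith

/-- The lune of a side and the opposite tangent shows that the thickness is at most `ω`, hence below
`π / 2`. Then `cos_thickness` applies and gives equality. -/
theorem exists_isRegularPolygon {n m : ℕ} [NeZero n] (hn : n = 2 * m + 1) (hn3 : 3 ≤ n) {ω : ℝ}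
    (h0 : 0 < ω) (hω : ω < Real.pi / 2) :
    ∃ v : Fin n → S2, IsRegularPolygon v ∧ thickness (polygon v) = ω := by
  obtain ⟨r, hr0, hrω, hr⟩ := exists_radius h0 hω (cos_pi_div_pos hn3)
  have hsc := Real.sin_sq_add_cos_sq r
  obtain ⟨v, e₁, e₂, hv⟩ := exists_isInscribed n (cos_pos_of_lt hr0 (hrω.trans hω))
    (sin_pos_of_lt hr0 (hrω.trans hω)) (by linarith)
  refine ⟨v, hv.isRegularPolygon hn3, ?_⟩
  have hc := hv.isConvexPolygon hn3
  have hB : 0 < Real.cos (ω - r) := cos_pos_of_lt (by linarith) (by linarith)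
  have hAB := Real.sin_sq_add_cos_sq (ω - r)
  have hcos : Real.cos (ω - r) * Real.cos r - Real.sin (ω - r) * Real.sin r = Real.cos ω := by
    rw [← Real.cos_add, sub_add_cancel]
  have hin := hv.inner_pole_tangentNormal hn hn3 hB hAB hr 0
  rw [hcos] at hin
  have hcω := cos_pos_of_lt h0 hω
  have hle : thickness (polygon v) ≤ ω := by
    have := thickness_le hc.isSphConvexBody.2.2 (hc.pole_norm (0 + m)) (hv.norm_tangentNormal 0)
      (hc.pole_mem _) (hv.tangentNormal_mem hn3 0) (fun he => by
        rw [he, inner_self_of_norm (hv.norm_tangentNormal 0)] at hin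
        linarith)
    rwa [hin, neg_neg, Real.arccos_cos h0.le (by linarith [Real.pi_pos])] at this
  have hpos := hc.thickness_pos
  have := hv.cos_thickness hn hn3 hB hAB hr hpos (by linarith)
  rw [hcos] at this
  have hpi := Real.pi_pos
  exact Real.injOn_cos ⟨hpos.le, by linarith⟩ ⟨h0.le, by linarith⟩ this

end

/-! ### The theorem on perimeters -/

theorem theorem3p3 (n : ℕ) [NeZero n] (hn : 3 ≤ n) (ω : ℝ) (hω : 0 < ω)
    (hω' : ω < Real.pi / 2) :
    (Odd n → ∃ v : Fin n → S2, IsRegularPolygon v ∧ thickness (polygon v) = ω) ∧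
    ∀ v : Fin n → S2, IsRegularPolygon v → thickness (polygon v) = ω →
      (Odd n → IsReducedBody (polygon v)) ∧
      ∀ w : Fin n → S2, IsConvexPolygon w → IsReducedBody (polygon w) →
        thickness (polygon w) = ω → perim v ≤ perim w := by
  refine ⟨fun ⟨m, hm⟩ => exists_isRegularPolygon hm hn hω hω', fun v hv hvω => ?_⟩
  obtain ⟨e₁, e₂, h, ρ, hins⟩ := hv.exists_isInscribed
  refine ⟨fun ⟨m, hm⟩ => hins.isReducedBody hm hn (hvω ▸ hω'), fun w hw hr hwω => ?_⟩
  -- The oddness of `n` comes from `w`, so the inequality needs no parity assumption; it also makes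
  -- the odd case available for `v`.
  obtain ⟨m, hm, hchord⟩ := exists_opposite_chords hw hr hω hω' hwω
  obtain ⟨y, hy0, hy, hperim, hyn⟩ := hins.exists_perim_eq hm hn (hvω ▸ hω')
  rw [hvω] at hyn
  rw [hperim]
  exact HasOppositeChords.le_perim ⟨hw, hω, hω', hwω, hm, hchord⟩ hy0 hy hyn
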